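/- **Theorem (De Giorgi conjecture on the cylinder).** Let $d\ge 1$ be an integer and $\Omega_d=\mathbb R\times\mathbb T^{d-1}$, $\mathbb T=\mathbb R/\mathbb Z$, with points $w=(x,y)$. Let $H:\mathbb R^d\to\mathbb R$, put $K(x,y)=\sum_{j\in\mathbb Z^{d-1}}H(x,y+j)$ and $$(\mathcal L u)(w)=\mathrm{P.V.}\int_{\Omega_d}(u(w)-u(w'))\,K(w-w')\,dw' .$$ For $\nu=(\xi,k)\in\mathbb R\times\mathbb Z^{d-1}$ let $\hat u(\nu)=\int_{\Omega_d}e^{-2\pi i(x\xi+y\cdot k)}u(x,y)\,dx\,dy$ (extended to $L^2(\Omega_d)$ in the usual way), and let $H^1(\Omega_d)=\{v\in L^2(\Omega_d): |\nu|\hat v\in L^2(\mathbb R\times\mathbb Z^{d-1})\}$. Assume: - (A) there are constants $c,C>0$ and a real function $\sigma$ with $c|\nu|\le\sigma(\nu)\le C|\nu|$ for all $\nu$ such that $\widehat{\mathcal L\varphi}(\nu)=\sigma(\nu)\hat\varphi(\nu)$ for all $\nu$ and all $\varphi\in C_c^\infty(\Omega_d)$ (where $\mathcal L\varphi$ exists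 everywhere and is integrable); - (B) $H$ is positive and continuous on $\mathbb R^d\setminus\{0\}$; - (C) $H(az)=a^{-d-1}H(z)$ for all $z\ne0$ and $a>0$; - (D) $H(z)=H(-z)$ for all $z$. Let $\gamma\in C^\infty(\mathbb R)$ satisfy $\gamma>0$ on $(-1,1)$, $\gamma(\pm1)=0$ and $\gamma''(\pm1)>0$. Let $\eta\in C^\infty(\mathbb R)$ satisfy $\eta=1$ on $[1,\infty)$ and $\eta=-1$ on $(-\infty,-1]$, regarded also as a function of $(x,y)$. Let $u:\Omega_d\to\mathbb R$ be such that $u-\eta\in H^1(\Omega_d)$, and let $u$ be a layer solution of $\mathcal Lu+\gamma'(u)=0$: for almost every $w\in\Omega_d$ the principal value $(\mathcal Lu)(w)$ exists and $(\mathcal Lu)(w)+\gamma'(u(w))=0$; and for every $(x,y)\in\Omega_d$ the derivative $\partial_xu(x,y)$ exists and is positive, and $\lim_{x\to\pm\infty}u(x,y)=\pm1$. Then $u$ depends only on $x$: there is $\phi:\mathbb R\to\mathbb R$ with $u(x,y)=\phi(x)$ for almost every $(x,y)\in\Omega_d$; and this holds for every $(x,y)\in\Omega_d$ if $u$ is continuous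 or if the equation holds at every point of $\Omega_d$. -/

import Mathlib

open MeasureTheory Filter Topology
open scoped ContDiff

noncomputable section

namespace DeGiorgi

/-- The cylinder `Ω_d = ℝ × 𝕋^(d-1)` with `𝕋 = ℝ/ℤ`, `d ≥ 1`. A point is `(x, y)`. -/
abbrev Cyl (d : ℕ) : Type := ℝ × (Fin (d - 1) → UnitAddCircle)

/-- The universal cover `ℝ^d = ℝ × ℝ^(d-1)` of the cylinder. -/
abbrev Cover (d : ℕ) : Type := ℝ × (Fin (d - 1) → ℝ)

/-- The covering projection `ℝ^d → Ω_d`. -/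
def proj {d : ℕ} (z : Cover d) : Cyl d := (z.1, fun i => (z.2 i : UnitAddCircle))

/-- The representative in `ℝ × [0,1)^(d-1)` of a point of the cylinder. -/
def rep {d : ℕ} (w : Cyl d) : Cover d :=
  (w.1, fun i => ((AddCircle.equivIco (1 : ℝ) 0 (w.2 i) : Set.Ico (0 : ℝ) (0 + 1)) : ℝ))

/-- The translate `(x, y + j)` of `(x, y)` by an integer vector `j`. -/
def shift {d : ℕ} (z : Cover d) (j : Fin (d - 1) → ℤ) : Cover d :=
  (z.1, fun i => z.2 i + (j i : ℝ))

/-- The kernel on the cylinder, `K(x, y) = ∑_{j ∈ ℤ^(d-1)} H(x, y + j)`. -/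
def periodize {d : ℕ} (H : Cover d → ℝ) (w : Cyl d) : ℝ :=
  ∑' j : Fin (d - 1) → ℤ, H (shift (rep w) j)

theorem proj_rep {d : ℕ} (w : Cyl d) : proj (rep w) = w := by
  refine Prod.ext rfl (funext fun i => ?_)
  exact AddCircle.coe_equivIco

/-- `K` does not depend on the representative. -/
theorem periodize_proj {d : ℕ} (H : Cover d → ℝ) (z : Cover d) :
    periodize H (proj z) = ∑' j : Fin (d - 1) → ℤ, H (shift z j) := by
  have h : ∀ i, ∃ m : ℤ, (rep (proj z)).2 i + (m : ℝ) = z.2 i := by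
    intro i
    have h1 := congrFun (congrArg Prod.snd (proj_rep (proj z))) i
    have h2 : ((z.2 i - (rep (proj z)).2 i : ℝ) : UnitAddCircle) = 0 := by
      rw [AddCircle.coe_sub, sub_eq_zero]
      exact h1.symm
    obtain ⟨m, hm⟩ := (AddCircle.coe_eq_zero_iff (1 : ℝ)).1 h2
    refine ⟨m, ?_⟩
    have : (m : ℝ) = z.2 i - (rep (proj z)).2 i := by simpa using hm
    linarith
  choose m hm using h
  rw [periodize, ← (Equiv.addLeft m).tsum_eq]
  refine tsum_congr fun j => congrArg H (Prod.ext rfl (funext fun i => ?_))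
  simp only [shift, Equiv.coe_addLeft, Pi.add_apply, Int.cast_add]
  rw [← hm i]
  ring

/-- The Euclidean (geodesic) distance to the origin on `Ω_d`; on the circle `‖·‖` is the
distance to the nearest integer. -/
def cylNorm {d : ℕ} (w : Cyl d) : ℝ := Real.sqrt (w.1 ^ 2 + ∑ i, ‖w.2 i‖ ^ 2)

/-- `(𝓛u)(w) = ℓ`: the principal value `P.V. ∫_{Ω_d} (u(w) - u(w')) K(w - w') dw'` exists and
equals `ℓ`. -/
def HasL {d : ℕ} (H : Cover d → ℝ) (u : Cyl d → ℝ) (w : Cyl d) (l : ℝ) : Prop :=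
  Tendsto (fun ε : ℝ => ∫ w' in {w' : Cyl d | ε < cylNorm (w - w')},
    (u w - u w') * periodize H (w - w')) (𝓝[>] 0) (𝓝 l)

/-- `|ν|` for a frequency `ν = (ξ, k) ∈ ℝ × ℤ^(d-1)`. -/
def freqNorm {d : ℕ} (ξ : ℝ) (k : Fin (d - 1) → ℤ) : ℝ :=
  Real.sqrt (ξ ^ 2 + ∑ i, (k i : ℝ) ^ 2)

/-- The character `e^{-2πi k·y}` of the torus. -/
def torusChar {d : ℕ} (k : Fin (d - 1) → ℤ) (y : Fin (d - 1) → UnitAddCircle) : ℂ :=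
  ∏ i, fourier (-(k i)) (y i)

/-- The Fourier integral `∫_{Ω_d} e^{-2πi(xξ + y·k)} f(x,y) dx dy` of an integrable function. -/
def fourierInt {d : ℕ} (f : Cyl d → ℝ) (ξ : ℝ) (k : Fin (d - 1) → ℤ) : ℂ :=
  ∫ w : Cyl d, Complex.exp (-(2 * Real.pi * Complex.I * (w.1 * ξ))) * torusChar k w.2 * (f w : ℂ)

/-- The `k`-th Fourier coefficient of `f` in the periodic variables, a function of `x`. -/
def torusCoeff {d : ℕ} (f : Cyl d → ℝ) (k : Fin (d - 1) → ℤ) (x : ℝ) : ℂ :=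
  ∫ y : Fin (d - 1) → UnitAddCircle, torusChar k y * (f (x, y) : ℂ)

/-- `f ∈ H^s(Ω_d)`: `f ∈ L²(Ω_d)` and `|ν|^s f̂ ∈ L²(ℝ × ℤ^(d-1))`. The Fourier transform of
`f ∈ L²` is the Fourier series in `y` (the coefficients `g k` lie in `L²(ℝ)`) followed by the
`L²` Fourier transform in `x`. -/
def MemH {d : ℕ} (s : ℝ) (f : Cyl d → ℝ) : Prop :=
  MemLp f 2 ∧
  ∃ g : (Fin (d - 1) → ℤ) → Lp ℂ 2 (volume : Measure ℝ),
    (∀ k, (g k : ℝ → ℂ) =ᵐ[volume] torusCoeff f k) ∧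
    ∑' k, ∫⁻ ξ : ℝ, ENNReal.ofReal (freqNorm ξ k ^ s) ^ 2 *
      ‖(FourierTransform.fourier (g k) : Lp ℂ 2 (volume : Measure ℝ)) ξ‖ₑ ^ 2 < (⊤ : ENNReal)

/-- Test functions on the cylinder: smooth with compact support. -/
def IsTest {d : ℕ} (φ : Cyl d → ℝ) : Prop :=
  ContDiff ℝ ∞ (fun z : Cover d => φ (proj z)) ∧ HasCompactSupport φ

/-- The assumptions on `𝓛` and on its kernel `H : ℝ^d → ℝ`. -/
structure KernelAssumptions (d : ℕ) (H : Cover d → ℝ) : Prop where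
  /-- (A) `𝓛` is a Fourier multiplier whose symbol is comparable with `|ν|`. -/
  symbol : ∃ (σ : ℝ → (Fin (d - 1) → ℤ) → ℝ) (c C : ℝ), 0 < c ∧ 0 < C ∧
    (∀ ξ k, c * freqNorm ξ k ≤ σ ξ k ∧ σ ξ k ≤ C * freqNorm ξ k) ∧
    ∀ φ : Cyl d → ℝ, IsTest φ → ∃ Lφ : Cyl d → ℝ, (∀ w, HasL H φ w (Lφ w)) ∧ Integrable Lφ ∧
      ∀ ξ k, fourierInt Lφ ξ k = (σ ξ k : ℂ) * fourierInt φ ξ k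
  /-- (B) positivity -/
  pos : ∀ z, z ≠ 0 → 0 < H z
  /-- (B) continuity -/
  cont : ContinuousOn H {z | z ≠ 0}
  /-- (C) homogeneity of degree `-d-1` -/
  homog : ∀ (z : Cover d) (a : ℝ), z ≠ 0 → 0 < a → H (a • z) = a ^ (-(d : ℤ) - 1) * H z
  /-- (D) symmetry -/
  symm : ∀ z, H z = H (-z)

/-- Smooth double-well type potentials. -/
structure IsDoubleWell (γ : ℝ → ℝ) : Prop where
  smooth : ContDiff ℝ ∞ γ
  pos : ∀ x, -1 < x → x < 1 → 0 < γ x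
  left : γ (-1) = 0
  right : γ 1 = 0
  left_convex : 0 < deriv (deriv γ) (-1)
  right_convex : 0 < deriv (deriv γ) 1

/-- Smooth reference profiles equal to `-1` on `(-∞,-1]` and to `1` on `[1,∞)`. -/
structure IsProfile (η : ℝ → ℝ) : Prop where
  smooth : ContDiff ℝ ∞ η
  right : ∀ x, 1 ≤ x → η x = 1
  left : ∀ x, x ≤ -1 → η x = -1

/-- The equation `𝓛u(w) + γ'(u(w)) = 0` holds at the point `w`. -/
def SolvesAt {d : ℕ} (H : Cover d → ℝ) (γ : ℝ → ℝ) (u : Cyl d → ℝ) (w : Cyl d) : Prop :=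
  ∃ l, HasL H u w l ∧ l + deriv γ (u w) = 0

/-- Layer solutions: the equation holds (almost everywhere), `∂u/∂x > 0` everywhere, and
`u(x,y) → ±1` as `x → ±∞` for every `y`. -/
structure IsLayerSolution {d : ℕ} (H : Cover d → ℝ) (γ : ℝ → ℝ) (u : Cyl d → ℝ) : Prop where
  solves : ∀ᵐ w : Cyl d, SolvesAt H γ u w
  differentiable : ∀ x y, DifferentiableAt ℝ (fun t => u (t, y)) x
  deriv_pos : ∀ x y, 0 < deriv (fun t => u (t, y)) x
  tendsto_top : ∀ y, Tendsto (fun x => u (x, y)) atTop (𝓝 1)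
  tendsto_bot : ∀ y, Tendsto (fun x => u (x, y)) atBot (𝓝 (-1))

end DeGiorgi

end

/-!
Difference quotients of `u` in a torus direction `(0, b)` are bounded in `L²` and converge there:
the spectral measure of `u - η` has finite second moment because `u - η ∈ H¹`. Their limit `w`
satisfies the same linearised equation as `v = ∂ₓu > 0`. Testing the Wronskian `v 𝓛w - w 𝓛v`, which
vanishes by the equation, against `arctan (w / v)` and symmetrising the double integral gives

  `∬ (arctan (w/v)(p) - arctan (w/v)(q)) (w(p) v(q) - w(q) v(p)) K(p - q) dp dq = 0`,

whose integrand is nonnegative, so that `w = c v`. The integral of `w` over `[0,1] × 𝕋^(d-1)` is a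
limit of zeros, whereas `v` is positive there; hence `c = 0`, and iterating the difference quotients
shows that `u` is invariant under all translations of the torus. Where the equation holds
everywhere, so does the symmetry: `K` has infinite mass near the origin, so at a given `x` the
principal value can exist for only one value of `u`.
-/

open scoped ComplexConjugate RealInnerProductSpace FourierTransform

noncomputable section

namespace DeGiorgi

/-! ### Haar measure on the cylinder and its cover -/

instance : IsProbabilityMeasure (volume : Measure UnitAddCircle) :=
  ⟨by simp⟩

instance (n : ℕ) : Measure.IsAddHaarMeasure (volume : Measure (Fin n → UnitAddCircle)) :=
  inferInstanceAs (Measure.IsAddHaarMeasure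
    (Measure.pi fun _ => volume : Measure (Fin n → UnitAddCircle)))

instance (d : ℕ) : Measure.IsAddHaarMeasure (volume : Measure (Cyl d)) :=
  inferInstanceAs (Measure.IsAddHaarMeasure (Measure.prod volume volume))

instance (d : ℕ) : Measure.IsAddHaarMeasure (volume : Measure (Cover d)) :=
  inferInstanceAs (Measure.IsAddHaarMeasure (Measure.prod volume volume))

instance (d : ℕ) : Measure.Regular (volume : Measure (Cyl d)) :=
  Measure.Regular.of_sigmaCompactSpace_of_isLocallyFiniteMeasure _

instance (d : ℕ) : Measure.IsNegInvariant (volume : Measure (Cyl d)) :=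
  Measure.IsAddHaarMeasure.isNegInvariant_of_regular _

instance (d : ℕ) : Measure.IsNegInvariant (volume : Measure (Cover d)) :=
  Measure.IsAddHaarMeasure.isNegInvariant_of_regular _

instance (d : ℕ) : NullSingletonClass (volume : Measure (Cyl d)) :=
  inferInstanceAs (NullSingletonClass (Measure.prod volume volume))

/-! ### Parseval on the torus -/

section Parseval

variable {ι : Type*} [Fintype ι]

theorem hasSum_parseval_pi_haarAddCircle {F G : (ι → UnitAddCircle) → ℂ}
    (hF : MemLp F 2 (Measure.pi fun _ => AddCircle.haarAddCircle))
    (hG : MemLp G 2 (Measure.pi fun _ => AddCircle.haarAddCircle)) :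
    HasSum (fun k : ι → ℤ =>
        conj (∫ y, UnitAddTorus.mFourier (-k) y * F y
          ∂Measure.pi fun _ => AddCircle.haarAddCircle) *
        ∫ y, UnitAddTorus.mFourier (-k) y * G y ∂Measure.pi fun _ => AddCircle.haarAddCircle)
      (∫ y, conj (F y) * G y ∂Measure.pi fun _ => AddCircle.haarAddCircle) := by
  have coeff_toLp {E : (ι → UnitAddCircle) → ℂ}
      (hE : MemLp E 2 (Measure.pi fun _ => AddCircle.haarAddCircle)) (k : ι → ℤ) :
      UnitAddTorus.mFourierCoeff (hE.toLp E) k =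
        ∫ y, UnitAddTorus.mFourier (-k) y * E y ∂Measure.pi fun _ => AddCircle.haarAddCircle :=
    integral_congr_ae (hE.coeFn_toLp.mono fun y hy => by simp only [smul_eq_mul, hy])
  have parseval := UnitAddTorus.hasSum_prod_mFourierCoeff (hF.toLp F) (hG.toLp G)
  simp only [coeff_toLp] at parseval
  convert parseval using 1
  refine integral_congr_ae ?_
  filter_upwards [hF.coeFn_toLp, hG.coeFn_toLp] with y hFy hGy
  rw [hFy, hGy]

theorem pi_haarAddCircle (ι : Type*) [Fintype ι] :
    (Measure.pi fun _ : ι => (AddCircle.haarAddCircle : Measure UnitAddCircle)) =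
      (volume : Measure (ι → UnitAddCircle)) := by
  have volume_eq : (volume : Measure UnitAddCircle) = AddCircle.haarAddCircle := by
    simpa only [ENNReal.ofReal_one, one_smul] using AddCircle.volume_eq_smul_haarAddCircle (T := 1)
  rw [volume_pi, volume_eq]

theorem hasSum_parseval {F G : (ι → UnitAddCircle) → ℂ} (hF : MemLp F 2) (hG : MemLp G 2) :
    HasSum (fun k : ι → ℤ => conj (∫ y, UnitAddTorus.mFourier (-k) y * F y) *
      ∫ y, UnitAddTorus.mFourier (-k) y * G y) (∫ y, conj (F y) * G y) := by
  rw [← pi_haarAddCircle] at hF hG ⊢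
  exact hasSum_parseval_pi_haarAddCircle hF hG

end Parseval

/-! ### Translation and the Fourier transform on `L²` -/

section Modulation

variable {V F : Type*} [NormedAddCommGroup V] [InnerProductSpace ℝ V] [FiniteDimensional ℝ V]
  [MeasurableSpace V] [BorelSpace V] [NormedAddCommGroup F] [InnerProductSpace ℂ F]

theorem memLp_fourierChar_smul (a : V) {g : V → F} (hg : MemLp g 2) :
    MemLp (fun ξ => Real.fourierChar ⟪a, ξ⟫ • g ξ) 2 := by
  have continuous_char : Continuous fun ξ : V => Real.fourierChar ⟪a, ξ⟫ :=
    Real.continuous_fourierChar.comp (by fun_prop)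
  exact hg.of_le (continuous_char.aestronglyMeasurable.smul hg.1)
    (ae_of_all _ fun ξ => (Circle.norm_smul _ _).le)

/-- Multiplication by the character `ξ ↦ e^{2πi⟪a, ξ⟫}` on `L²`, the Fourier side of the
translation `g ↦ g(· + a)`. -/
def modulation (a : V) (g : Lp F 2 (volume : Measure V)) : Lp F 2 (volume : Measure V) :=
  (memLp_fourierChar_smul a (Lp.memLp g)).toLp

theorem coeFn_modulation (a : V) (g : Lp F 2 (volume : Measure V)) :
    modulation a g =ᵐ[volume] fun ξ => Real.fourierChar ⟪a, ξ⟫ • g ξ :=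
  MemLp.coeFn_toLp _

theorem isometry_modulation (a : V) :
    Isometry (modulation a : Lp F 2 (volume : Measure V) → Lp F 2 (volume : Measure V)) := by
  refine Isometry.of_dist_eq fun g h => ?_
  rw [dist_eq_norm, dist_eq_norm, modulation, modulation, ← MemLp.toLp_sub, Lp.norm_toLp,
    Lp.norm_def]
  congr 1
  refine eLpNorm_congr_norm_ae ?_
  filter_upwards [Lp.coeFn_sub g h] with ξ hξ
  rw [hξ, Pi.sub_apply, Pi.sub_apply, ← smul_sub, Circle.norm_smul]

theorem toLp_compSubConst_neg (f : SchwartzMap V F) (a : V) :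
    (f.compSubConstCLM ℂ (-a)).toLp 2 =
      Lp.compMeasurePreserving _ (measurePreserving_add_right volume a) (f.toLp 2) := by
  apply Lp.ext
  filter_upwards [Lp.coeFn_compMeasurePreserving (f.toLp 2) (measurePreserving_add_right volume a),
    (measurePreserving_add_right volume a).quasiMeasurePreserving.ae
      (SchwartzMap.coeFn_toLp f 2 volume),
    SchwartzMap.coeFn_toLp (f.compSubConstCLM ℂ (-a)) 2 volume] with x hcomp hf hshift
  rw [hcomp, hshift, SchwartzMap.compSubConstCLM_apply, sub_neg_eq_add, ← hf, Function.comp_apply]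

theorem fourier_compSubConst_neg (f : SchwartzMap V F) (a ξ : V) :
    𝓕 (f.compSubConstCLM ℂ (-a)) ξ = Real.fourierChar ⟪a, ξ⟫ • 𝓕 f ξ := by
  have coe_shift : ⇑(f.compSubConstCLM ℂ (-a)) = ⇑f ∘ fun v => v + a := by
    ext v
    rw [SchwartzMap.compSubConstCLM_apply, sub_neg_eq_add, Function.comp_apply]
  rw [SchwartzMap.fourier_coe, SchwartzMap.fourier_coe, coe_shift]
  exact congrFun (VectorFourier.fourierIntegral_comp_add_right Real.fourierChar volume
    (innerₗ V) (⇑f) a) ξ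

variable [CompleteSpace F]

theorem fourier_compMeasurePreserving_add_right (g : Lp F 2 (volume : Measure V)) (a : V) :
    𝓕 (Lp.compMeasurePreserving _ (measurePreserving_add_right volume a) g) =
      modulation a (𝓕 g) := by
  have continuous_fourier : Continuous (𝓕 : Lp F 2 (volume : Measure V) → Lp F 2 volume) :=
    (Lp.fourierTransformₗᵢ V F).continuous
  have continuous_translate : Continuous fun g : Lp F 2 (volume : Measure V) =>
      Lp.compMeasurePreserving _ (measurePreserving_add_right volume a) g :=
    (Lp.isometry_compMeasurePreserving (measurePreserving_add_right volume a)).continuous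
  have dense_schwartz : DenseRange (SchwartzMap.toLpCLM ℝ F 2 (volume : Measure V)) :=
    SchwartzMap.denseRange_toLpCLM ENNReal.ofNat_ne_top
  refine dense_schwartz.induction_on (p := fun g : Lp F 2 (volume : Measure V) =>
    𝓕 (Lp.compMeasurePreserving _ (measurePreserving_add_right volume a) g) =
      modulation a (𝓕 g)) g (isClosed_eq ?_ ?_) fun f => ?_
  · exact continuous_fourier.comp continuous_translate
  · exact (isometry_modulation a).continuous.comp continuous_fourier
  · rw [SchwartzMap.toLpCLM_apply, ← toLp_compSubConst_neg, SchwartzMap.toLp_fourier_eq,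
      SchwartzMap.toLp_fourier_eq]
    apply Lp.ext
    filter_upwards [coeFn_modulation a ((𝓕 f).toLp 2),
      SchwartzMap.coeFn_toLp (𝓕 (f.compSubConstCLM ℂ (-a))) 2 volume,
      SchwartzMap.coeFn_toLp (𝓕 f) 2 volume] with ξ hmod hshift hf
    rw [hmod, hshift, hf, fourier_compSubConst_neg]

theorem integral_inner_translate (g : Lp F 2 (volume : Measure V)) (a : V) :
    ∫ x, inner ℂ (g x) (g (x + a)) =
      ∫ ξ, (Real.fourierChar ⟪a, ξ⟫ : ℂ) * ((‖𝓕 g ξ‖ ^ 2 : ℝ) : ℂ) := by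
  have plancherel := Lp.inner_fourier_eq g
    (Lp.compMeasurePreserving _ (measurePreserving_add_right volume a) g)
  rw [fourier_compMeasurePreserving_add_right, L2.inner_def, L2.inner_def] at plancherel
  trans ∫ x, inner ℂ (g x) ((Lp.compMeasurePreserving _ (measurePreserving_add_right volume a) g) x)
  · refine integral_congr_ae ?_
    filter_upwards [Lp.coeFn_compMeasurePreserving g (measurePreserving_add_right volume a)]
      with x hx
    rw [hx, Function.comp_apply]
  rw [← plancherel]
  refine integral_congr_ae ?_
  filter_upwards [coeFn_modulation a (𝓕 g)] with ξ hξ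
  rw [hξ, Circle.smul_def, inner_smul_right, inner_self_eq_norm_sq_to_K]
  push_cast
  rfl

theorem lintegral_enorm_sq_fourier (g : Lp F 2 (volume : Measure V)) :
    ∫⁻ ξ, ‖(𝓕 g : Lp F 2 (volume : Measure V)) ξ‖ₑ ^ 2 = ∫⁻ x, ‖g x‖ₑ ^ 2 := by
  have lintegral_eq_norm_sq (h : Lp F 2 (volume : Measure V)) :
      ∫⁻ ξ, ‖h ξ‖ₑ ^ 2 = ENNReal.ofReal (‖h‖ ^ 2) := by
    rw [Lp.norm_def, ← ENNReal.toReal_pow, ENNReal.ofReal_toReal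
      (ENNReal.pow_ne_top (Lp.eLpNorm_ne_top h)),
      eLpNorm_eq_lintegral_rpow_enorm_toReal (by norm_num) (by norm_num),
      ← ENNReal.rpow_natCast, ← ENNReal.rpow_mul]
    norm_num
  rw [lintegral_eq_norm_sq, lintegral_eq_norm_sq, Lp.norm_fourier_eq]

end Modulation

/-! ### The spectral measure of an `H¹` function -/

section Characters

variable {ι : Type*} [Fintype ι]

theorem norm_mFourier_apply (k : ι → ℤ) (y : ι → UnitAddCircle) :
    ‖UnitAddTorus.mFourier k y‖ = 1 := by
  simp only [UnitAddTorus.mFourier, ContinuousMap.coe_mk, norm_prod, fourier_apply,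
    Circle.norm_coe, Finset.prod_const_one]

theorem mFourier_apply_add (k : ι → ℤ) (y z : ι → UnitAddCircle) :
    UnitAddTorus.mFourier k (y + z) = UnitAddTorus.mFourier k y * UnitAddTorus.mFourier k z := by
  simp only [UnitAddTorus.mFourier, ContinuousMap.coe_mk, Pi.add_apply,
    fourier_apply, smul_add, AddCircle.toCircle_add, Circle.coe_mul, Finset.prod_mul_distrib]

/-- Frequencies `ν = (ξ, k)`, i.e. the dual group of the cylinder. -/
abbrev Freq (d : ℕ) : Type := ℝ × (Fin (d - 1) → ℤ)

/-- The character `e^{2πi(xξ + y·k)}` of the cylinder with frequency `ν = (ξ, k)`. -/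
def cylChar {d : ℕ} (ν : Freq d) : AddChar (Cyl d) Circle where
  toFun w := Real.fourierChar (w.1 * ν.1) * ∏ i, AddCircle.toCircle (ν.2 i • w.2 i)
  map_zero_eq_one' := by simp
  map_add_eq_mul' v w := by
    simp only [Prod.fst_add, Prod.snd_add, Pi.add_apply, add_mul, AddChar.map_add_eq_mul, smul_add,
      AddCircle.toCircle_add, Finset.prod_mul_distrib]
    exact mul_mul_mul_comm _ _ _ _

variable {d : ℕ}

theorem coe_cylChar (ν : Freq d) (w : Cyl d) :
    (cylChar ν w : ℂ) = Real.fourierChar (w.1 * ν.1) * UnitAddTorus.mFourier ν.2 w.2 := by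
  change ((Real.fourierChar (w.1 * ν.1) * ∏ i, AddCircle.toCircle (ν.2 i • w.2 i) : Circle) : ℂ) = _
  rw [Circle.coe_mul]
  exact congrArg _ (map_prod Circle.coeHom _ _)

theorem cylChar_sub (ν : Freq d) (v w : Cyl d) :
    (cylChar ν (v - w) : ℂ) = cylChar ν v * conj (cylChar ν w : ℂ) := by
  rw [sub_eq_add_neg, AddChar.map_add_eq_mul, AddChar.map_neg_eq_inv, Circle.coe_mul,
    Circle.coe_inv_eq_conj]

theorem cylChar_re_le_one (ν : Freq d) (w : Cyl d) : (cylChar ν w : ℂ).re ≤ 1 :=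
  (Complex.re_le_norm _).trans (Circle.norm_coe _).le

theorem continuous_cylChar (ν : Freq d) : Continuous fun w : Cyl d => (cylChar ν w : ℂ) := by
  simp only [coe_cylChar]
  exact (continuous_subtype_val.comp (Real.continuous_fourierChar.comp (by fun_prop))).mul
    ((UnitAddTorus.mFourier ν.2).continuous.comp continuous_snd)

theorem measurable_cylChar {α : Type*} [MeasurableSpace α] {ν : α → Freq d} {w : α → Cyl d}
    (hν : Measurable ν) (hw : Measurable w) : Measurable fun x => (cylChar (ν x) (w x) : ℂ) := by
  have measurable_mFourier : Measurable fun p : (Fin (d - 1) → ℤ) × (Fin (d - 1) → UnitAddCircle) =>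
      UnitAddTorus.mFourier p.1 p.2 :=
    measurable_from_prod_countable_right fun k => (UnitAddTorus.mFourier k).continuous.measurable
  have measurable_line : Measurable fun t : ℝ => (Real.fourierChar t : ℂ) :=
    (continuous_subtype_val.comp Real.continuous_fourierChar).measurable
  simp only [coe_cylChar]
  exact (measurable_line.comp (f := fun x => (w x).1 * (ν x).1) (hw.fst.mul hν.fst)).mul
    (measurable_mFourier.comp (f := fun x => ((ν x).2, (w x).2)) (hν.snd.prodMk hw.snd))

theorem measurable_freqNorm : Measurable fun ν : Freq d => freqNorm ν.1 ν.2 := by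
  refine Measurable.sqrt (.add (by fun_prop) (Finset.measurable_sum _ fun i _ => ?_))
  exact ((measurable_from_top (f := fun n : ℤ => (n : ℝ))).comp
    ((measurable_pi_apply i).comp measurable_snd)).pow_const 2

end Characters

section TorusCoeff

variable {d : ℕ} {f : Cyl d → ℝ} {g : (Fin (d - 1) → ℤ) → Lp ℂ 2 (volume : Measure ℝ)}

theorem torusChar_eq_mFourier_neg (k : Fin (d - 1) → ℤ) (y : Fin (d - 1) → UnitAddCircle) :
    torusChar (d := d) k y = UnitAddTorus.mFourier (-k) y := rfl

theorem integral_mFourier_mul_translate (f : Cyl d → ℝ) (a : Cyl d) (k : Fin (d - 1) → ℤ) (x : ℝ) :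
    ∫ y, UnitAddTorus.mFourier (-k) y * (f ((x, y) + a) : ℂ) =
      UnitAddTorus.mFourier k a.2 * torusCoeff f k (x + a.1) := by
  have mFourier_mul_neg : UnitAddTorus.mFourier k a.2 * UnitAddTorus.mFourier (-k) a.2 = 1 := by
    rw [UnitAddTorus.mFourier_neg, Complex.mul_conj', norm_mFourier_apply]
    norm_num
  rw [torusCoeff, ← integral_const_mul, ← integral_add_right_eq_self
    (fun y => UnitAddTorus.mFourier k a.2 * (torusChar (d := d) k y * (f (x + a.1, y) : ℂ))) a.2]
  refine integral_congr_ae (ae_of_all _ fun y => ?_)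
  simp only [torusChar_eq_mFourier_neg, mFourier_apply_add, Prod.add_def]
  linear_combination
    (-UnitAddTorus.mFourier (-k) y * (f (x + a.1, y + a.2) : ℂ)) * mFourier_mul_neg

theorem ae_memLp_two_section {α β : Type*} [MeasurableSpace α] [MeasurableSpace β] {μ : Measure α}
    {ν : Measure β} [SFinite μ] [SFinite ν] {F : α × β → ℝ} (hF : MemLp F 2 (μ.prod ν)) :
    ∀ᵐ x ∂μ, MemLp (fun y => F (x, y)) 2 ν := by
  filter_upwards [hF.1.prodMk_left, hF.integrable_sq.prod_right_ae] with x meas_section int_sq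
  exact (memLp_two_iff_integrable_sq meas_section).2 int_sq

theorem memLp_translate {G : Type*} [AddGroup G] [MeasurableSpace G] [MeasurableAdd G]
    {μ : Measure G} [μ.IsAddRightInvariant] {F : G → ℝ} (hF : MemLp F 2 μ) (a : G) :
    MemLp (fun w => F (w + a)) 2 μ :=
  hF.comp_measurePreserving (measurePreserving_add_right μ a)

theorem ae_hasSum_torusCoeff_mul_translate (hf : MemLp f 2) (a : Cyl d) :
    ∀ᵐ x : ℝ, HasSum (fun k => UnitAddTorus.mFourier k a.2 *
      (conj (torusCoeff f k x) * torusCoeff f k (x + a.1)))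
      (∫ y, ((f ((x, y) + a) * f (x, y) : ℝ) : ℂ)) := by
  filter_upwards [ae_memLp_two_section hf, ae_memLp_two_section (memLp_translate hf a)]
    with x section_mem translate_section_mem
  convert hasSum_parseval section_mem.ofReal translate_section_mem.ofReal using 1
  · ext k
    simp only [Complex.coe_algebraMap, integral_mFourier_mul_translate, torusCoeff,
      torusChar_eq_mFourier_neg]
    ring
  · refine integral_congr_ae (ae_of_all _ fun y => ?_)
    simp only [Complex.coe_algebraMap, Complex.conj_ofReal]
    push_cast
    ring

theorem ae_tsum_enorm_sq_torusCoeff (hf : MemLp f 2)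
    (hg : ∀ k, (g k : ℝ → ℂ) =ᵐ[volume] torusCoeff f k) :
    ∀ᵐ x : ℝ, ∑' k, ‖g k x‖ₑ ^ 2 = ENNReal.ofReal (∫ y, f (x, y) ^ 2) := by
  filter_upwards [ae_hasSum_torusCoeff_mul_translate hf 0, ae_all_iff.2 hg] with x parseval coeff_eq
  have hasSum_norm_sq : HasSum (fun k => ‖g k x‖ ^ 2) (∫ y, f (x, y) ^ 2) := by
    rw [← Complex.hasSum_ofReal]
    convert parseval using 1
    · ext k
      simp only [coeff_eq k, Prod.snd_zero, Prod.fst_zero, add_zero, Complex.conj_mul',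
        UnitAddTorus.mFourier, ContinuousMap.coe_mk, Pi.zero_apply, fourier_eval_zero,
        Finset.prod_const_one, one_mul, Complex.ofReal_pow]
    · simp only [add_zero, ← sq, integral_complex_ofReal]
  rw [← hasSum_norm_sq.tsum_eq, ENNReal.ofReal_tsum_of_nonneg (fun k => by positivity)
    hasSum_norm_sq.summable]
  exact tsum_congr fun k => by rw [ENNReal.ofReal_pow (norm_nonneg _), ofReal_norm]

theorem tsum_lintegral_enorm_sq_torusCoeff_lt_top (hf : MemLp f 2)
    (hg : ∀ k, (g k : ℝ → ℂ) =ᵐ[volume] torusCoeff f k) :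
    ∑' k, ∫⁻ x, ‖g k x‖ₑ ^ 2 < ⊤ := by
  have integrable_slices : Integrable fun x : ℝ => ∫ y, f (x, y) ^ 2 :=
    hf.integrable_sq.integral_prod_left
  rw [← lintegral_tsum fun k => ((Lp.aestronglyMeasurable (g k)).enorm.pow_const 2),
    lintegral_congr_ae (ae_tsum_enorm_sq_torusCoeff hf hg)]
  exact (lintegral_mono fun x => Real.ofReal_le_enorm _).trans_lt integrable_slices.2

theorem enorm_mul_le_sq_add_sq (z w : ℂ) : ‖z * w‖ₑ ≤ ‖z‖ₑ ^ 2 + ‖w‖ₑ ^ 2 := by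
  rw [enorm_mul]
  rcases le_total ‖z‖ₑ ‖w‖ₑ with h | h
  · exact (mul_le_mul_left h _).trans (by rw [← sq]; exact le_add_self)
  · exact (mul_le_mul_right h _).trans (by rw [← sq]; exact le_self_add)

theorem tsum_lintegral_enorm_mul_translate_lt_top (hsum : ∑' k, ∫⁻ x, ‖g k x‖ₑ ^ 2 < ⊤)
    (a : Cyl d) :
    ∑' k, ∫⁻ x, ‖UnitAddTorus.mFourier k a.2 * (conj (g k x) * g k (x + a.1))‖ₑ < ⊤ := by
  have enorm_mFourier (k : Fin (d - 1) → ℤ) : ‖UnitAddTorus.mFourier k a.2‖ₑ = 1 := by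
    rw [← ofReal_norm, norm_mFourier_apply, ENNReal.ofReal_one]
  calc ∑' k, ∫⁻ x, ‖UnitAddTorus.mFourier k a.2 * (conj (g k x) * g k (x + a.1))‖ₑ
      ≤ ∑' k, ((∫⁻ x, ‖g k x‖ₑ ^ 2) + ∫⁻ x, ‖g k (x + a.1)‖ₑ ^ 2) := by
        refine ENNReal.tsum_le_tsum fun k => ?_
        rw [← lintegral_add_left' ((Lp.aestronglyMeasurable (g k)).enorm.pow_const 2)]
        refine lintegral_mono fun x => ?_
        rw [enorm_mul, enorm_mFourier, one_mul, ← RCLike.enorm_conj (g k x)]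
        exact enorm_mul_le_sq_add_sq _ _
    _ = (∑' k, ∫⁻ x, ‖g k x‖ₑ ^ 2) + ∑' k, ∫⁻ x, ‖g k x‖ₑ ^ 2 := by
        rw [← ENNReal.tsum_add]
        refine tsum_congr fun k => ?_
        rw [lintegral_add_right_eq_self (fun x => ‖g k x‖ₑ ^ 2)]
    _ < ⊤ := ENNReal.add_lt_top.2 ⟨hsum, hsum⟩

theorem integral_translate_mul_eq_tsum (hf : MemLp f 2)
    (hg : ∀ k, (g k : ℝ → ℂ) =ᵐ[volume] torusCoeff f k) (a : Cyl d) :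
    ((∫ w, f (w + a) * f w : ℝ) : ℂ) =
      ∑' k, UnitAddTorus.mFourier k a.2 * ∫ x, conj (g k x) * g k (x + a.1) := by
  have integrable_mul : Integrable fun w => ((f (w + a) * f w : ℝ) : ℂ) :=
    ((memLp_translate hf a).integrable_mul hf).ofReal
  have slice_eq_tsum : ∀ᵐ x : ℝ,
      ∫ y : Fin (d - 1) → UnitAddCircle, ((f ((x, y) + a) * f (x, y) : ℝ) : ℂ) =
        ∑' k, UnitAddTorus.mFourier k a.2 * (conj (g k x) * g k (x + a.1)) := by
    filter_upwards [ae_hasSum_torusCoeff_mul_translate hf a, ae_all_iff.2 hg, ae_all_iff.2 fun k =>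
      (measurePreserving_add_right volume a.1).quasiMeasurePreserving.ae (hg k)]
      with x parseval coeff_eq coeff_translate_eq
    rw [← parseval.tsum_eq]
    exact tsum_congr fun k => by rw [coeff_eq k, coeff_translate_eq k]
  calc ((∫ w, f (w + a) * f w : ℝ) : ℂ)
      = ∫ w, ((f (w + a) * f w : ℝ) : ℂ) := integral_complex_ofReal.symm
    _ = ∫ x : ℝ, ∫ y : Fin (d - 1) → UnitAddCircle, ((f ((x, y) + a) * f (x, y) : ℝ) : ℂ) :=
        integral_prod _ integrable_mul
    _ = ∫ x, ∑' k, UnitAddTorus.mFourier k a.2 * (conj (g k x) * g k (x + a.1)) :=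
        integral_congr_ae slice_eq_tsum
    _ = ∑' k, ∫ x, UnitAddTorus.mFourier k a.2 * (conj (g k x) * g k (x + a.1)) := by
        refine integral_tsum (fun k => ?_) (tsum_lintegral_enorm_mul_translate_lt_top
          (tsum_lintegral_enorm_sq_torusCoeff_lt_top hf hg) a).ne
        exact ((Lp.aestronglyMeasurable (g k)).star.mul
          ((Lp.aestronglyMeasurable (g k)).comp_measurePreserving
            (measurePreserving_add_right volume a.1))).const_mul _
    _ = ∑' k, UnitAddTorus.mFourier k a.2 * ∫ x, conj (g k x) * g k (x + a.1) := by
        simp only [integral_const_mul]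

end TorusCoeff

section SpectralMeasure

variable {d : ℕ}

/-- The spectral measure `|f̂|² dν` of the function on the cylinder whose Fourier coefficients in
the periodic variables are `g k`. -/
def spectralMeasure (g : (Fin (d - 1) → ℤ) → Lp ℂ 2 (volume : Measure ℝ)) : Measure (Freq d) :=
  Measure.sum fun k => Measure.map (fun ξ => (ξ, k))
    (volume.withDensity fun ξ => ‖(𝓕 (g k) : Lp ℂ 2 (volume : Measure ℝ)) ξ‖ₑ ^ 2)

theorem lintegral_spectralMeasure (g : (Fin (d - 1) → ℤ) → Lp ℂ 2 (volume : Measure ℝ))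
    {F : Freq d → ENNReal} (hF : Measurable F) :
    ∫⁻ ν, F ν ∂spectralMeasure g =
      ∑' k, ∫⁻ ξ, F (ξ, k) * ‖(𝓕 (g k) : Lp ℂ 2 (volume : Measure ℝ)) ξ‖ₑ ^ 2 := by
  rw [spectralMeasure, lintegral_sum_measure]
  refine tsum_congr fun k => ?_
  rw [lintegral_map hF measurable_prodMk_right, lintegral_withDensity_eq_lintegral_mul₀
    ((Lp.aestronglyMeasurable _).enorm.pow_const 2) (g := fun ξ => F (ξ, k))
    (hF.comp measurable_prodMk_right).aemeasurable]
  simp only [Pi.mul_apply, mul_comm]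

theorem measurable_cylChar_left (a : Cyl d) : Measurable fun ν : Freq d => (cylChar ν a : ℂ) :=
  measurable_cylChar measurable_id measurable_const

theorem integrable_cylChar (m : Measure (Freq d)) [IsFiniteMeasure m] (a : Cyl d) :
    Integrable (fun ν => (cylChar ν a : ℂ)) m :=
  Integrable.of_bound (measurable_cylChar_left a).aestronglyMeasurable 1
    (ae_of_all _ fun _ => (Circle.norm_coe _).le)

theorem integral_cylChar_spectralMeasure (g : (Fin (d - 1) → ℤ) → Lp ℂ 2 (volume : Measure ℝ))
    [IsFiniteMeasure (spectralMeasure g)] (a : Cyl d) :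
    ∫ ν, (cylChar ν a : ℂ) ∂spectralMeasure g =
      ∑' k, UnitAddTorus.mFourier k a.2 * ∫ x, conj (g k x) * g k (x + a.1) := by
  have integrable_char := integrable_cylChar (spectralMeasure g) a
  rw [spectralMeasure] at integrable_char ⊢
  rw [integral_sum_measure integrable_char]
  refine tsum_congr fun k => ?_
  have plancherel := integral_inner_translate (g k) a.1
  simp only [RCLike.inner_apply'] at plancherel
  rw [plancherel, integral_map measurable_prodMk_right.aemeasurable
      (measurable_cylChar_left a).aestronglyMeasurable,
    integral_withDensity_eq_integral_toReal_smul₀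
      ((Lp.aestronglyMeasurable _).enorm.pow_const 2)
      (ae_of_all _ fun ξ => ENNReal.pow_lt_top enorm_lt_top), ← integral_const_mul]
  refine integral_congr_ae (ae_of_all _ fun ξ => ?_)
  simp only [coe_cylChar, ENNReal.toReal_pow, toReal_enorm, Complex.real_smul,
    conj_trivial]
  ring

/-- `m` is a spectral measure of `f ∈ L²`: a finite measure with finite second moment (that is,
`f ∈ H¹`) whose cosine transform is the autocorrelation of `f`. All energy estimates are read off
from `m`. -/
structure IsSpectral (f : Cyl d → ℝ) (m : Measure (Freq d)) : Prop where
  memLp : MemLp f 2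
  finite : IsFiniteMeasure m
  moment : Integrable (fun ν => freqNorm ν.1 ν.2 ^ 2) m
  corr : ∀ a : Cyl d, ∫ w, f (w + a) * f w = ∫ ν, (cylChar ν a : ℂ).re ∂m

theorem MemH.exists_isSpectral {f : Cyl d → ℝ} (hf : MemH 1 f) :
    ∃ m : Measure (Freq d), IsSpectral f m := by
  obtain ⟨hfL2, g, hg, moment_lt_top⟩ := hf
  have hfin : IsFiniteMeasure (spectralMeasure g) := by
    refine ⟨?_⟩
    rw [← lintegral_one, lintegral_spectralMeasure g measurable_const]
    simpa only [one_mul, lintegral_enorm_sq_fourier] using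
      tsum_lintegral_enorm_sq_torusCoeff_lt_top hfL2 hg
  refine ⟨spectralMeasure g, hfL2, hfin,
    ⟨(measurable_freqNorm.pow_const 2).aestronglyMeasurable, ?_⟩, fun a => ?_⟩
  · rw [hasFiniteIntegral_iff_ofReal (ae_of_all _ fun ν => sq_nonneg _)]
    have ofReal_sq (ν : Freq d) : ENNReal.ofReal (freqNorm ν.1 ν.2 ^ 2) =
        ENNReal.ofReal (freqNorm ν.1 ν.2) ^ 2 := ENNReal.ofReal_pow (Real.sqrt_nonneg _) 2
    simp only [ofReal_sq]
    rw [lintegral_spectralMeasure g (measurable_freqNorm.ennreal_ofReal.pow_const 2)]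
    simpa only [Real.rpow_one] using moment_lt_top
  · have re_integral : ∫ ν, (cylChar ν a : ℂ).re ∂spectralMeasure g =
        (∫ ν, (cylChar ν a : ℂ) ∂spectralMeasure g).re :=
      integral_re (integrable_cylChar _ a)
    rw [re_integral, integral_cylChar_spectralMeasure, ← integral_translate_mul_eq_tsum hfL2 hg,
      Complex.ofReal_re]

end SpectralMeasure

/-! ### The jump measure on the universal cover -/

/-- Positive, continuous, even kernels, homogeneous of degree `-d-1`: assumptions (B), (C) and (D)
on `H`. They already make the operator `𝓛` comparable with a half-Laplacian. -/
structure IsJumpKernel (d : ℕ) (H : Cover d → ℝ) : Prop where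
  pos : ∀ z, z ≠ 0 → 0 < H z
  cont : ContinuousOn H {z | z ≠ 0}
  homog : ∀ (z : Cover d) (a : ℝ), z ≠ 0 → 0 < a → H (a • z) = a ^ (-(d : ℤ) - 1) * H z
  symm : ∀ z, H z = H (-z)

theorem KernelAssumptions.isJumpKernel {d : ℕ} {H : Cover d → ℝ} (hH : KernelAssumptions d H) :
    IsJumpKernel d H :=
  ⟨hH.pos, hH.cont, hH.homog, hH.symm⟩

section RadialIntegral

theorem integrableOn_min_rpow_neg_two :
    IntegrableOn (fun r : ℝ => min (r ^ (-2 : ℝ)) 1) (Set.Ioi 0) := by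
  have measurable_min : Measurable fun r : ℝ => min (r ^ (-2 : ℝ)) 1 := by fun_prop
  have norm_min {r : ℝ} (hr : 0 < r) : ‖min (r ^ (-2 : ℝ)) 1‖ = min (r ^ (-2 : ℝ)) 1 :=
    Real.norm_of_nonneg (le_min (Real.rpow_nonneg hr.le _) zero_le_one)
  rw [← Set.Ioc_union_Ioi_eq_Ioi zero_le_one]
  refine IntegrableOn.union ?_ ?_
  · refine Measure.integrableOn_of_bounded (M := 1) (by simp) measurable_min.aestronglyMeasurable ?_
    filter_upwards [ae_restrict_mem measurableSet_Ioc] with r hr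
    exact (norm_min hr.1).trans_le (min_le_right _ _)
  · refine Integrable.mono' (integrableOn_Ioi_rpow_of_lt (by norm_num : (-2 : ℝ) < -1) one_pos)
      measurable_min.aestronglyMeasurable ?_
    filter_upwards [ae_restrict_mem measurableSet_Ioi] with r hr
    exact (norm_min (one_pos.trans hr)).trans_le (min_le_left _ _)

variable {E : Type*} [NormedAddCommGroup E] [NormedSpace ℝ E] [FiniteDimensional ℝ E]
  [Nontrivial E] [MeasurableSpace E] [BorelSpace E]

theorem integrable_min_norm_sq_mul_norm_zpow (μ : Measure E) [μ.IsAddHaarMeasure] :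
    Integrable (fun z : E => min 1 (‖z‖ ^ 2) * ‖z‖ ^ (-(Module.finrank ℝ E : ℤ) - 1)) μ := by
  refine (integrable_fun_norm_addHaar μ
    (f := fun r : ℝ => min 1 (r ^ 2) * r ^ (-(Module.finrank ℝ E : ℤ) - 1))).2 ?_
  refine integrableOn_min_rpow_neg_two.congr_fun (fun r hr => ?_) measurableSet_Ioi
  replace hr : 0 < r := hr
  have radial_power : r ^ (Module.finrank ℝ E - 1) * r ^ (-(Module.finrank ℝ E : ℤ) - 1) =
      r ^ (-2 : ℝ) := by
    rw [← zpow_natCast, ← zpow_add₀ hr.ne', ← Real.rpow_intCast]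
    congr 1
    push_cast [Nat.cast_sub (Module.finrank_pos (R := ℝ) (M := E))]
    ring
  have power_mul_min : r ^ (-2 : ℝ) * min 1 (r ^ 2) = min (r ^ (-2 : ℝ)) 1 := by
    rw [mul_min_of_nonneg _ _ (by positivity), mul_one, ← Real.rpow_natCast, ← Real.rpow_add hr]
    norm_num
  change min (r ^ (-2 : ℝ)) 1 = _
  rw [smul_eq_mul, ← power_mul_min, ← radial_power]
  ring

end RadialIntegral

section CoverJump

variable {d : ℕ} {H : Cover d → ℝ}

/-- The measure `H(z) dz` on the universal cover. -/
def coverJump (H : Cover d → ℝ) : Measure (Cover d) :=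
  volume.withDensity fun z => ENNReal.ofReal (H z)

theorem finrank_cover (hd : 1 ≤ d) : Module.finrank ℝ (Cover d) = d := by
  rw [Module.finrank_prod, Module.finrank_self, Module.finrank_fin_fun]
  omega

namespace IsJumpKernel

theorem measurable (hH : IsJumpKernel d H) : Measurable H :=
  measurable_of_continuousOn_compl_singleton 0 hH.cont

theorem lintegral_coverJump (hH : IsJumpKernel d H) {F : Cover d → ENNReal} (hF : Measurable F) :
    ∫⁻ z, F z ∂coverJump H = ∫⁻ z, F z * ENNReal.ofReal (H z) := by
  rw [coverJump, lintegral_withDensity_eq_lintegral_mul _ hH.measurable.ennreal_ofReal hF]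
  simp only [Pi.mul_apply, mul_comm]

theorem homog_inv (hH : IsJumpKernel d H) {a : ℝ} (ha : 0 < a) {z : Cover d} (hz : z ≠ 0) :
    H (a⁻¹ • z) = a ^ (d + 1) * H z := by
  rw [hH.homog z a⁻¹ hz (inv_pos.2 ha), inv_zpow', ← zpow_natCast]
  congr 2
  push_cast
  ring

theorem lintegral_coverJump_smul (hH : IsJumpKernel d H) (hd : 1 ≤ d) {F : Cover d → ENNReal}
    (hF : Measurable F) {a : ℝ} (ha : 0 < a) :
    ∫⁻ z, F (a • z) ∂coverJump H = ENNReal.ofReal a * ∫⁻ z, F z ∂coverJump H := by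
  have measurable_scaled : Measurable fun z => F z * ENNReal.ofReal (H (a⁻¹ • z)) :=
    hF.mul (hH.measurable.comp (measurable_const_smul a⁻¹)).ennreal_ofReal
  have dilate : ∫⁻ z, F (a • z) * ENNReal.ofReal (H z) =
      ENNReal.ofReal |(a ^ d)⁻¹| * ∫⁻ z, F z * ENNReal.ofReal (H (a⁻¹ • z)) := by
    have map_smul := Measure.map_addHaar_smul (volume : Measure (Cover d)) ha.ne'
    rw [finrank_cover hd] at map_smul
    rw [← smul_eq_mul, ← lintegral_smul_measure, ← map_smul,
      lintegral_map measurable_scaled (measurable_const_smul a)]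
    simp only [smul_smul, inv_mul_cancel₀ ha.ne', one_smul]
  have homogeneity : ∫⁻ z, F z * ENNReal.ofReal (H (a⁻¹ • z)) =
      ENNReal.ofReal (a ^ (d + 1)) * ∫⁻ z, F z * ENNReal.ofReal (H z) := by
    rw [← lintegral_const_mul (f := fun z => F z * ENNReal.ofReal (H z)) _
      (hF.mul hH.measurable.ennreal_ofReal)]
    refine lintegral_congr_ae ((Measure.ae_ne volume 0).mono fun z hz => ?_)
    simp only [hH.homog_inv ha hz]
    rw [ENNReal.ofReal_mul (by positivity), mul_left_comm]
  rw [hH.lintegral_coverJump hF, hH.lintegral_coverJump (F := fun z => F (a • z))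
    (hF.comp (measurable_const_smul a)), dilate, homogeneity, ← mul_assoc,
    ← ENNReal.ofReal_mul (abs_nonneg _)]
  congr 2
  rw [abs_of_pos (by positivity), pow_succ]
  field_simp

theorem exists_upper_bound (hH : IsJumpKernel d H) :
    ∃ C, ∀ z, z ≠ 0 → H z ≤ C * ‖z‖ ^ (-(d : ℤ) - 1) := by
  have continuousOn_sphere : ContinuousOn H (Metric.sphere 0 1) :=
    hH.cont.mono fun z hz => ne_zero_of_mem_unit_sphere ⟨z, hz⟩
  obtain ⟨C, hC⟩ := (isCompact_sphere (0 : Cover d) 1).bddAbove_image continuousOn_sphere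
  refine ⟨C, fun z hz => ?_⟩
  have norm_pos : 0 < ‖z‖ := norm_pos_iff.2 hz
  have sphere_bound : H (‖z‖⁻¹ • z) ≤ C := by
    refine (hC ⟨_, ?_, rfl⟩)
    rw [mem_sphere_zero_iff_norm, norm_smul, norm_inv, norm_norm, inv_mul_cancel₀ norm_pos.ne']
  calc H z = H (‖z‖ • ‖z‖⁻¹ • z) := by rw [smul_smul, mul_inv_cancel₀ norm_pos.ne', one_smul]
    _ = H (‖z‖⁻¹ • z) * ‖z‖ ^ (-(d : ℤ) - 1) := by
      rw [hH.homog _ _ (smul_ne_zero (inv_ne_zero norm_pos.ne') hz) norm_pos, mul_comm]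
    _ ≤ C * ‖z‖ ^ (-(d : ℤ) - 1) := by gcongr

theorem lintegral_coverJump_min_lt_top (hH : IsJumpKernel d H) (hd : 1 ≤ d) :
    ∫⁻ z, ENNReal.ofReal (min 1 (‖z‖ ^ 2)) ∂coverJump H < ⊤ := by
  obtain ⟨C, H_le⟩ := hH.exists_upper_bound
  have integrable_bound := (integrable_min_norm_sq_mul_norm_zpow
    (volume : Measure (Cover d))).const_mul C
  rw [finrank_cover hd] at integrable_bound
  rw [hH.lintegral_coverJump (by fun_prop)]
  refine lt_of_le_of_lt (lintegral_mono_ae ((Measure.ae_ne volume 0).mono fun z hz => ?_))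
    integrable_bound.2
  rw [← ENNReal.ofReal_mul (by positivity)]
  refine le_trans (ENNReal.ofReal_le_ofReal ?_) (Real.ofReal_le_enorm _)
  simp only [mul_left_comm C]
  exact mul_le_mul_of_nonneg_left (H_le z hz) (by positivity)

theorem coverJump_ne_zero (hH : IsJumpKernel d H) : coverJump H ≠ 0 := by
  intro h
  rw [coverJump, withDensity_eq_zero_iff hH.measurable.ennreal_ofReal.aemeasurable] at h
  obtain ⟨z, H_eq_zero, hz⟩ := (h.and (Measure.ae_ne volume 0)).exists
  simp only [Pi.zero_apply, ENNReal.ofReal_eq_zero] at H_eq_zero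
  exact (hH.pos z hz).not_ge H_eq_zero

theorem coverJump_univ (hH : IsJumpKernel d H) (hd : 1 ≤ d) : coverJump H Set.univ = ⊤ := by
  have scaling := hH.lintegral_coverJump_smul hd (F := fun _ => 1) measurable_const two_pos
  simp only [lintegral_one] at scaling
  by_contra hne
  have toReal_scaling := congrArg ENNReal.toReal scaling
  rw [ENNReal.toReal_mul, ENNReal.toReal_ofReal zero_le_two] at toReal_scaling
  have toReal_pos := ENNReal.toReal_pos (Measure.measure_univ_ne_zero.2 hH.coverJump_ne_zero) hne
  linarith

theorem map_neg_coverJump (hH : IsJumpKernel d H) :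
    (coverJump H).map Neg.neg = coverJump H := by
  refine Measure.ext_of_lintegral _ fun F hF => ?_
  rw [lintegral_map hF measurable_neg, hH.lintegral_coverJump hF,
    hH.lintegral_coverJump (F := fun z => F (-z)) (hF.comp measurable_neg),
    ← lintegral_neg_eq_self]
  refine lintegral_congr fun z => ?_
  rw [neg_neg, ← hH.symm z]

end IsJumpKernel

end CoverJump

/-! ### The jump measure on the cylinder -/

section Geometry

variable {d : ℕ}

theorem continuous_proj : Continuous (proj : Cover d → Cyl d) :=
  continuous_fst.prodMk (continuous_pi fun i =>
    (AddCircle.continuous_mk' 1).comp ((continuous_apply i).comp continuous_snd))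

theorem continuous_cylNorm : Continuous (cylNorm : Cyl d → ℝ) := by
  unfold cylNorm
  fun_prop

theorem measurableSet_lt_cylNorm (ε : ℝ) : MeasurableSet {w : Cyl d | ε < cylNorm w} :=
  (isOpen_lt continuous_const continuous_cylNorm).measurableSet

theorem cylNorm_neg (w : Cyl d) : cylNorm (-w) = cylNorm w := by
  simp only [cylNorm, Prod.fst_neg, Prod.snd_neg, Pi.neg_apply, even_two.neg_pow, norm_neg]

theorem cylNorm_proj_sq_le (hd : 1 ≤ d) (z : Cover d) : cylNorm (proj z) ^ 2 ≤ d * ‖z‖ ^ 2 := by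
  have norm_le (i : Fin (d - 1)) : ‖(proj z).2 i‖ ≤ ‖z‖ :=
    QuotientAddGroup.norm_mk_le_norm.trans ((norm_le_pi_norm z.2 i).trans (norm_snd_le z))
  calc cylNorm (proj z) ^ 2 = |z.1| ^ 2 + ∑ i, ‖(proj z).2 i‖ ^ 2 := by
        rw [cylNorm, Real.sq_sqrt (by positivity), sq_abs, proj]
    _ ≤ ‖z‖ ^ 2 + ∑ _i : Fin (d - 1), ‖z‖ ^ 2 := by
        gcongr with i
        · exact norm_fst_le z
        · exact norm_le i
    _ = d * ‖z‖ ^ 2 := by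
        rw [Finset.sum_const, Finset.card_univ, Fintype.card_fin, nsmul_eq_mul, Nat.cast_sub hd]
        push_cast
        ring

theorem cylNorm_eq_zero {w : Cyl d} : cylNorm w = 0 ↔ w = 0 := by
  rw [cylNorm, Real.sqrt_eq_zero (by positivity),
    add_eq_zero_iff_of_nonneg (sq_nonneg _) (by positivity), sq_eq_zero_iff,
    Finset.sum_eq_zero_iff_of_nonneg fun i _ => by positivity, Prod.ext_iff, funext_iff]
  simp only [Finset.mem_univ, sq_eq_zero_iff, norm_eq_zero, forall_const, Prod.fst_zero,
    Prod.snd_zero, Pi.zero_apply]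

theorem cylNorm_pos {w : Cyl d} (hw : w ≠ 0) : 0 < cylNorm w :=
  (Real.sqrt_nonneg _).lt_of_ne' (cylNorm_eq_zero.not.2 hw)

theorem volume_preimage_proj_zero : volume (proj ⁻¹' {(0 : Cyl d)}) = 0 := by
  refine measure_mono_null (t := {(0 : ℝ)} ×ˢ Set.univ) (fun z hz => ?_) ?_
  · exact ⟨congrArg Prod.fst (show proj z = 0 from hz), Set.mem_univ _⟩
  · rw [Measure.volume_eq_prod, Measure.prod_prod, Real.volume_singleton, zero_mul]

theorem iUnion_lt_cylNorm :
    ⋃ n : ℕ, {w : Cyl d | 1 / ((n : ℝ) + 1) < cylNorm w} = {0}ᶜ := by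
  ext w
  simp only [Set.mem_iUnion, Set.mem_ofPred_eq, Set.mem_compl_iff, Set.mem_singleton_iff]
  refine ⟨?_, fun hw => exists_nat_one_div_lt (cylNorm_pos hw)⟩
  rintro ⟨n, hn⟩ rfl
  rw [cylNorm_eq_zero.2 rfl] at hn
  exact hn.not_gt (by positivity)

end Geometry

section Jump

variable {d : ℕ} {H : Cover d → ℝ}

/-- The measure `K(w) dw` on the cylinder, as the projection of `H(z) dz`. -/
def jump (H : Cover d → ℝ) : Measure (Cyl d) := (coverJump H).map proj

/-- The measure `K(w) dw` restricted to `|w| > ε`. -/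
def jumpTrunc (H : Cover d → ℝ) (ε : ℝ) : Measure (Cyl d) :=
  (jump H).restrict {w | ε < cylNorm w}

theorem lintegral_jump {F : Cyl d → ENNReal} (hF : Measurable F) :
    ∫⁻ w, F w ∂jump H = ∫⁻ z, F (proj z) ∂coverJump H :=
  lintegral_map hF continuous_proj.measurable

theorem jumpTrunc_anti {ε δ : ℝ} (h : ε ≤ δ) : jumpTrunc H δ ≤ jumpTrunc H ε :=
  Measure.restrict_mono (fun _ hw => lt_of_le_of_lt h hw) le_rfl

namespace IsJumpKernel

theorem isFiniteMeasure_jumpTrunc (hH : IsJumpKernel d H) (hd : 1 ≤ d) {ε : ℝ} (hε : 0 < ε) :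
    IsFiniteMeasure (jumpTrunc H ε) := by
  have d_pos : (0 : ℝ) < d := by exact_mod_cast hd
  set c : ℝ := min 1 (ε ^ 2 / d)
  have c_pos : ENNReal.ofReal c ≠ 0 :=
    (ENNReal.ofReal_pos.2 (lt_min one_pos (by positivity))).ne'
  have far_subset : proj ⁻¹' {w : Cyl d | ε < cylNorm w} ⊆
      {z | ENNReal.ofReal c ≤ ENNReal.ofReal (min 1 (‖z‖ ^ 2))} := by
    intro z hz
    refine ENNReal.ofReal_le_ofReal (min_le_min_left _ ?_)
    rw [div_le_iff₀ d_pos, mul_comm]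
    exact (pow_le_pow_left₀ hε.le (le_of_lt hz) 2).trans (cylNorm_proj_sq_le hd z)
  refine ⟨?_⟩
  rw [jumpTrunc, Measure.restrict_apply_univ, jump, Measure.map_apply continuous_proj.measurable
    (measurableSet_lt_cylNorm ε)]
  calc coverJump H (proj ⁻¹' {w : Cyl d | ε < cylNorm w})
      ≤ coverJump H {z | ENNReal.ofReal c ≤ ENNReal.ofReal (min 1 (‖z‖ ^ 2))} :=
        measure_mono far_subset
    _ ≤ (∫⁻ z, ENNReal.ofReal (min 1 (‖z‖ ^ 2)) ∂coverJump H) / ENNReal.ofReal c :=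
        meas_ge_le_lintegral_div (by fun_prop) c_pos ENNReal.ofReal_ne_top
    _ < ⊤ := ENNReal.div_lt_top (hH.lintegral_coverJump_min_lt_top hd).ne c_pos

theorem map_neg_jump (hH : IsJumpKernel d H) : (jump H).map Neg.neg = jump H := by
  have neg_comp_proj : Neg.neg ∘ (proj : Cover d → Cyl d) = proj ∘ Neg.neg := rfl
  rw [jump, Measure.map_map measurable_neg continuous_proj.measurable, neg_comp_proj,
    ← Measure.map_map continuous_proj.measurable measurable_neg, hH.map_neg_coverJump]

theorem isNegInvariant_jumpTrunc (hH : IsJumpKernel d H) (ε : ℝ) :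
    (jumpTrunc H ε).IsNegInvariant := by
  have far_symm : Neg.neg ⁻¹' {w : Cyl d | ε < cylNorm w} = {w | ε < cylNorm w} := by
    ext w
    simp only [Set.mem_preimage, Set.mem_ofPred_eq, cylNorm_neg]
  refine ⟨?_⟩
  conv_rhs => rw [jumpTrunc, ← hH.map_neg_jump]
  rw [Measure.neg_def, Measure.restrict_map measurable_neg (measurableSet_lt_cylNorm ε),
    far_symm, jumpTrunc]

theorem jump_compl_zero (hH : IsJumpKernel d H) (hd : 1 ≤ d) : jump H {0}ᶜ = ⊤ := by
  have jump_zero : jump H {0} = 0 := by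
    rw [jump, Measure.map_apply continuous_proj.measurable (measurableSet_singleton 0)]
    exact withDensity_absolutelyContinuous _ _ volume_preimage_proj_zero
  have split := measure_add_measure_compl (μ := jump H) (measurableSet_singleton (0 : Cyl d))
  rw [jump_zero, zero_add] at split
  rw [split, jump, Measure.map_apply continuous_proj.measurable MeasurableSet.univ,
    Set.preimage_univ, hH.coverJump_univ hd]

theorem tendsto_jumpTrunc_univ (hH : IsJumpKernel d H) (hd : 1 ≤ d) :
    Tendsto (fun n : ℕ => jumpTrunc H (1 / ((n : ℝ) + 1)) Set.univ) atTop (𝓝 ⊤) := by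
  have monotone_far : Monotone fun n : ℕ => {w : Cyl d | 1 / ((n : ℝ) + 1) < cylNorm w} :=
    fun n m hnm w (hw : 1 / ((n : ℝ) + 1) < cylNorm w) =>
      (Nat.one_div_le_one_div hnm).trans_lt hw
  simpa only [Function.comp_def, jumpTrunc, Measure.restrict_apply_univ, iUnion_lt_cylNorm,
    hH.jump_compl_zero hd] using tendsto_measure_iUnion_atTop (μ := jump H) monotone_far

end IsJumpKernel

end Jump

/-! ### The symbols of the truncated operators -/

section Symbol

variable {d : ℕ} {H : Cover d → ℝ}

/-- The phase `ν · z` of the character of frequency `ν` at a point `z` of the universal cover,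
without the factor `2π`. -/
def phase (ν : Freq d) (z : Cover d) : ℝ :=
  ν.1 * z.1 + ∑ i, ν.2 i * z.2 i

theorem phase_smul (ν : Freq d) (t : ℝ) (z : Cover d) : phase ν (t • z) = t * phase ν z := by
  simp only [phase, Prod.smul_fst, Prod.smul_snd, Pi.smul_apply, smul_eq_mul, mul_add,
    Finset.mul_sum, mul_left_comm]

theorem measurable_phase (z : Cover d) : Measurable fun ν : Freq d => phase ν z := by
  unfold phase
  fun_prop

theorem cylChar_proj (ν : Freq d) (z : Cover d) :
    cylChar ν (proj z) = Real.fourierChar (phase ν z) := by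
  have toCircle_eq (i : Fin (d - 1)) :
      AddCircle.toCircle (ν.2 i • (z.2 i : UnitAddCircle)) =
        Real.fourierChar (ν.2 i * z.2 i) := by
    rw [← AddCircle.coe_zsmul, AddCircle.toCircle_apply_mk, Real.fourierChar_apply', div_one,
      zsmul_eq_mul]
  have fourierChar_sum : Real.fourierChar (∑ i, ν.2 i * z.2 i) =
      ∏ i, Real.fourierChar (ν.2 i * z.2 i) :=
    map_sum Real.fourierChar.toAddMonoidHom _ _
  rw [phase, AddChar.map_add_eq_mul, fourierChar_sum, mul_comm ν.1]
  simp only [← toCircle_eq]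
  rfl

theorem freqNorm_nonneg (ν : Freq d) : 0 ≤ freqNorm ν.1 ν.2 := Real.sqrt_nonneg _

theorem abs_fst_le_freqNorm (ν : Freq d) : |ν.1| ≤ freqNorm ν.1 ν.2 :=
  Real.abs_le_sqrt (le_add_of_nonneg_right (by positivity))

theorem abs_snd_le_freqNorm (ν : Freq d) (i : Fin (d - 1)) : |(ν.2 i : ℝ)| ≤ freqNorm ν.1 ν.2 :=
  Real.abs_le_sqrt ((Finset.single_le_sum (f := fun i => (ν.2 i : ℝ) ^ 2)
    (fun _ _ => sq_nonneg _) (Finset.mem_univ i)).trans (le_add_of_nonneg_left (sq_nonneg _)))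

theorem abs_phase_le (hd : 1 ≤ d) (ν : Freq d) (z : Cover d) :
    |phase ν z| ≤ d * freqNorm ν.1 ν.2 * ‖z‖ := by
  calc |phase ν z|
      ≤ |ν.1| * |z.1| + ∑ i, |(ν.2 i : ℝ)| * |z.2 i| := by
        simp only [← abs_mul]
        exact (abs_add_le _ _).trans (add_le_add_right (Finset.abs_sum_le_sum_abs _ _) _)
    _ ≤ freqNorm ν.1 ν.2 * ‖z‖ + ∑ _i : Fin (d - 1), freqNorm ν.1 ν.2 * ‖z‖ := by
        have := freqNorm_nonneg ν
        gcongr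
        · exact abs_fst_le_freqNorm ν
        · exact norm_fst_le z
        · exact abs_snd_le_freqNorm ν _
        · exact (norm_le_pi_norm z.2 _).trans (norm_snd_le z)
    _ = d * freqNorm ν.1 ν.2 * ‖z‖ := by
        rw [Finset.sum_const, Finset.card_univ, Fintype.card_fin, nsmul_eq_mul, Nat.cast_sub hd]
        push_cast
        ring

theorem one_sub_cos_le_two_mul_min (t : ℝ) : 1 - Real.cos t ≤ 2 * min 1 (t ^ 2) := by
  rw [mul_min_of_nonneg _ _ zero_le_two]
  have quadratic_bound := Real.one_sub_sq_div_two_le_cos (x := t)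
  exact le_min (by linarith [Real.neg_one_le_cos t]) (by linarith [sq_nonneg t])

theorem one_sub_cylChar_proj_le (hd : 1 ≤ d) (ν : Freq d) (z : Cover d) :
    1 - (cylChar ν (proj z) : ℂ).re ≤
      2 * min 1 (‖(2 * Real.pi * d * freqNorm ν.1 ν.2) • z‖ ^ 2) := by
  have scale_nonneg : 0 ≤ 2 * Real.pi * d * freqNorm ν.1 ν.2 :=
    mul_nonneg (by positivity) (freqNorm_nonneg ν)
  rw [cylChar_proj, Real.fourierChar_apply, Complex.exp_ofReal_mul_I_re, norm_smul,
    Real.norm_of_nonneg scale_nonneg]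
  refine (one_sub_cos_le_two_mul_min _).trans ?_
  rw [← sq_abs, abs_mul, abs_of_pos Real.two_pi_pos, mul_assoc (2 * Real.pi),
    mul_assoc (2 * Real.pi)]
  gcongr
  exact abs_phase_le hd ν z

theorem continuous_one_sub_cylChar_re (ν : Freq d) :
    Continuous fun w : Cyl d => 1 - (cylChar ν w : ℂ).re :=
  continuous_const.sub (Complex.continuous_re.comp (continuous_cylChar ν))

namespace IsJumpKernel

theorem lintegral_min_norm_smul (hH : IsJumpKernel d H) (hd : 1 ≤ d) {a : ℝ} (ha : 0 ≤ a) :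
    ∫⁻ z, ENNReal.ofReal (min 1 (‖a • z‖ ^ 2)) ∂coverJump H =
      ENNReal.ofReal a * ∫⁻ z, ENNReal.ofReal (min 1 (‖z‖ ^ 2)) ∂coverJump H := by
  rcases ha.eq_or_lt with rfl | ha
  · simp
  · exact hH.lintegral_coverJump_smul hd
      (F := fun z => ENNReal.ofReal (min 1 (‖z‖ ^ 2))) (by fun_prop) ha

theorem lintegral_one_sub_cylChar_le (hH : IsJumpKernel d H) (hd : 1 ≤ d) (ν : Freq d) :
    ∫⁻ w, ENNReal.ofReal (1 - (cylChar ν w : ℂ).re) ∂jump H ≤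
      2 * (ENNReal.ofReal (2 * Real.pi * d * freqNorm ν.1 ν.2) *
        ∫⁻ z, ENNReal.ofReal (min 1 (‖z‖ ^ 2)) ∂coverJump H) := by
  rw [lintegral_jump (continuous_one_sub_cylChar_re ν).measurable.ennreal_ofReal,
    ← hH.lintegral_min_norm_smul hd (mul_nonneg (by positivity) (freqNorm_nonneg ν)),
    ← lintegral_const_mul _ (by fun_prop)]
  refine lintegral_mono fun z => ?_
  rw [← ENNReal.ofReal_ofNat 2, ← ENNReal.ofReal_mul zero_le_two]
  exact ENNReal.ofReal_le_ofReal (one_sub_cylChar_proj_le hd ν z)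

theorem exists_symbol_bound (hH : IsJumpKernel d H) (hd : 1 ≤ d) :
    ∃ C : ℝ, 0 ≤ C ∧ ∀ (ε : ℝ) (ν : Freq d),
      ∫ w, (1 - (cylChar ν w : ℂ).re) ∂jumpTrunc H ε ≤ C * freqNorm ν.1 ν.2 := by
  set A := ∫⁻ z, ENNReal.ofReal (min 1 (‖z‖ ^ 2)) ∂coverJump H
  have A_ne_top : A ≠ ⊤ := (hH.lintegral_coverJump_min_lt_top hd).ne
  refine ⟨2 * (2 * Real.pi * d * A.toReal), by positivity, fun ε ν => ?_⟩
  have scale_nonneg : 0 ≤ 2 * Real.pi * d * freqNorm ν.1 ν.2 :=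
    mul_nonneg (by positivity) (freqNorm_nonneg ν)
  rw [integral_eq_lintegral_of_nonneg_ae
    (ae_of_all _ fun w => sub_nonneg.2 (cylChar_re_le_one ν w))
    (continuous_one_sub_cylChar_re ν).aestronglyMeasurable]
  calc (∫⁻ w, ENNReal.ofReal (1 - (cylChar ν w : ℂ).re) ∂jumpTrunc H ε).toReal
      ≤ (2 * (ENNReal.ofReal (2 * Real.pi * d * freqNorm ν.1 ν.2) * A)).toReal := by
        refine ENNReal.toReal_mono (by finiteness) ?_
        exact (lintegral_mono' Measure.restrict_le_self le_rfl).trans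
          (hH.lintegral_one_sub_cylChar_le hd ν)
    _ = 2 * (2 * Real.pi * d * A.toReal) * freqNorm ν.1 ν.2 := by
        rw [ENNReal.toReal_mul, ENNReal.toReal_mul, ENNReal.toReal_ofReal scale_nonneg,
          ENNReal.toReal_ofNat]
        ring

end IsJumpKernel

end Symbol

/-! ### The jump measure has density `K` -/

section Cells

variable {d : ℕ}

/-- The translate by `j ∈ ℤ^(d-1)` of the fundamental domain `ℝ × [0,1)^(d-1)` of the covering
projection. -/
def cell (j : Fin (d - 1) → ℤ) : Set (Cover d) := {z | ∀ i, ⌊z.2 i⌋ = j i}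

theorem measurableSet_cell (j : Fin (d - 1) → ℤ) : MeasurableSet (cell j : Set (Cover d)) := by
  have measurable_floor : Measurable fun (z : Cover d) i => ⌊z.2 i⌋ :=
    measurable_pi_lambda _ fun i => Int.measurable_floor.comp
      ((measurable_pi_apply i).comp measurable_snd)
  convert measurable_floor (measurableSet_singleton j) using 1
  ext z
  exact funext_iff.symm

theorem cell_zero :
    (cell 0 : Set (Cover d)) = Set.univ ×ˢ Set.univ.pi fun _ => Set.Ico (0 : ℝ) 1 := by
  ext z
  simp only [cell, Pi.zero_apply, Int.floor_eq_zero_iff, Set.mem_ofPred_eq, Set.mem_prod,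
    Set.mem_univ, true_and, Set.mem_pi, forall_const]

theorem measurePreserving_proj_cell (d : ℕ) :
    MeasurePreserving (proj : Cover d → Cyl d) (volume.restrict (cell 0)) volume := by
  have circle_cover : MeasurePreserving (fun y : ℝ => (y : UnitAddCircle))
      (volume.restrict (Set.Ico 0 1)) volume := by
    simpa only [zero_add, restrict_Ico_eq_restrict_Ioc] using UnitAddCircle.measurePreserving_mk 0
  have torus_cover : MeasurePreserving (fun (y : Fin (d - 1) → ℝ) i => (y i : UnitAddCircle))
      (volume.restrict (Set.univ.pi fun _ => Set.Ico (0 : ℝ) 1)) volume := by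
    rw [volume_pi, Measure.restrict_pi_pi, volume_pi]
    exact measurePreserving_pi _ _ fun _ => circle_cover
  rw [cell_zero, Measure.volume_eq_prod, ← Measure.prod_restrict, Measure.restrict_univ,
    Measure.volume_eq_prod]
  exact (MeasurePreserving.id volume).prod torus_cover

theorem measurePreserving_shift (j : Fin (d - 1) → ℤ) :
    MeasurePreserving fun z : Cover d => shift z j := by
  have shift_eq_add (z : Cover d) : shift z j = z + (0, fun i => (j i : ℝ)) :=
    Prod.ext (add_zero _).symm rfl
  simp only [shift_eq_add]
  exact measurePreserving_add_right volume _

theorem proj_shift (z : Cover d) (j : Fin (d - 1) → ℤ) : proj (shift z j) = proj z := by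
  refine Prod.ext rfl (funext fun i => ?_)
  simp only [proj, shift, AddCircle.coe_add]
  rw [add_eq_left, AddCircle.coe_eq_zero_iff]
  exact ⟨j i, by rw [zsmul_one]⟩

theorem shift_rep_ne_zero {w : Cyl d} (hw : w ≠ 0) (j : Fin (d - 1) → ℤ) :
    shift (rep w) j ≠ 0 := by
  intro h
  refine hw ?_
  rw [← proj_rep w, ← proj_shift (rep w) j, h]
  rfl

theorem rep_proj_of_mem_cell {z : Cover d} (hz : z ∈ cell 0) : rep (proj z) = z := by
  refine Prod.ext rfl (funext fun i => ?_)
  have mem_Ico : z.2 i ∈ Set.Ico (0 : ℝ) (0 + 1) := by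
    rw [zero_add]
    exact Int.floor_eq_zero_iff.1 (hz i)
  exact congrArg Subtype.val (AddCircle.equivIco_coe_eq (p := (1 : ℝ)) mem_Ico)

theorem lintegral_eq_tsum_cell {F : Cover d → ENNReal} (hF : Measurable F) :
    ∫⁻ z, F z = ∑' j, ∫⁻ z in cell 0, F (shift z j) := by
  have iUnion_cell : ⋃ j, (cell j : Set (Cover d)) = Set.univ :=
    Set.eq_univ_of_forall fun z => Set.mem_iUnion.2 ⟨fun i => ⌊z.2 i⌋, fun _ => rfl⟩
  have disjoint_cell :
      Pairwise (Function.onFun Disjoint (cell : (Fin (d - 1) → ℤ) → Set (Cover d))) := by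
    refine fun j k hjk => Set.disjoint_left.2 fun z hzj hzk => hjk (funext fun i => ?_)
    rw [← hzj i, ← hzk i]
  have preimage_shift_cell (j : Fin (d - 1) → ℤ) :
      (fun z : Cover d => shift z j) ⁻¹' cell j = cell 0 := by
    ext z
    simp [cell, shift]
  rw [← setLIntegral_univ, ← iUnion_cell, lintegral_iUnion measurableSet_cell disjoint_cell]
  refine tsum_congr fun j => ?_
  rw [← preimage_shift_cell j,
    (measurePreserving_shift j).setLIntegral_comp_preimage (measurableSet_cell j) hF]

theorem measurable_rep : Measurable (rep : Cyl d → Cover d) :=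
  measurable_fst.prodMk (measurable_pi_lambda _ fun i => measurable_subtype_coe.comp
    ((AddCircle.measurableEquivIco (1 : ℝ) 0).measurable.comp
      ((measurable_pi_apply i).comp measurable_snd)))

end Cells

section Density

variable {d : ℕ} {H : Cover d → ℝ}

/-- The kernel `K` with values in `[0, ∞]`, whose defining series needs no convergence. -/
def eperiodize (H : Cover d → ℝ) (w : Cyl d) : ENNReal :=
  ∑' j : Fin (d - 1) → ℤ, ENNReal.ofReal (H (shift (rep w) j))

theorem measurable_eperiodize (hH : Measurable H) : Measurable (eperiodize H) :=
  Measurable.tsum fun j =>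
    (hH.comp ((measurePreserving_shift j).measurable.comp measurable_rep)).ennreal_ofReal

namespace IsJumpKernel

theorem jump_eq_withDensity (hH : IsJumpKernel d H) :
    jump H = volume.withDensity (eperiodize H) := by
  refine Measure.ext_of_lintegral _ fun F hF => ?_
  have measurable_K := measurable_eperiodize hH.measurable
  have measurable_F_proj := hF.comp continuous_proj.measurable
  have measurable_lift : Measurable fun z => F (proj z) * ENNReal.ofReal (H z) :=
    measurable_F_proj.mul hH.measurable.ennreal_ofReal
  calc ∫⁻ w, F w ∂jump H
      = ∫⁻ z, F (proj z) * ENNReal.ofReal (H z) := by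
        rw [lintegral_jump hF, hH.lintegral_coverJump (F := fun z => F (proj z)) measurable_F_proj]
    _ = ∫⁻ z in cell 0, ∑' j, F (proj z) * ENNReal.ofReal (H (shift z j)) := by
        rw [lintegral_eq_tsum_cell measurable_lift]
        refine (lintegral_tsum fun j => (measurable_lift.comp
          (measurePreserving_shift j).measurable).aemeasurable).symm.trans ?_
        simp only [Function.comp_apply, proj_shift]
    _ = ∫⁻ z in cell 0, eperiodize H (proj z) * F (proj z) := by
        refine setLIntegral_congr_fun (measurableSet_cell 0) fun z hz => ?_
        simp only [ENNReal.tsum_mul_left, eperiodize, rep_proj_of_mem_cell hz, mul_comm]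
    _ = ∫⁻ w, F w ∂volume.withDensity (eperiodize H) := by
        rw [lintegral_withDensity_eq_lintegral_mul _ measurable_K hF,
          ← (measurePreserving_proj_cell d).lintegral_comp (measurable_K.mul hF)]
        rfl

theorem toReal_eperiodize (hH : IsJumpKernel d H) {w : Cyl d} (hw : w ≠ 0) :
    (eperiodize H w).toReal = periodize H w := by
  rw [periodize, eperiodize, ENNReal.tsum_toReal_eq fun _ => ENNReal.ofReal_ne_top]
  exact tsum_congr fun j => ENNReal.toReal_ofReal (hH.pos _ (shift_rep_ne_zero hw j)).le

theorem eperiodize_pos (hH : IsJumpKernel d H) {w : Cyl d} (hw : w ≠ 0) : 0 < eperiodize H w :=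
  (ENNReal.ofReal_pos.2 (hH.pos _ (shift_rep_ne_zero hw 0))).trans_le
    (ENNReal.le_tsum (f := fun j => ENNReal.ofReal (H (shift (rep w) j))) 0)

theorem jumpTrunc_eq_withDensity (hH : IsJumpKernel d H) (ε : ℝ) :
    jumpTrunc H ε = (volume.restrict {w : Cyl d | ε < cylNorm w}).withDensity (eperiodize H) := by
  rw [jumpTrunc, hH.jump_eq_withDensity, restrict_withDensity (measurableSet_lt_cylNorm ε)]

theorem jumpTrunc_absolutelyContinuous (hH : IsJumpKernel d H) (ε : ℝ) :
    jumpTrunc H ε ≪ volume := by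
  rw [hH.jumpTrunc_eq_withDensity]
  exact (withDensity_absolutelyContinuous _ _).trans Measure.restrict_le_self.absolutelyContinuous

theorem ae_of_forall_ae_jumpTrunc (hH : IsJumpKernel d H) {P : Cyl d → Prop}
    (h : ∀ n : ℕ, ∀ᵐ w ∂jumpTrunc H (1 / ((n : ℝ) + 1)), P w) : ∀ᵐ w, P w := by
  have holds_far (n : ℕ) : ∀ᵐ w : Cyl d, 1 / ((n : ℝ) + 1) < cylNorm w → P w := by
    have holds_trunc := h n
    rw [hH.jumpTrunc_eq_withDensity, ae_withDensity_iff (measurable_eperiodize hH.measurable),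
      ae_restrict_iff' (measurableSet_lt_cylNorm _)] at holds_trunc
    filter_upwards [holds_trunc, Measure.ae_ne volume 0] with w hw w_ne_zero hn
    exact hw hn (hH.eperiodize_pos w_ne_zero).ne'
  filter_upwards [ae_all_iff.2 holds_far, Measure.ae_ne volume 0] with w hw w_ne_zero
  obtain ⟨n, hn⟩ := exists_nat_one_div_lt (cylNorm_pos w_ne_zero)
  exact hw n hn

theorem ae_eperiodize_lt_top (hH : IsJumpKernel d H) (hd : 1 ≤ d) {ε : ℝ} (hε : 0 < ε) :
    ∀ᵐ z ∂volume.restrict {w : Cyl d | ε < cylNorm w}, eperiodize H z < ⊤ := by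
  have := hH.isFiniteMeasure_jumpTrunc hd hε
  refine ae_lt_top (measurable_eperiodize hH.measurable) ?_
  rw [← setLIntegral_univ, ← withDensity_apply _ MeasurableSet.univ,
    ← hH.jumpTrunc_eq_withDensity]
  exact measure_ne_top _ _

theorem setIntegral_eq_integral_jumpTrunc (hH : IsJumpKernel d H) (hd : 1 ≤ d) (u : Cyl d → ℝ)
    (w : Cyl d) {ε : ℝ} (hε : 0 < ε) :
    ∫ w' in {w' : Cyl d | ε < cylNorm (w - w')}, (u w - u w') * periodize H (w - w') =
      ∫ z, (u w - u (w - z)) ∂jumpTrunc H ε := by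
  have measurableSet_far : MeasurableSet {w' : Cyl d | ε < cylNorm (w - w')} :=
    (isOpen_lt continuous_const
      (continuous_cylNorm.comp (continuous_const.sub continuous_id))).measurableSet
  rw [hH.jumpTrunc_eq_withDensity, integral_withDensity_eq_integral_toReal_smul
      (measurable_eperiodize hH.measurable) (hH.ae_eperiodize_lt_top hd hε),
    ← integral_indicator measurableSet_far, ← integral_indicator (measurableSet_lt_cylNorm ε),
    ← integral_sub_left_eq_self _ volume w]
  refine integral_congr_ae (ae_of_all _ fun z => ?_)
  simp only [Set.indicator, Set.mem_ofPred_eq, sub_sub_cancel]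
  split_ifs with far
  · have z_ne_zero : z ≠ 0 := by
      rintro rfl
      exact (hε.trans far).ne' (cylNorm_eq_zero.2 rfl)
    rw [← hH.toReal_eperiodize z_ne_zero, smul_eq_mul, mul_comm]
  · rfl

end IsJumpKernel

theorem HasL.tendsto_integral_jumpTrunc (hH : IsJumpKernel d H) (hd : 1 ≤ d) {u : Cyl d → ℝ}
    {w : Cyl d} {l : ℝ} (h : HasL H u w l) :
    Tendsto (fun n : ℕ => ∫ z, (u w - u (w - z)) ∂jumpTrunc H (1 / ((n : ℝ) + 1))) atTop
      (𝓝 l) := by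
  have tendsto_radius : Tendsto (fun n : ℕ => 1 / ((n : ℝ) + 1)) atTop (𝓝[>] 0) :=
    tendsto_nhdsWithin_iff.2 ⟨tendsto_one_div_add_atTop_nhds_zero_nat,
      Eventually.of_forall fun n => Set.mem_Ioi.2 Nat.one_div_pos_of_nat⟩
  refine (h.comp tendsto_radius).congr fun n => ?_
  exact hH.setIntegral_eq_integral_jumpTrunc hd u w Nat.one_div_pos_of_nat

end Density

/-! ### Finite symmetric jump operators on a group -/

section JumpOperator

variable {G : Type*} [AddCommGroup G] [MeasurableSpace G]

/-- The bounded nonlocal operator `f ↦ ∫ (f(w) - f(w - z)) dκ(z)` with jump measure `κ`. -/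
def nonlocal (κ : Measure G) (f : G → ℝ) (w : G) : ℝ := ∫ z, (f w - f (w - z)) ∂κ

/-- The Wronskian `w(p) v(p - z) - v(p) w(p - z)` of two functions along the jump from `p` to
`p - z`. -/
def jumpWronskian (v w : G → ℝ) (p : G × G) : ℝ :=
  w p.1 * v (p.1 - p.2) - v p.1 * w (p.1 - p.2)

variable [MeasurableAdd₂ G] {μ κ : Measure G} [SFinite μ] [μ.IsAddRightInvariant]
  [IsFiniteMeasure κ] {f v w φ : G → ℝ}

theorem memLp_comp_add (hf : MemLp f 2 μ) :
    MemLp (fun p : G × G => f (p.1 + p.2)) 2 (μ.prod κ) :=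
  (hf.comp_fst κ).comp_measurePreserving (measurePreserving_add_prod μ κ)

variable [MeasurableNeg G]

theorem measurePreserving_sub_prod_neg [κ.IsNegInvariant] :
    MeasurePreserving (fun p : G × G => (p.1 - p.2, -p.2)) (μ.prod κ) (μ.prod κ) :=
  ((MeasurePreserving.id μ).prod (Measure.measurePreserving_neg κ)).comp
    (measurePreserving_sub_prod μ κ)

theorem memLp_comp_sub (hf : MemLp f 2 μ) :
    MemLp (fun p : G × G => f (p.1 - p.2)) 2 (μ.prod κ) :=
  (hf.comp_fst κ).comp_measurePreserving (measurePreserving_sub_prod μ κ)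

theorem ae_integrable_comp_sub (hf : MemLp f 2 μ) :
    ∀ᵐ w ∂μ, Integrable (fun z => f (w - z)) κ :=
  (ae_memLp_two_section (memLp_comp_sub hf)).mono fun _ h => h.integrable one_le_two

theorem ae_nonlocal_eq_symm [κ.IsNegInvariant] (hf : MemLp f 2 μ) :
    ∀ᵐ w ∂μ, nonlocal κ f w = ∫ z, (f w - (1 / 2) * f (w - z) - (1 / 2) * f (w + z)) ∂κ := by
  filter_upwards [ae_integrable_comp_sub (κ := κ) hf,
    (ae_memLp_two_section (memLp_comp_add (κ := κ) hf)).mono fun _ h => h.integrable one_le_two]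
    with w integrable_left integrable_right
  have integral_right : ∫ z, (f w - f (w + z)) ∂κ = nonlocal κ f w := by
    rw [nonlocal, ← integral_neg_eq_self]
    simp only [← sub_eq_add_neg]
  calc nonlocal κ f w
      = (1 / 2) * ∫ z, (f w - f (w - z)) ∂κ + (1 / 2) * ∫ z, (f w - f (w + z)) ∂κ := by
        rw [integral_right, ← nonlocal]
        ring
    _ = ∫ z, (f w - (1 / 2) * f (w - z) - (1 / 2) * f (w + z)) ∂κ := by
        rw [← integral_const_mul, ← integral_const_mul, ← integral_add]
        · congr 1 with z
          ring
        · exact ((integrable_const _).sub integrable_left).const_mul _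
        · exact ((integrable_const _).sub integrable_right).const_mul _

theorem aestronglyMeasurable_nonlocal (hf : MemLp f 2 μ) :
    AEStronglyMeasurable (nonlocal κ f) μ :=
  ((hf.comp_fst κ).sub (memLp_comp_sub hf)).1.integral_prod_right'

theorem integrable_jumpWronskian (hv : MemLp v 2 μ) (hw : MemLp w 2 μ) :
    Integrable (jumpWronskian v w) (μ.prod κ) :=
  ((hw.comp_fst κ).integrable_mul (memLp_comp_sub hv)).sub
    ((hv.comp_fst κ).integrable_mul (memLp_comp_sub hw))

section Weighted

variable {M : ℝ}

theorem integrable_fst_mul_jumpWronskian (hv : MemLp v 2 μ) (hw : MemLp w 2 μ)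
    (hφ : AEStronglyMeasurable φ μ) (hM : ∀ p, |φ p| ≤ M) :
    Integrable (fun p => φ p.1 * jumpWronskian v w p) (μ.prod κ) :=
  (integrable_jumpWronskian hv hw).bdd_mul hφ.comp_fst (ae_of_all _ fun _ => hM _)

theorem integrable_comp_sub_mul_jumpWronskian (hv : MemLp v 2 μ) (hw : MemLp w 2 μ)
    (hφ : AEStronglyMeasurable φ μ) (hM : ∀ p, |φ p| ≤ M) :
    Integrable (fun p => φ (p.1 - p.2) * jumpWronskian v w p) (μ.prod κ) :=
  (integrable_jumpWronskian hv hw).bdd_mul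
    (hφ.comp_fst.comp_measurePreserving (measurePreserving_sub_prod μ κ))
    (ae_of_all _ fun _ => hM _)

theorem integrable_jumpWronskian_mul_sub (hv : MemLp v 2 μ) (hw : MemLp w 2 μ)
    (hφ : AEStronglyMeasurable φ μ) (hM : ∀ p, |φ p| ≤ M) :
    Integrable (fun p => jumpWronskian v w p * (φ p.1 - φ (p.1 - p.2))) (μ.prod κ) := by
  simp only [mul_comm (jumpWronskian _ _ _), sub_mul]
  exact (integrable_fst_mul_jumpWronskian hv hw hφ hM).sub
    (integrable_comp_sub_mul_jumpWronskian hv hw hφ hM)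

theorem integral_fst_mul_jumpWronskian_eq_neg [κ.IsNegInvariant] (hv : MemLp v 2 μ)
    (hw : MemLp w 2 μ) (hφ : AEStronglyMeasurable φ μ) (hM : ∀ p, |φ p| ≤ M) :
    ∫ p, φ p.1 * jumpWronskian v w p ∂μ.prod κ =
      -∫ p, φ (p.1 - p.2) * jumpWronskian v w p ∂μ.prod κ := by
  have reverse_jump := measurePreserving_sub_prod_neg (μ := μ) (κ := κ)
  have integrable_left := integrable_fst_mul_jumpWronskian (κ := κ) hv hw hφ hM
  rw [← reverse_jump.map_eq, integral_map reverse_jump.aemeasurable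
    (by rw [reverse_jump.map_eq]; exact integrable_left.1), reverse_jump.map_eq, ← integral_neg]
  congr 1 with p
  simp only [jumpWronskian, sub_neg_eq_add, sub_add_cancel]
  ring

theorem integral_mul_wronskian_eq_integral_prod (hv : MemLp v 2 μ) (hw : MemLp w 2 μ)
    (hφ : AEStronglyMeasurable φ μ) (hM : ∀ p, |φ p| ≤ M) :
    ∫ p, φ p * (v p * nonlocal κ w p - w p * nonlocal κ v p) ∂μ =
      ∫ p, φ p.1 * jumpWronskian v w p ∂μ.prod κ := by
  rw [integral_prod _ (integrable_fst_mul_jumpWronskian hv hw hφ hM)]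
  refine integral_congr_ae ?_
  filter_upwards [ae_integrable_comp_sub (κ := κ) hv, ae_integrable_comp_sub (κ := κ) hw]
    with p integrable_v integrable_w
  rw [nonlocal, nonlocal, integral_const_mul, ← integral_const_mul (v p),
    ← integral_const_mul (w p), ← integral_sub]
  · congr 2 with z
    simp only [jumpWronskian]
    ring
  · exact ((integrable_const _).sub integrable_w).const_mul _
  · exact ((integrable_const _).sub integrable_v).const_mul _

theorem integral_mul_wronskian [κ.IsNegInvariant] (hv : MemLp v 2 μ) (hw : MemLp w 2 μ)
    (hφ : AEStronglyMeasurable φ μ) (hM : ∀ p, |φ p| ≤ M) :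
    ∫ p, φ p * (v p * nonlocal κ w p - w p * nonlocal κ v p) ∂μ =
      (1 / 2) * ∫ p, jumpWronskian v w p * (φ p.1 - φ (p.1 - p.2)) ∂μ.prod κ := by
  rw [integral_mul_wronskian_eq_integral_prod hv hw hφ hM]
  simp only [mul_comm (jumpWronskian _ _ _), sub_mul]
  rw [integral_sub (integrable_fst_mul_jumpWronskian hv hw hφ hM)
    (integrable_comp_sub_mul_jumpWronskian hv hw hφ hM)]
  linarith [integral_fst_mul_jumpWronskian_eq_neg (κ := κ) hv hw hφ hM]

end Weighted

end JumpOperator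

/-! ### Weak convergence in `L²` from almost everywhere convergence -/

section WeakConvergence

variable {α : Type*} [MeasurableSpace α] {μ : Measure α}

theorem abs_integral_mul_le {f g : α → ℝ} (hf : MemLp f 2 μ) (hg : MemLp g 2 μ) :
    |∫ x, f x * g x ∂μ| ≤ √(∫ x, f x ^ 2 ∂μ) * √(∫ x, g x ^ 2 ∂μ) := by
  have hölder := integral_mul_norm_le_Lp_mul_Lq (p := 2) (q := 2) Real.HolderConjugate.two_two
    (by simpa using hf) (by simpa using hg)
  simp only [Real.rpow_two, Real.norm_eq_abs, sq_abs, ← abs_mul, ← Real.sqrt_eq_rpow] at hölder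
  exact abs_integral_le_integral_abs.trans hölder

variable {h : ℕ → α → ℝ} {h₀ ψ : α → ℝ} {C : ℝ}

theorem memLp_two_of_tendsto_ae (hh : ∀ n, MemLp (h n) 2 μ) (hC : ∀ n, ∫ x, h n x ^ 2 ∂μ ≤ C)
    (hlim : ∀ᵐ x ∂μ, Tendsto (fun n => h n x) atTop (𝓝 (h₀ x))) : MemLp h₀ 2 μ := by
  have meas_lim : AEStronglyMeasurable h₀ μ :=
    aestronglyMeasurable_of_tendsto_ae _ (fun n => (hh n).1) hlim
  rw [memLp_two_iff_integrable_sq meas_lim]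
  refine ⟨meas_lim.pow 2, ?_⟩
  rw [hasFiniteIntegral_iff_ofReal (ae_of_all _ fun x => sq_nonneg _)]
  calc ∫⁻ x, ENNReal.ofReal (h₀ x ^ 2) ∂μ
      = ∫⁻ x, liminf (fun n => ENNReal.ofReal (h n x ^ 2)) atTop ∂μ := by
        refine lintegral_congr_ae (hlim.mono fun x hx => ?_)
        exact (((ENNReal.continuous_ofReal.tendsto _).comp (hx.pow 2)).liminf_eq).symm
    _ ≤ liminf (fun n => ∫⁻ x, ENNReal.ofReal (h n x ^ 2) ∂μ) atTop :=
        lintegral_liminf_le' fun n => ((hh n).1.aemeasurable.pow_const 2).ennreal_ofReal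
    _ ≤ ENNReal.ofReal C := by
        refine liminf_le_of_frequently_le' (Frequently.of_forall fun n => ?_)
        rw [← ofReal_integral_eq_lintegral_ofReal (hh n).integrable_sq
          (ae_of_all _ fun x => sq_nonneg _)]
        exact ENNReal.ofReal_le_ofReal (hC n)
    _ < ⊤ := ENNReal.ofReal_lt_top

theorem memLp_min_abs {f : ℕ → α → ℝ} (hψ : MemLp ψ 2 μ)
    (hf : ∀ n, AEStronglyMeasurable (f n) μ) (n : ℕ) :
    MemLp (fun x => min |ψ x| |f n x|) 2 μ := by
  refine hψ.of_le (hψ.1.norm.inf (hf n).norm) (ae_of_all _ fun x => ?_)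
  rw [Real.norm_of_nonneg (le_min (abs_nonneg _) (abs_nonneg _))]
  exact min_le_left _ _

theorem tendsto_integral_min_abs_sq {f : ℕ → α → ℝ} (hψ : MemLp ψ 2 μ)
    (hf : ∀ n, AEStronglyMeasurable (f n) μ)
    (hlim : ∀ᵐ x ∂μ, Tendsto (fun n => f n x) atTop (𝓝 0)) :
    Tendsto (fun n => ∫ x, min |ψ x| |f n x| ^ 2 ∂μ) atTop (𝓝 0) := by
  rw [← integral_zero α ℝ (μ := μ)]
  refine tendsto_integral_of_dominated_convergence (fun x => ψ x ^ 2)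
    (fun n => (memLp_min_abs hψ hf n).1.pow 2) hψ.integrable_sq
    (fun n => ae_of_all _ fun x => ?_) ?_
  · rw [Real.norm_of_nonneg (sq_nonneg _), ← sq_abs (ψ x)]
    exact pow_le_pow_left₀ (le_min (abs_nonneg _) (abs_nonneg _)) (min_le_left _ _) 2
  · filter_upwards [hlim] with x hx
    have tendsto_min := (tendsto_const_nhds (x := |ψ x|)).min hx.abs
    rw [abs_zero, min_eq_right (abs_nonneg _)] at tendsto_min
    simpa using tendsto_min.pow 2

theorem integral_sub_sq_le {f g : α → ℝ} (hf : MemLp f 2 μ) (hg : MemLp g 2 μ) :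
    ∫ x, (f x - g x) ^ 2 ∂μ ≤ 2 * ∫ x, f x ^ 2 ∂μ + 2 * ∫ x, g x ^ 2 ∂μ := by
  rw [← integral_const_mul, ← integral_const_mul,
    ← integral_add (hf.integrable_sq.const_mul 2) (hg.integrable_sq.const_mul 2)]
  refine integral_mono (hf.sub hg).integrable_sq
    ((hf.integrable_sq.const_mul 2).add (hg.integrable_sq.const_mul 2)) fun x => ?_
  linarith [sq_nonneg (f x + g x)]

/- Splitting `|ψ fₙ| = min(|ψ|, |fₙ|) max(|ψ|, |fₙ|)` separates a factor tending to `0` in `L²` by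
dominated convergence from a factor that stays bounded in `L²`. -/
theorem tendsto_integral_mul_zero {f : ℕ → α → ℝ} (hf : ∀ n, MemLp (f n) 2 μ)
    (hC : ∀ n, ∫ x, f n x ^ 2 ∂μ ≤ C) (hψ : MemLp ψ 2 μ)
    (hlim : ∀ᵐ x ∂μ, Tendsto (fun n => f n x) atTop (𝓝 0)) :
    Tendsto (fun n => ∫ x, f n x * ψ x ∂μ) atTop (𝓝 0) := by
  have memLp_min := memLp_min_abs hψ fun n => (hf n).1
  have memLp_max (n : ℕ) : MemLp (fun x => max |ψ x| |f n x|) 2 μ := hψ.abs.sup (hf n).abs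
  have max_bound (n : ℕ) : ∫ x, max |ψ x| |f n x| ^ 2 ∂μ ≤ ∫ x, ψ x ^ 2 ∂μ + C := by
    calc ∫ x, max |ψ x| |f n x| ^ 2 ∂μ
        ≤ ∫ x, (ψ x ^ 2 + f n x ^ 2) ∂μ := by
          refine integral_mono (memLp_max n).integrable_sq
            (hψ.integrable_sq.add (hf n).integrable_sq) fun x => ?_
          rcases max_choice |ψ x| |f n x| with h | h <;> simp only [h, sq_abs]
          · exact le_add_of_nonneg_right (sq_nonneg _)
          · exact le_add_of_nonneg_left (sq_nonneg _)
      _ ≤ ∫ x, ψ x ^ 2 ∂μ + C := by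
          rw [integral_add hψ.integrable_sq (hf n).integrable_sq]
          gcongr
          exact hC n
  have bound_tendsto : Tendsto (fun n => √(∫ x, min |ψ x| |f n x| ^ 2 ∂μ) *
      √(∫ x, ψ x ^ 2 ∂μ + C)) atTop (𝓝 0) := by
    simpa using (tendsto_integral_min_abs_sq hψ (fun n => (hf n).1) hlim).sqrt.mul_const
      (√(∫ x, ψ x ^ 2 ∂μ + C))
  refine squeeze_zero_norm (fun n => ?_) bound_tendsto
  calc ‖∫ x, f n x * ψ x ∂μ‖
      ≤ ∫ x, min |ψ x| |f n x| * max |ψ x| |f n x| ∂μ := by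
        refine (norm_integral_le_integral_norm _).trans_eq ?_
        simp only [min_mul_max, norm_mul, Real.norm_eq_abs]
        simp only [mul_comm]
    _ ≤ √(∫ x, min |ψ x| |f n x| ^ 2 ∂μ) * √(∫ x, max |ψ x| |f n x| ^ 2 ∂μ) :=
        (le_abs_self _).trans (abs_integral_mul_le (memLp_min n) (memLp_max n))
    _ ≤ √(∫ x, min |ψ x| |f n x| ^ 2 ∂μ) * √(∫ x, ψ x ^ 2 ∂μ + C) := by
        gcongr
        exact max_bound n

theorem tendsto_integral_mul_of_tendsto_ae (hh : ∀ n, MemLp (h n) 2 μ)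
    (hC : ∀ n, ∫ x, h n x ^ 2 ∂μ ≤ C) (hψ : MemLp ψ 2 μ)
    (hlim : ∀ᵐ x ∂μ, Tendsto (fun n => h n x) atTop (𝓝 (h₀ x))) :
    Tendsto (fun n => ∫ x, h n x * ψ x ∂μ) atTop (𝓝 (∫ x, h₀ x * ψ x ∂μ)) := by
  have memLp_lim := memLp_two_of_tendsto_ae hh hC hlim
  have diff_bound (n : ℕ) :
      ∫ x, (h n x - h₀ x) ^ 2 ∂μ ≤ 2 * C + 2 * ∫ x, h₀ x ^ 2 ∂μ := by
    linarith [integral_sub_sq_le (hh n) memLp_lim, hC n]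
  have diff_tendsto : ∀ᵐ x ∂μ, Tendsto (fun n => h n x - h₀ x) atTop (𝓝 0) :=
    hlim.mono fun x hx => tendsto_sub_nhds_zero_iff.2 hx
  rw [← tendsto_sub_nhds_zero_iff]
  refine (tendsto_integral_mul_zero (fun n => (hh n).sub memLp_lim) diff_bound hψ
    diff_tendsto).congr fun n => ?_
  simp only [Pi.sub_apply, sub_mul]
  exact integral_sub ((hh n).integrable_mul hψ) (memLp_lim.integrable_mul hψ)

end WeakConvergence

/-! ### Energy identities on the Fourier side -/

section TranslateCombinations

variable {d : ℕ} {f : Cyl d → ℝ} {m : Measure (Freq d)}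

theorem re_sum_cylChar_mul_conj {ι ι' : Type*} [Fintype ι] [Fintype ι'] (ν : Freq d)
    (c : ι → ℝ) (a : ι → Cyl d) (c' : ι' → ℝ) (a' : ι' → Cyl d) :
    ((∑ i, c i * (cylChar ν (a i) : ℂ)) * conj (∑ j, c' j * (cylChar ν (a' j) : ℂ))).re =
      ∑ i, ∑ j, c i * c' j * (cylChar ν (a i - a' j) : ℂ).re := by
  rw [map_sum, Finset.sum_mul_sum, Complex.re_sum]
  refine Finset.sum_congr rfl fun i _ => ?_
  rw [Complex.re_sum]
  refine Finset.sum_congr rfl fun j _ => ?_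
  rw [map_mul, Complex.conj_ofReal, cylChar_sub, ← Complex.re_ofReal_mul]
  push_cast
  congr 1
  ring

namespace IsSpectral

theorem integral_translate_mul (hf : IsSpectral f m) (a b : Cyl d) :
    ∫ w, f (w + a) * f (w + b) = ∫ ν, (cylChar ν (a - b) : ℂ).re ∂m := by
  rw [← hf.corr, ← integral_add_right_eq_self (fun w => f (w + (a - b)) * f w) b]
  simp only [add_assoc, add_sub_cancel]

theorem integral_sum_translate_mul {ι ι' : Type*} [Fintype ι] [Fintype ι'] (hf : IsSpectral f m)
    (c : ι → ℝ) (a : ι → Cyl d) (c' : ι' → ℝ) (a' : ι' → Cyl d) :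
    ∫ w, (∑ i, c i * f (w + a i)) * ∑ j, c' j * f (w + a' j) =
      ∫ ν, ((∑ i, c i * (cylChar ν (a i) : ℂ)) *
        conj (∑ j, c' j * (cylChar ν (a' j) : ℂ))).re ∂m := by
  have := hf.finite
  have integrable_space (i : ι) (j : ι') :
      Integrable fun w => c i * c' j * (f (w + a i) * f (w + a' j)) :=
    ((memLp_translate hf.memLp _).integrable_mul (memLp_translate hf.memLp _)).const_mul _
  have integrable_freq (i : ι) (j : ι') :
      Integrable (fun ν => c i * c' j * (cylChar ν (a i - a' j) : ℂ).re) m :=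
    (integrable_cylChar m _).re.const_mul _
  simp only [re_sum_cylChar_mul_conj, Finset.sum_mul_sum, mul_mul_mul_comm (c _) (f _)]
  rw [integral_finsetSum _ fun i _ => integrable_finsetSum _ fun j _ => integrable_space i j,
    integral_finsetSum _ fun i _ => integrable_finsetSum _ fun j _ => integrable_freq i j]
  refine Finset.sum_congr rfl fun i _ => ?_
  rw [integral_finsetSum _ fun j _ => integrable_space i j,
    integral_finsetSum _ fun j _ => integrable_freq i j]
  refine Finset.sum_congr rfl fun j _ => ?_
  rw [integral_const_mul, integral_const_mul, hf.integral_translate_mul]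

theorem integral_sum_translate_sq {ι : Type*} [Fintype ι] (hf : IsSpectral f m)
    (c : ι → ℝ) (a : ι → Cyl d) :
    ∫ w, (∑ i, c i * f (w + a i)) ^ 2 = ∫ ν, ‖∑ i, c i * (cylChar ν (a i) : ℂ)‖ ^ 2 ∂m := by
  simp only [sq (∑ i, c i * f _)]
  rw [hf.integral_sum_translate_mul]
  congr 1 with ν
  rw [Complex.mul_conj, Complex.ofReal_re, Complex.normSq_eq_norm_sq]

theorem integral_second_difference_mul (hf : IsSpectral f m) (z z' : Cyl d) :
    ∫ w, (f w - (1 / 2) * f (w - z) - (1 / 2) * f (w + z)) *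
        (f w - (1 / 2) * f (w - z') - (1 / 2) * f (w + z')) =
      ∫ ν, (1 - (cylChar ν z : ℂ).re) * (1 - (cylChar ν z' : ℂ).re) ∂m := by
  have difference_eq (z w : Cyl d) : ∑ i, (![1, -(1 / 2), -(1 / 2)] : Fin 3 → ℝ) i *
      f (w + (![0, -z, z] : Fin 3 → Cyl d) i) =
      f w - (1 / 2) * f (w - z) - (1 / 2) * f (w + z) := by
    simp only [Fin.sum_univ_three, Matrix.cons_val, add_zero, ← sub_eq_add_neg]
    ring
  have symbol_eq (z : Cyl d) (ν : Freq d) :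
      ∑ i, ((![1, -(1 / 2), -(1 / 2)] : Fin 3 → ℝ) i : ℂ) *
        (cylChar ν ((![0, -z, z] : Fin 3 → Cyl d) i) : ℂ) =
      ((1 - (cylChar ν z : ℂ).re : ℝ) : ℂ) := by
    simp only [Fin.sum_univ_three, Matrix.cons_val, AddChar.map_zero_eq_one,
      AddChar.map_neg_eq_inv, Circle.coe_inv_eq_conj, Circle.coe_one]
    push_cast
    rw [Complex.re_eq_add_conj]
    ring
  have combination := hf.integral_sum_translate_mul ![1, -(1 / 2), -(1 / 2)] ![0, -z, z]
    ![1, -(1 / 2), -(1 / 2)] ![0, -z', z']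
  simp only [difference_eq, symbol_eq] at combination
  rw [combination]
  congr 1 with ν
  rw [Complex.conj_ofReal, ← Complex.ofReal_mul, Complex.ofReal_re]

end IsSpectral

end TranslateCombinations

section SecondDifference

variable {d : ℕ} {f : Cyl d → ℝ} {m : Measure (Freq d)} {κ : Measure (Cyl d)} [IsFiniteMeasure κ]

theorem integrable_second_difference_mul (hf : MemLp f 2) :
    Integrable (fun p : Cyl d × (Cyl d × Cyl d) =>
      (f p.1 - (1 / 2) * f (p.1 - p.2.1) - (1 / 2) * f (p.1 + p.2.1)) *
        (f p.1 - (1 / 2) * f (p.1 - p.2.2) - (1 / 2) * f (p.1 + p.2.2)))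
      (volume.prod (κ.prod κ)) := by
  have memLp_difference : MemLp (fun p : Cyl d × Cyl d =>
      f p.1 - (1 / 2) * f (p.1 - p.2) - (1 / 2) * f (p.1 + p.2)) 2 (volume.prod κ) :=
    ((hf.comp_fst κ).sub ((memLp_comp_sub hf).const_mul _)).sub ((memLp_comp_add hf).const_mul _)
  have memLp_left : MemLp (fun p : Cyl d × (Cyl d × Cyl d) =>
      f p.1 - (1 / 2) * f (p.1 - p.2.1) - (1 / 2) * f (p.1 + p.2.1)) 2
      (volume.prod (κ.prod κ)) :=
    (memLp_difference.comp_fst κ).comp_measurePreserving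
      (measurePreserving_prodAssoc (volume : Measure (Cyl d)) κ κ).symm
  exact memLp_left.integrable_mul (memLp_left.comp_measurePreserving
    ((MeasurePreserving.id volume).prod Measure.measurePreserving_swap))

theorem ae_integral_second_difference_mul [κ.IsNegInvariant] (hf : MemLp f 2) :
    ∀ᵐ w : Cyl d, ∫ q : Cyl d × Cyl d, (f w - (1 / 2) * f (w - q.1) - (1 / 2) * f (w + q.1)) *
      (f w - (1 / 2) * f (w - q.2) - (1 / 2) * f (w + q.2)) ∂κ.prod κ = nonlocal κ f w ^ 2 := by
  filter_upwards [ae_nonlocal_eq_symm (κ := κ) hf] with w hw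
  rw [hw, sq, integral_prod_mul (fun z => f w - (1 / 2) * f (w - z) - (1 / 2) * f (w + z))
    (fun z => f w - (1 / 2) * f (w - z) - (1 / 2) * f (w + z))]

theorem memLp_nonlocal [κ.IsNegInvariant] (hf : MemLp f 2) : MemLp (nonlocal κ f) 2 :=
  (memLp_two_iff_integrable_sq (aestronglyMeasurable_nonlocal hf)).2
    ((integrable_second_difference_mul hf).integral_prod_left.congr
      (ae_integral_second_difference_mul hf))

theorem integrable_one_sub_cylChar_mul [IsFiniteMeasure m] :
    Integrable (fun p : (Cyl d × Cyl d) × Freq d =>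
      (1 - (cylChar p.2 p.1.1 : ℂ).re) * (1 - (cylChar p.2 p.1.2 : ℂ).re))
      ((κ.prod κ).prod m) := by
  refine Integrable.of_bound (C := 2 * 2) ?_ (ae_of_all _ fun p => ?_)
  · exact ((measurable_const.sub (Complex.measurable_re.comp
      (measurable_cylChar measurable_snd measurable_fst.fst))).mul
      (measurable_const.sub (Complex.measurable_re.comp
        (measurable_cylChar measurable_snd measurable_fst.snd)))).aestronglyMeasurable
  · have norm_le_two (z : Cyl d) : ‖1 - (cylChar p.2 z : ℂ).re‖ ≤ 2 := by
      have re_bounds := (Complex.abs_re_le_norm (cylChar p.2 z : ℂ)).trans (Circle.norm_coe _).le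
      rw [abs_le] at re_bounds
      rw [Real.norm_eq_abs, abs_le]
      constructor <;> linarith
    rw [norm_mul]
    exact mul_le_mul (norm_le_two _) (norm_le_two _) (norm_nonneg _) zero_le_two

namespace IsSpectral

theorem integral_nonlocal_sq (hf : IsSpectral f m) [κ.IsNegInvariant] :
    ∫ w, nonlocal κ f w ^ 2 = ∫ ν, (∫ w, (1 - (cylChar ν w : ℂ).re) ∂κ) ^ 2 ∂m := by
  have := hf.finite
  calc ∫ w, nonlocal κ f w ^ 2
      = ∫ w : Cyl d, ∫ q : Cyl d × Cyl d,
          (f w - (1 / 2) * f (w - q.1) - (1 / 2) * f (w + q.1)) *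
          (f w - (1 / 2) * f (w - q.2) - (1 / 2) * f (w + q.2)) ∂κ.prod κ :=
        (integral_congr_ae (ae_integral_second_difference_mul hf.memLp)).symm
    _ = ∫ q : Cyl d × Cyl d, (∫ w : Cyl d,
          (f w - (1 / 2) * f (w - q.1) - (1 / 2) * f (w + q.1)) *
          (f w - (1 / 2) * f (w - q.2) - (1 / 2) * f (w + q.2))) ∂κ.prod κ :=
        integral_integral_swap (integrable_second_difference_mul hf.memLp)
    _ = ∫ q : Cyl d × Cyl d, (∫ ν : Freq d,
          (1 - (cylChar ν q.1 : ℂ).re) * (1 - (cylChar ν q.2 : ℂ).re) ∂m) ∂κ.prod κ := by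
        simp only [hf.integral_second_difference_mul]
    _ = ∫ ν : Freq d, (∫ q : Cyl d × Cyl d,
          (1 - (cylChar ν q.1 : ℂ).re) * (1 - (cylChar ν q.2 : ℂ).re) ∂κ.prod κ) ∂m :=
        integral_integral_swap integrable_one_sub_cylChar_mul
    _ = ∫ ν, (∫ w, (1 - (cylChar ν w : ℂ).re) ∂κ) ^ 2 ∂m := by
        congr 1 with ν
        rw [integral_prod_mul (fun z : Cyl d => 1 - (cylChar ν z : ℂ).re)
          (fun z : Cyl d => 1 - (cylChar ν z : ℂ).re), sq]

theorem integral_nonlocal_sq_le (hf : IsSpectral f m) [κ.IsNegInvariant] {C : ℝ}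
    (hC : ∀ ν : Freq d, ∫ w, (1 - (cylChar ν w : ℂ).re) ∂κ ≤ C * freqNorm ν.1 ν.2) :
    ∫ w, nonlocal κ f w ^ 2 ≤ C ^ 2 * ∫ ν, freqNorm ν.1 ν.2 ^ 2 ∂m := by
  rw [hf.integral_nonlocal_sq, ← integral_const_mul]
  refine integral_mono_of_nonneg (ae_of_all _ fun ν => sq_nonneg _)
    (hf.moment.const_mul _) (ae_of_all _ fun ν => ?_)
  simp only [← mul_pow]
  exact pow_le_pow_left₀ (integral_nonneg fun w => sub_nonneg.2 (cylChar_re_le_one ν w)) (hC ν) 2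

end IsSpectral

end SecondDifference

/-! ### Difference quotients -/

section SquareIntegrable

variable {α : Type*} [MeasurableSpace α] {μ : Measure α}

theorem norm_toLp_sq {g : α → ℝ} (hg : MemLp g 2 μ) : ‖hg.toLp‖ ^ 2 = ∫ x, g x ^ 2 ∂μ := by
  rw [← real_inner_self_eq_norm_sq, L2.inner_def]
  refine integral_congr_ae (hg.coeFn_toLp.mono fun x hx => ?_)
  simp only [RCLike.inner_apply, conj_trivial, hx, sq]

theorem exists_tendsto_of_integral_sub_sq_le {g : ℕ → α → ℝ} (hg : ∀ n, MemLp (g n) 2 μ)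
    {E : ℕ → ℝ} (hE : Tendsto E atTop (𝓝 0))
    (hle : ∀ n l, ∫ x, (g n x - g l x) ^ 2 ∂μ ≤ E n + E l) :
    ∃ g₀, MemLp g₀ 2 μ ∧ Tendsto (fun n => ∫ x, (g n x - g₀ x) ^ 2 ∂μ) atTop (𝓝 0) := by
  have norm_sub_sq_le (n l : ℕ) : ‖(hg n).toLp - (hg l).toLp‖ ^ 2 ≤ E n + E l := by
    rw [← MemLp.toLp_sub, norm_toLp_sq]
    exact hle n l
  have cauchy : CauchySeq fun n => (hg n).toLp := by
    rw [Metric.cauchySeq_iff]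
    intro ε hε
    obtain ⟨N, hN⟩ := eventually_atTop.1 (hE.eventually (gt_mem_nhds (half_pos (pow_pos hε 2))))
    refine ⟨N, fun n hn l hl => ?_⟩
    rw [dist_eq_norm]
    refine lt_of_pow_lt_pow_left₀ 2 hε.le ((norm_sub_sq_le n l).trans_lt ?_)
    linarith [hN n hn, hN l hl]
  obtain ⟨G, hG⟩ := cauchySeq_tendsto_of_complete cauchy
  refine ⟨G, Lp.memLp G, ?_⟩
  have tendsto_norm_sq : Tendsto (fun n => ‖(hg n).toLp - G‖ ^ 2) atTop (𝓝 0) := by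
    simpa using (tendsto_iff_norm_sub_tendsto_zero.1 hG).pow 2
  refine tendsto_norm_sq.congr fun n => ?_
  nth_rewrite 1 [← Lp.toLp_coeFn G (Lp.memLp G)]
  rw [← MemLp.toLp_sub, norm_toLp_sq]
  rfl

end SquareIntegrable

/-- The difference quotient of `f` in the direction `b` with step `1 / (n + 1)`. -/
def diffQuot {d : ℕ} (b : Cover d) (n : ℕ) (f : Cyl d → ℝ) (w : Cyl d) : ℝ :=
  (n + 1) * (f (w + proj ((1 / ((n : ℝ) + 1)) • b)) - f w)

/-- The Fourier multiplier of `diffQuot b n` at a frequency whose phase at `b` is `p`. -/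
def diffSymbol (n : ℕ) (p : ℝ) : ℂ :=
  (n + 1) * (Real.fourierChar (1 / ((n : ℝ) + 1) * p) - 1)

theorem measurable_diffSymbol (n : ℕ) : Measurable (diffSymbol n) := by
  unfold diffSymbol
  fun_prop

theorem norm_diffSymbol_le (n : ℕ) (p : ℝ) : ‖diffSymbol n p‖ ≤ 2 * Real.pi * |p| := by
  have norm_step : ‖((n : ℂ) + 1)‖ = (n : ℝ) + 1 := by
    exact_mod_cast Complex.norm_natCast (n + 1)
  rw [diffSymbol, norm_mul, norm_step, Real.fourierChar_apply, mul_comm _ Complex.I]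
  calc ((n : ℝ) + 1) * _ ≤ ((n : ℝ) + 1) * ‖2 * Real.pi * (1 / ((n : ℝ) + 1) * p)‖ := by
        gcongr
        exact Real.norm_exp_I_mul_ofReal_sub_one_le
    _ = 2 * Real.pi * |p| := by
        rw [Real.norm_eq_abs, abs_mul, abs_mul (1 / _), abs_of_pos Real.two_pi_pos,
          abs_of_pos Nat.one_div_pos_of_nat]
        field_simp

theorem tendsto_diffSymbol (p : ℝ) :
    Tendsto (fun n => diffSymbol n p) atTop (𝓝 (2 * Real.pi * Complex.I * p)) := by
  have hasDerivAt : HasDerivAt (fun t : ℝ => (Real.fourierChar (t * p) : ℂ))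
      (2 * Real.pi * Complex.I * p) 0 := by
    have outer := Real.hasDerivAt_fourierChar (0 * p)
    have := outer.scomp_of_eq (h := fun t : ℝ => t * p) 0 (hasDerivAt_mul_const p) rfl
    simpa [Function.comp_def, mul_comm] using this
  have step_tendsto : Tendsto (fun n : ℕ => 1 / ((n : ℝ) + 1)) atTop (𝓝[>] 0) :=
    tendsto_nhdsWithin_iff.2 ⟨tendsto_one_div_add_atTop_nhds_zero_nat,
      Eventually.of_forall fun n => Set.mem_Ioi.2 Nat.one_div_pos_of_nat⟩
  refine (hasDerivAt.tendsto_slope_zero_right.comp step_tendsto).congr fun n => ?_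
  simp [diffSymbol]

theorem norm_diffSymbol_sub_limit_le (n : ℕ) (p : ℝ) :
    ‖diffSymbol n p - 2 * Real.pi * Complex.I * p‖ ≤ 2 * (2 * Real.pi * |p|) := by
  have norm_limit : ‖2 * Real.pi * Complex.I * p‖ = 2 * Real.pi * |p| := by
    simp [abs_of_pos Real.pi_pos]
  exact (norm_sub_le _ _).trans (by linarith [norm_diffSymbol_le n p])

theorem norm_sub_sq_le_two_mul_add {E : Type*} [SeminormedAddCommGroup E] (x y z : E) :
    ‖x - y‖ ^ 2 ≤ 2 * ‖x - z‖ ^ 2 + 2 * ‖y - z‖ ^ 2 := by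
  have triangle := norm_sub_le_norm_sub_add_norm_sub x z y
  rw [norm_sub_rev z y] at triangle
  nlinarith [sq_nonneg (‖x - z‖ - ‖y - z‖), norm_nonneg (x - y)]

namespace IsSpectral

variable {d : ℕ} {f : Cyl d → ℝ} {m : Measure (Freq d)}

theorem memLp_diffQuot (hf : IsSpectral f m) (b : Cover d) (n : ℕ) : MemLp (diffQuot b n f) 2 :=
  ((memLp_translate hf.memLp _).sub hf.memLp).const_mul _

theorem integral_diffQuot_sq (hf : IsSpectral f m) (b : Cover d) (n : ℕ) :
    ∫ w, diffQuot b n f w ^ 2 = ∫ ν, ‖diffSymbol n (phase ν b)‖ ^ 2 ∂m := by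
  have combination := hf.integral_sum_translate_sq ![(n : ℝ) + 1, -((n : ℝ) + 1)]
    ![proj ((1 / ((n : ℝ) + 1)) • b), 0]
  simp only [Fin.sum_univ_two, Matrix.cons_val, add_zero, cylChar_proj, phase_smul,
    AddChar.map_zero_eq_one, Circle.coe_one] at combination
  convert combination using 5 with w ν
  · rw [diffQuot]; ring
  · rw [diffSymbol]; push_cast; ring

theorem integral_diffQuot_sub_sq (hf : IsSpectral f m) (b : Cover d) (n l : ℕ) :
    ∫ w, (diffQuot b n f w - diffQuot b l f w) ^ 2 =
      ∫ ν, ‖diffSymbol n (phase ν b) - diffSymbol l (phase ν b)‖ ^ 2 ∂m := by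
  have combination := hf.integral_sum_translate_sq
    ![(n : ℝ) + 1, -((l : ℝ) + 1), ((l : ℝ) + 1) - ((n : ℝ) + 1)]
    ![proj ((1 / ((n : ℝ) + 1)) • b), proj ((1 / ((l : ℝ) + 1)) • b), 0]
  simp only [Fin.sum_univ_three, Matrix.cons_val, add_zero, cylChar_proj, phase_smul,
    AddChar.map_zero_eq_one, Circle.coe_one] at combination
  convert combination using 5 with w ν
  · rw [diffQuot, diffQuot]; ring
  · rw [diffSymbol, diffSymbol]; push_cast; ring

theorem integral_diffQuot_sq_le (hd : 1 ≤ d) (hf : IsSpectral f m) (b : Cover d) (n : ℕ) :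
    ∫ w, diffQuot b n f w ^ 2 ≤
      (2 * Real.pi * (d * ‖b‖)) ^ 2 * ∫ ν, freqNorm ν.1 ν.2 ^ 2 ∂m := by
  rw [hf.integral_diffQuot_sq, ← integral_const_mul]
  refine integral_mono_of_nonneg (ae_of_all _ fun ν => by positivity)
    (hf.moment.const_mul _) (ae_of_all _ fun ν => ?_)
  calc ‖diffSymbol n (phase ν b)‖ ^ 2
      ≤ (2 * Real.pi * (d * freqNorm ν.1 ν.2 * ‖b‖)) ^ 2 := by
        gcongr
        exact (norm_diffSymbol_le _ _).trans (by gcongr; exact abs_phase_le hd ν b)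
    _ = (2 * Real.pi * (d * ‖b‖)) ^ 2 * freqNorm ν.1 ν.2 ^ 2 := by ring

theorem norm_diffSymbol_sub_limit_sq_le (hd : 1 ≤ d) (b : Cover d) (n : ℕ) (ν : Freq d) :
    ‖diffSymbol n (phase ν b) - 2 * Real.pi * Complex.I * phase ν b‖ ^ 2 ≤
      (2 * (2 * Real.pi * (d * ‖b‖))) ^ 2 * freqNorm ν.1 ν.2 ^ 2 := by
  calc ‖diffSymbol n (phase ν b) - 2 * Real.pi * Complex.I * phase ν b‖ ^ 2
      ≤ (2 * (2 * Real.pi * (d * freqNorm ν.1 ν.2 * ‖b‖))) ^ 2 := by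
        gcongr
        exact (norm_diffSymbol_sub_limit_le _ _).trans (by gcongr; exact abs_phase_le hd ν b)
    _ = (2 * (2 * Real.pi * (d * ‖b‖))) ^ 2 * freqNorm ν.1 ν.2 ^ 2 := by ring

theorem aestronglyMeasurable_norm_diffSymbol_sub_limit_sq (b : Cover d) (n : ℕ) :
    AEStronglyMeasurable (fun ν =>
      ‖diffSymbol n (phase ν b) - 2 * Real.pi * Complex.I * phase ν b‖ ^ 2) m := by
  have measurable_symbol := (measurable_diffSymbol n).comp (measurable_phase b)
  have measurable_limit := (Complex.measurable_ofReal.comp (measurable_phase b)).const_mul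
    (2 * Real.pi * Complex.I)
  exact ((measurable_symbol.sub measurable_limit).norm.pow_const 2).aestronglyMeasurable

theorem integrable_norm_diffSymbol_sub_limit_sq (hd : 1 ≤ d) (hf : IsSpectral f m) (b : Cover d)
    (n : ℕ) : Integrable (fun ν =>
      ‖diffSymbol n (phase ν b) - 2 * Real.pi * Complex.I * phase ν b‖ ^ 2) m :=
  (hf.moment.const_mul _).mono' (aestronglyMeasurable_norm_diffSymbol_sub_limit_sq b n)
    (ae_of_all _ fun ν => by
      rw [Real.norm_of_nonneg (sq_nonneg _)]
      exact norm_diffSymbol_sub_limit_sq_le hd b n ν)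

theorem tendsto_integral_norm_diffSymbol_sub_limit_sq (hd : 1 ≤ d) (hf : IsSpectral f m)
    (b : Cover d) :
    Tendsto (fun n => ∫ ν,
      ‖diffSymbol n (phase ν b) - 2 * Real.pi * Complex.I * phase ν b‖ ^ 2 ∂m) atTop (𝓝 0) := by
  rw [← integral_zero (Freq d) ℝ (μ := m)]
  refine tendsto_integral_of_dominated_convergence _
    (aestronglyMeasurable_norm_diffSymbol_sub_limit_sq b)
    (hf.moment.const_mul ((2 * (2 * Real.pi * (d * ‖b‖))) ^ 2))
    (fun n => ae_of_all _ fun ν => ?_) (ae_of_all _ fun ν => ?_)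
  · rw [Real.norm_of_nonneg (sq_nonneg _)]
    exact norm_diffSymbol_sub_limit_sq_le hd b n ν
  · simpa using ((tendsto_diffSymbol (phase ν b)).sub_const
      (2 * Real.pi * Complex.I * phase ν b)).norm.pow 2

theorem exists_diffQuot_limit (hd : 1 ≤ d) (hf : IsSpectral f m) (b : Cover d) :
    ∃ g, MemLp g 2 ∧ Tendsto (fun n => ∫ w, (diffQuot b n f w - g w) ^ 2) atTop (𝓝 0) := by
  have integrable_error := integrable_norm_diffSymbol_sub_limit_sq hd hf b
  have error_tendsto := (tendsto_integral_norm_diffSymbol_sub_limit_sq hd hf b).const_mul 2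
  rw [mul_zero] at error_tendsto
  refine exists_tendsto_of_integral_sub_sq_le (hf.memLp_diffQuot b) error_tendsto fun n l => ?_
  rw [hf.integral_diffQuot_sub_sq, ← integral_const_mul, ← integral_const_mul,
    ← integral_add ((integrable_error n).const_mul 2) ((integrable_error l).const_mul 2)]
  exact integral_mono_of_nonneg (ae_of_all _ fun ν => sq_nonneg _)
    (((integrable_error n).const_mul 2).add ((integrable_error l).const_mul 2))
    (ae_of_all _ fun ν => norm_sub_sq_le_two_mul_add _ _ _)

end IsSpectral

/-! ### Functions of the axial variable -/

section AxialFunctions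

theorem integral_torusChar_of_ne_zero {d : ℕ} {k : Fin (d - 1) → ℤ} (hk : k ≠ 0) :
    ∫ y, torusChar (d := d) k y = 0 := by
  obtain ⟨i, hi⟩ := Function.ne_iff.1 hk
  simp only [torusChar]
  rw [← pi_haarAddCircle, integral_fintype_prod_eq_prod (fun i => ⇑(fourier (-(k i))))]
  exact Finset.prod_eq_zero (Finset.mem_univ i) (integral_eq_zero_of_add_right_eq_neg
    (fourier_add_half_inv_index (neg_ne_zero.2 hi) one_pos))

theorem torusCoeff_comp_fst {d : ℕ} (θ : ℝ → ℝ) (k : Fin (d - 1) → ℤ) (x : ℝ) :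
    torusCoeff (fun w : Cyl d => θ w.1) k x = if k = 0 then (θ x : ℂ) else 0 := by
  simp only [torusCoeff]
  rw [integral_mul_const]
  split_ifs with hk
  · simp [hk, torusChar]
  · rw [integral_torusChar_of_ne_zero hk, zero_mul]

theorem integrable_norm_pow_mul_norm_sq {V F : Type*} [NormedAddCommGroup V] [NormedSpace ℝ V]
    [MeasurableSpace V] [BorelSpace V] [SecondCountableTopology V] [NormedAddCommGroup F]
    [NormedSpace ℝ F] {μ : Measure V} [μ.HasTemperateGrowth] (f : SchwartzMap V F) (k : ℕ) :
    Integrable (fun x => ‖x‖ ^ k * ‖f x‖ ^ 2) μ := by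
  have bounded := (f.integrable_pow_mul μ k).mul_bdd
    f.continuous.norm.aestronglyMeasurable
    (ae_of_all _ fun x => (norm_norm _).trans_le (SchwartzMap.norm_le_seminorm ℝ f x))
  simpa only [mul_assoc, ← sq] using bounded

theorem lintegral_ofReal_abs_sq_mul_enorm_fourier_sq_lt_top (f : SchwartzMap ℝ ℂ) :
    ∫⁻ ξ, ENNReal.ofReal |ξ| ^ 2 *
      ‖(𝓕 (f.toLp 2) : Lp ℂ 2 (volume : Measure ℝ)) ξ‖ₑ ^ 2 < ⊤ := by
  have moment := (integrable_norm_pow_mul_norm_sq (μ := volume) (𝓕 f) 2).hasFiniteIntegral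
  rw [hasFiniteIntegral_iff_ofReal (ae_of_all _ fun ξ => by positivity)] at moment
  refine lt_of_eq_of_lt (lintegral_congr_ae ?_) moment
  rw [SchwartzMap.toLp_fourier_eq]
  filter_upwards [(𝓕 f).coeFn_toLp 2 volume] with ξ hξ
  rw [hξ, ENNReal.ofReal_mul (by positivity), ENNReal.ofReal_pow (norm_nonneg _),
    ENNReal.ofReal_pow (norm_nonneg _), ofReal_norm (𝓕 f ξ), Real.norm_eq_abs]

theorem memH_one_comp_fst {d : ℕ} {θ : ℝ → ℝ} (hθ : ContDiff ℝ ∞ θ) (hc : HasCompactSupport θ) :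
    MemH 1 (fun w : Cyl d => θ w.1) := by
  have compact_ofReal : HasCompactSupport fun x => (θ x : ℂ) :=
    hc.comp_left (g := fun r : ℝ => (r : ℂ)) Complex.ofReal_zero
  let S : SchwartzMap ℝ ℂ :=
    compact_ofReal.toSchwartzMap (Complex.ofRealCLM.contDiff.comp hθ)
  have memLp_θ : MemLp θ 2 := hθ.continuous.memLp_of_hasCompactSupport hc
  refine ⟨memLp_θ.comp_fst _, Pi.single 0 (S.toLp 2), fun k => ?_, ?_⟩
  · rcases eq_or_ne k 0 with rfl | hk
    · filter_upwards [S.coeFn_toLp 2 volume] with x hx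
      rw [Pi.single_eq_same, hx, torusCoeff_comp_fst, if_pos rfl]
      rfl
    · filter_upwards [Lp.coeFn_zero ℂ 2 (volume : Measure ℝ)] with x hx
      rw [Pi.single_eq_of_ne hk, hx, torusCoeff_comp_fst, if_neg hk, Pi.zero_apply]
  · rw [tsum_eq_single 0 fun k hk => ?_]
    · simpa [freqNorm, Real.sqrt_sq_eq_abs] using
        lintegral_ofReal_abs_sq_mul_enorm_fourier_sq_lt_top S
    · have fourier_zero : 𝓕 (0 : Lp ℂ 2 (volume : Measure ℝ)) = 0 :=
        map_zero (Lp.fourierTransformₗᵢ ℝ ℂ)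
      rw [Pi.single_eq_of_ne hk, fourier_zero]
      refine lintegral_eq_zero_of_ae_eq_zero ?_
      filter_upwards [Lp.coeFn_zero ℂ 2 (volume : Measure ℝ)] with ξ hξ
      rw [hξ, Pi.zero_apply, enorm_zero, zero_pow two_ne_zero, mul_zero, Pi.zero_apply]

end AxialFunctions

/-! ### Uniformly bounded truncated operators -/

section TruncBounded

variable {d : ℕ} {H : Cover d → ℝ} {f g : Cyl d → ℝ}

/-- The truncated jump measures along the radii `1 / (n + 1)`. -/
abbrev jumpSeq (H : Cover d → ℝ) (n : ℕ) : Measure (Cyl d) :=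
  jumpTrunc H (1 / ((n : ℝ) + 1))

theorem jumpSeq_mono : Monotone (jumpSeq H) := fun _ _ h =>
  jumpTrunc_anti (Nat.one_div_le_one_div h)

theorem IsJumpKernel.isFiniteMeasure_jumpSeq (hH : IsJumpKernel d H) (hd : 1 ≤ d) (n : ℕ) :
    IsFiniteMeasure (jumpSeq H n) :=
  hH.isFiniteMeasure_jumpTrunc hd Nat.one_div_pos_of_nat

/-- Square-integrable functions on which the truncated operators `nonlocal (jumpSeq H n)` are
bounded in `L²` uniformly in `n`. Unlike `IsSpectral`, this notion is visibly linear. -/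
structure IsTruncBounded (H : Cover d → ℝ) (g : Cyl d → ℝ) : Prop where
  memLp : MemLp g 2
  memLp_nonlocal : ∀ n, MemLp (nonlocal (jumpSeq H n) g) 2
  bound : ∃ C, ∀ n, ∫ w, nonlocal (jumpSeq H n) g w ^ 2 ≤ C

theorem IsSpectral.isTruncBounded {m : Measure (Freq d)} (hf : IsSpectral f m)
    (hH : IsJumpKernel d H) (hd : 1 ≤ d) : IsTruncBounded H f := by
  have := hH.isFiniteMeasure_jumpSeq hd
  have (n : ℕ) : (jumpSeq H n).IsNegInvariant := hH.isNegInvariant_jumpTrunc _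
  obtain ⟨C, -, hC⟩ := hH.exists_symbol_bound hd
  exact ⟨hf.memLp, fun _ => memLp_nonlocal hf.memLp, _,
    fun _ => hf.integral_nonlocal_sq_le (hC _)⟩

theorem nonlocal_translate (κ : Measure (Cyl d)) (f : Cyl d → ℝ) (a : Cyl d) :
    nonlocal κ (fun w => f (w + a)) = fun w => nonlocal κ f (w + a) := by
  ext w
  simp only [nonlocal, sub_add_eq_add_sub]

theorem nonlocal_const_mul (κ : Measure (Cyl d)) (c : ℝ) (f : Cyl d → ℝ) :
    nonlocal κ (fun w => c * f w) = fun w => c * nonlocal κ f w := by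
  ext w
  simp only [nonlocal, ← mul_sub, integral_const_mul]

theorem nonlocal_sub {κ : Measure (Cyl d)} [IsFiniteMeasure κ] {w : Cyl d}
    (hf : Integrable (fun z => f (w - z)) κ) (hg : Integrable (fun z => g (w - z)) κ) :
    nonlocal κ (fun w => f w - g w) w = nonlocal κ f w - nonlocal κ g w := by
  have integrable_jump {h : Cyl d → ℝ} (hh : Integrable (fun z => h (w - z)) κ) :
      Integrable (fun z => h w - h (w - z)) κ := (integrable_const _).sub hh
  rw [nonlocal, nonlocal, nonlocal, ← integral_sub (integrable_jump hf) (integrable_jump hg)]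
  congr 1 with z
  ring

namespace IsTruncBounded

theorem translate (hf : IsTruncBounded H f) (a : Cyl d) :
    IsTruncBounded H (fun w => f (w + a)) := by
  obtain ⟨C, hC⟩ := hf.bound
  refine ⟨memLp_translate hf.memLp a, fun n => ?_, C, fun n => ?_⟩
  · simpa only [nonlocal_translate] using memLp_translate (hf.memLp_nonlocal n) a
  · simp only [nonlocal_translate]
    exact (integral_add_right_eq_self (fun w => nonlocal (jumpSeq H n) f w ^ 2) a).trans_le (hC n)

theorem const_mul (hf : IsTruncBounded H f) (c : ℝ) : IsTruncBounded H (fun w => c * f w) := by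
  obtain ⟨C, hC⟩ := hf.bound
  refine ⟨hf.memLp.const_mul c, fun n => ?_, c ^ 2 * C, fun n => ?_⟩
  · simpa only [nonlocal_const_mul] using (hf.memLp_nonlocal n).const_mul c
  · simp only [nonlocal_const_mul, mul_pow, integral_const_mul]
    exact mul_le_mul_of_nonneg_left (hC n) (sq_nonneg c)

theorem sub (hf : IsTruncBounded H f) (hg : IsTruncBounded H g) (hH : IsJumpKernel d H)
    (hd : 1 ≤ d) : IsTruncBounded H (fun w => f w - g w) := by
  obtain ⟨C, hC⟩ := hf.bound
  obtain ⟨C', hC'⟩ := hg.bound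
  have nonlocal_eq (n : ℕ) : nonlocal (jumpSeq H n) (fun w => f w - g w) =ᵐ[volume]
      fun w => nonlocal (jumpSeq H n) f w - nonlocal (jumpSeq H n) g w := by
    have := hH.isFiniteMeasure_jumpSeq hd n
    filter_upwards [ae_integrable_comp_sub (κ := jumpSeq H n) hf.memLp,
      ae_integrable_comp_sub (κ := jumpSeq H n) hg.memLp] with w integrable_f integrable_g
    exact nonlocal_sub integrable_f integrable_g
  refine ⟨hf.memLp.sub hg.memLp, fun n => ?_, 2 * C + 2 * C', fun n => ?_⟩
  · exact ((hf.memLp_nonlocal n).sub (hg.memLp_nonlocal n)).ae_eq (nonlocal_eq n).symm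
  · calc ∫ w, nonlocal (jumpSeq H n) (fun w => f w - g w) w ^ 2
        = ∫ w, (nonlocal (jumpSeq H n) f w - nonlocal (jumpSeq H n) g w) ^ 2 :=
          integral_congr_ae ((nonlocal_eq n).mono fun _ hw => congrArg (· ^ 2) hw)
      _ ≤ 2 * (∫ w, nonlocal (jumpSeq H n) f w ^ 2) + 2 * ∫ w, nonlocal (jumpSeq H n) g w ^ 2 :=
          integral_sub_sq_le (hf.memLp_nonlocal n) (hg.memLp_nonlocal n)
      _ ≤ 2 * C + 2 * C' := by linarith [hC n, hC' n]

end IsTruncBounded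

end TruncBounded

/-! ### The energy of a quotient -/

section QuotientEnergy

theorem arctan_wronskian_nonneg {v v' w w' : ℝ} (hv : 0 < v) (hv' : 0 < v') :
    0 ≤ (w * v' - v * w') * (Real.arctan (w / v) - Real.arctan (w' / v')) := by
  have wronskian_eq : w * v' - v * w' = v * v' * (w / v - w' / v') := by field_simp
  rw [wronskian_eq, mul_assoc]
  refine mul_nonneg (mul_pos hv hv').le ?_
  rcases le_total (w / v) (w' / v') with h | h
  · exact mul_nonneg_of_nonpos_of_nonpos (sub_nonpos.2 h)
      (sub_nonpos.2 (Real.arctan_strictMono.monotone h))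
  · exact mul_nonneg (sub_nonneg.2 h) (sub_nonneg.2 (Real.arctan_strictMono.monotone h))

theorem div_eq_div_of_arctan_wronskian_eq_zero {v v' w w' : ℝ} (hv : v ≠ 0) (hv' : v' ≠ 0)
    (h : (w * v' - v * w') * (Real.arctan (w / v) - Real.arctan (w' / v')) = 0) :
    w / v = w' / v' := by
  rcases mul_eq_zero.1 h with wronskian_eq | arctan_eq
  · rw [div_eq_div_iff hv hv']
    linarith
  · exact Real.arctan_strictMono.injective (sub_eq_zero.1 arctan_eq)

theorem abs_arctan_le (x : ℝ) : |Real.arctan x| ≤ Real.pi / 2 :=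
  abs_le.2 ⟨(Real.neg_pi_div_two_lt_arctan x).le, (Real.arctan_lt_pi_div_two x).le⟩

variable {α : Type*} [MeasurableSpace α] {μ : Measure α}

theorem aestronglyMeasurable_arctan_div {f g : α → ℝ} (hf : AEStronglyMeasurable f μ)
    (hg : AEStronglyMeasurable g μ) :
    AEStronglyMeasurable (fun x => Real.arctan (f x / g x)) μ :=
  (Real.measurable_arctan.comp_aemeasurable
    (hf.aemeasurable.div hg.aemeasurable)).aestronglyMeasurable

theorem memLp_arctan_mul {f g h : α → ℝ} (hf : AEStronglyMeasurable f μ)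
    (hg : AEStronglyMeasurable g μ) (hh : MemLp h 2 μ) :
    MemLp (fun x => Real.arctan (f x / g x) * h x) 2 μ :=
  hh.of_le_mul ((aestronglyMeasurable_arctan_div hf hg).mul hh.1) (ae_of_all _ fun _ =>
    (norm_mul _ _).trans_le (mul_le_mul_of_nonneg_right (abs_arctan_le _) (norm_nonneg _)))

variable {d : ℕ} {H : Cover d → ℝ} {v w Dv Dw : Cyl d → ℝ}

/-- The density of the energy of the quotient `w / v` along the jump from `p` to `p - z`. Testing
with `arctan (w / v)` rather than `w / v` makes it integrable as soon as `v` and `w` are in `L²`,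
with no lower bound on `v`. -/
def arctanEnergy (v w : Cyl d → ℝ) (p : Cyl d × Cyl d) : ℝ :=
  jumpWronskian v w p *
    (Real.arctan (w p.1 / v p.1) - Real.arctan (w (p.1 - p.2) / v (p.1 - p.2)))

theorem arctanEnergy_nonneg (hv : ∀ p, 0 < v p) (p : Cyl d × Cyl d) : 0 ≤ arctanEnergy v w p :=
  arctan_wronskian_nonneg (hv _) (hv _)

theorem integrable_arctanEnergy {κ : Measure (Cyl d)} [IsFiniteMeasure κ] (hv : MemLp v 2)
    (hw : MemLp w 2) : Integrable (arctanEnergy v w) (volume.prod κ) :=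
  integrable_jumpWronskian_mul_sub hv hw (aestronglyMeasurable_arctan_div hw.1 hv.1)
    fun _ => abs_arctan_le _

theorem tendsto_integral_arctan_mul_wronskian (hv : IsTruncBounded H v) (hw : IsTruncBounded H w)
    (hDv : ∀ᵐ p, Tendsto (fun n => nonlocal (jumpSeq H n) v p) atTop (𝓝 (Dv p)))
    (hDw : ∀ᵐ p, Tendsto (fun n => nonlocal (jumpSeq H n) w p) atTop (𝓝 (Dw p))) :
    Tendsto (fun n => ∫ p, Real.arctan (w p / v p) *
        (v p * nonlocal (jumpSeq H n) w p - w p * nonlocal (jumpSeq H n) v p)) atTop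
      (𝓝 (∫ p, Real.arctan (w p / v p) * (v p * Dw p - w p * Dv p))) := by
  obtain ⟨Cv, hCv⟩ := hv.bound
  obtain ⟨Cw, hCw⟩ := hw.bound
  have memLp_arctan_v := memLp_arctan_mul hw.memLp.1 hv.memLp.1 hv.memLp
  have memLp_arctan_w := memLp_arctan_mul hw.memLp.1 hv.memLp.1 hw.memLp
  have integral_eq {D D' : Cyl d → ℝ} (hD : MemLp D 2) (hD' : MemLp D' 2) :
      ∫ p, Real.arctan (w p / v p) * (v p * D p - w p * D' p) =
        (∫ p, D p * (Real.arctan (w p / v p) * v p)) -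
          ∫ p, D' p * (Real.arctan (w p / v p) * w p) := by
    refine Eq.trans ?_
      (integral_sub (hD.integrable_mul memLp_arctan_v) (hD'.integrable_mul memLp_arctan_w))
    congr 1 with p
    ring
  simp_rw [fun n => integral_eq (hw.memLp_nonlocal n) (hv.memLp_nonlocal n)]
  rw [integral_eq (memLp_two_of_tendsto_ae hw.memLp_nonlocal hCw hDw)
    (memLp_two_of_tendsto_ae hv.memLp_nonlocal hCv hDv)]
  exact (tendsto_integral_mul_of_tendsto_ae hw.memLp_nonlocal hCw memLp_arctan_v hDw).sub
    (tendsto_integral_mul_of_tendsto_ae hv.memLp_nonlocal hCv memLp_arctan_w hDv)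

theorem integral_arctanEnergy_le (hH : IsJumpKernel d H) (hd : 1 ≤ d) (hv : IsTruncBounded H v)
    (hw : IsTruncBounded H w) (hpos : ∀ p, 0 < v p)
    (hDv : ∀ᵐ p, Tendsto (fun n => nonlocal (jumpSeq H n) v p) atTop (𝓝 (Dv p)))
    (hDw : ∀ᵐ p, Tendsto (fun n => nonlocal (jumpSeq H n) w p) atTop (𝓝 (Dw p))) (n : ℕ) :
    ∫ p, arctanEnergy v w p ∂volume.prod (jumpSeq H n) ≤
      2 * ∫ p, Real.arctan (w p / v p) * (v p * Dw p - w p * Dv p) := by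
  have := hH.isFiniteMeasure_jumpSeq hd
  have (l : ℕ) : (jumpSeq H l).IsNegInvariant := hH.isNegInvariant_jumpTrunc _
  have energy_eq (l : ℕ) : ∫ p, arctanEnergy v w p ∂volume.prod (jumpSeq H l) =
      2 * ∫ p, Real.arctan (w p / v p) *
        (v p * nonlocal (jumpSeq H l) w p - w p * nonlocal (jumpSeq H l) v p) := by
    rw [integral_mul_wronskian hv.memLp hw.memLp
      (aestronglyMeasurable_arctan_div hw.memLp.1 hv.memLp.1) fun _ => abs_arctan_le _, ← mul_assoc,
      mul_one_div_cancel two_ne_zero, one_mul]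
    rfl
  refine ge_of_tendsto ((tendsto_integral_arctan_mul_wronskian hv hw hDv hDw).const_mul 2)
    (eventually_atTop.2 ⟨n, fun l hl => ?_⟩)
  rw [← energy_eq]
  exact integral_mono_measure (Measure.prod_mono le_rfl (jumpSeq_mono hl))
    (ae_of_all _ (arctanEnergy_nonneg hpos)) (integrable_arctanEnergy hv.memLp hw.memLp)

theorem ae_eq_zero_of_tendsto_of_integral_le {Φ : ℕ → α → ℝ} {Φ₀ : α → ℝ} {E : ℕ → ℝ}
    (hΦ : ∀ n, Integrable (Φ n) μ) (hΦ_nonneg : ∀ n x, 0 ≤ Φ n x)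
    (hE : ∀ n, ∫ x, Φ n x ∂μ ≤ E n) (hE_lim : Tendsto E atTop (𝓝 0))
    (hlim : ∀ᵐ x ∂μ, Tendsto (fun n => Φ n x) atTop (𝓝 (Φ₀ x))) : ∀ᵐ x ∂μ, Φ₀ x = 0 := by
  have fatou : ∫⁻ x, ENNReal.ofReal (Φ₀ x) ∂μ ≤ 0 := by
    calc ∫⁻ x, ENNReal.ofReal (Φ₀ x) ∂μ
        = ∫⁻ x, liminf (fun n => ENNReal.ofReal (Φ n x)) atTop ∂μ :=
          lintegral_congr_ae (hlim.mono fun x hx => (ENNReal.tendsto_ofReal hx).liminf_eq.symm)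
      _ ≤ liminf (fun n => ∫⁻ x, ENNReal.ofReal (Φ n x) ∂μ) atTop :=
          lintegral_liminf_le' fun n => (hΦ n).1.aemeasurable.ennreal_ofReal
      _ ≤ liminf (fun n => ENNReal.ofReal (E n)) atTop := by
          refine liminf_le_liminf (Eventually.of_forall fun n => ?_)
          rw [← ofReal_integral_eq_lintegral_ofReal (hΦ n) (ae_of_all _ (hΦ_nonneg n))]
          exact ENNReal.ofReal_le_ofReal (hE n)
      _ = 0 := by
          rw [(ENNReal.tendsto_ofReal hE_lim).liminf_eq, ENNReal.ofReal_zero]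
  have meas_lim : AEStronglyMeasurable Φ₀ μ :=
    aestronglyMeasurable_of_tendsto_ae _ (fun n => (hΦ n).1) hlim
  rw [nonpos_iff_eq_zero, lintegral_eq_zero_iff' meas_lim.aemeasurable.ennreal_ofReal] at fatou
  filter_upwards [fatou, hlim] with x ofReal_eq_zero hx
  exact le_antisymm (ENNReal.ofReal_eq_zero.1 ofReal_eq_zero)
    (ge_of_tendsto' hx fun n => hΦ_nonneg n x)

end QuotientEnergy

/-! ### Layer solutions and their difference quotients -/

namespace IsLayerSolution

variable {d : ℕ} {H : Cover d → ℝ} {γ : ℝ → ℝ} {u : Cyl d → ℝ}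

theorem strictMono (h : IsLayerSolution H γ u) (y : Fin (d - 1) → UnitAddCircle) :
    StrictMono fun x => u (x, y) :=
  strictMono_of_deriv_pos fun x => h.deriv_pos x y

theorem continuous_fst (h : IsLayerSolution H γ u) (y : Fin (d - 1) → UnitAddCircle) :
    Continuous fun x => u (x, y) :=
  Differentiable.continuous fun x => h.differentiable x y

theorem mem_Icc (h : IsLayerSolution H γ u) (w : Cyl d) : u w ∈ Set.Icc (-1 : ℝ) 1 :=
  ⟨(h.strictMono w.2).monotone.le_of_tendsto (h.tendsto_bot w.2) w.1,
    (h.strictMono w.2).monotone.ge_of_tendsto (h.tendsto_top w.2) w.1⟩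

theorem abs_le_one (h : IsLayerSolution H γ u) (w : Cyl d) : |u w| ≤ 1 :=
  abs_le.2 (h.mem_Icc w)

theorem ae_tendsto_nonlocal (h : IsLayerSolution H γ u) (hH : IsJumpKernel d H) (hd : 1 ≤ d) :
    ∀ᵐ w, Tendsto (fun n => nonlocal (jumpSeq H n) u w) atTop (𝓝 (-deriv γ (u w))) := by
  filter_upwards [h.solves] with w ⟨l, hasL, equation⟩
  rw [← eq_neg_of_add_eq_zero_left equation]
  exact hasL.tendsto_integral_jumpTrunc hH hd

end IsLayerSolution

namespace IsProfile

variable {d : ℕ} {η : ℝ → ℝ}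

theorem translate_sub_eq_zero (hη : IsProfile η) {t x : ℝ} (hx : 1 + |t| < |x|) :
    η (x + t) - η x = 0 := by
  have neg_le := neg_abs_le t
  have le_abs := le_abs_self t
  rcases lt_abs.1 hx with right | left
  · rw [hη.right _ (by linarith), hη.right _ (by linarith), sub_self]
  · rw [hη.left _ (by linarith), hη.left _ (by linarith), sub_self]

theorem hasCompactSupport_translate_sub (hη : IsProfile η) (t : ℝ) :
    HasCompactSupport fun x => η (x + t) - η x := by
  refine HasCompactSupport.intro (isCompact_closedBall (0 : ℝ) (1 + |t|)) fun x hx => ?_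
  rw [mem_closedBall_zero_iff, not_le, Real.norm_eq_abs] at hx
  exact hη.translate_sub_eq_zero hx

theorem deriv_eq_zero (hη : IsProfile η) {x : ℝ} (hx : x ∉ Set.Icc (-1 : ℝ) 1) :
    deriv η x = 0 := by
  rw [Set.mem_Icc, not_and_or, not_le, not_le] at hx
  rcases hx with left | right
  · have eventuallyEq : η =ᶠ[𝓝 x] fun _ => -1 :=
      (eventually_lt_nhds left).mono fun t ht => hη.left t ht.le
    rw [eventuallyEq.deriv_eq, deriv_const]
  · have eventuallyEq : η =ᶠ[𝓝 x] fun _ => 1 :=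
      (eventually_gt_nhds right).mono fun t ht => hη.right t ht.le
    rw [eventuallyEq.deriv_eq, deriv_const]

theorem exists_lipschitz (hη : IsProfile η) : ∃ L, LipschitzWith L η := by
  have compact : HasCompactSupport (deriv η) :=
    HasCompactSupport.intro isCompact_Icc fun _ => hη.deriv_eq_zero
  obtain ⟨L, hL⟩ := compact.exists_bound_of_continuous
    (hη.smooth.continuous_deriv (by simp))
  exact ⟨L.toNNReal, lipschitzWith_of_nnnorm_deriv_le (hη.smooth.differentiable (by simp))
    fun x => NNReal.coe_le_coe.1 ((hL x).trans (Real.le_coe_toNNReal L))⟩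

theorem memH_translate_sub (hη : IsProfile η) (t : ℝ) :
    MemH 1 (fun w : Cyl d => η (w.1 + t) - η w.1) :=
  memH_one_comp_fst ((hη.smooth.comp (contDiff_id.add contDiff_const)).sub hη.smooth)
    (hη.hasCompactSupport_translate_sub t)

theorem exists_integral_translate_sub_sq_le (hη : IsProfile η) :
    ∃ C, ∀ t, |t| ≤ 1 → ∫ w : Cyl d, (η (w.1 + t) - η w.1) ^ 2 ≤ C * t ^ 2 := by
  obtain ⟨L, lipschitz⟩ := hη.exists_lipschitz
  let S : Set (Cyl d) := Set.Icc (-2 : ℝ) 2 ×ˢ Set.univ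
  have measurableSet_S : MeasurableSet S := measurableSet_Icc.prod MeasurableSet.univ
  have volume_S_ne_top : volume S ≠ ⊤ := by
    rw [Measure.volume_eq_prod, Measure.prod_prod, measure_univ, mul_one, Real.volume_Icc]
    exact ENNReal.ofReal_ne_top
  refine ⟨∫ w, S.indicator (fun _ => (L : ℝ) ^ 2) w, fun t ht => ?_⟩
  rw [← integral_mul_const]
  have integrable_bound : Integrable (S.indicator fun _ => (L : ℝ) ^ 2) :=
    (integrable_indicator_iff measurableSet_S).2 (integrableOn_const volume_S_ne_top)
  refine integral_mono_of_nonneg (ae_of_all _ fun w => sq_nonneg _)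
    (integrable_bound.mul_const _) (ae_of_all _ fun w => ?_)
  by_cases hw : w ∈ S
  · have increment := lipschitz.dist_le_mul (w.1 + t) w.1
    rw [Real.dist_eq, Real.dist_eq, add_sub_cancel_left] at increment
    simp only [Set.indicator_of_mem hw]
    rw [← mul_pow, ← sq_abs, ← sq_abs (_ * t), abs_mul, NNReal.abs_eq]
    gcongr
  · have far : 1 + |t| < |w.1| := by
      refine lt_of_not_ge fun hle => hw ⟨abs_le.1 (hle.trans ?_), trivial⟩
      linarith
    simp only [hη.translate_sub_eq_zero far, Set.indicator_of_notMem hw, zero_mul]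
    norm_num

end IsProfile

section Perturbation

variable {d : ℕ} {H : Cover d → ℝ} {γ η : ℝ → ℝ} {f g u : Cyl d → ℝ}

theorem MemH.isTruncBounded (hf : MemH 1 f) (hH : IsJumpKernel d H) (hd : 1 ≤ d) :
    IsTruncBounded H f :=
  let ⟨_, spectral⟩ := hf.exists_isSpectral
  spectral.isTruncBounded hH hd

theorem IsTruncBounded.add (hf : IsTruncBounded H f) (hg : IsTruncBounded H g)
    (hH : IsJumpKernel d H) (hd : 1 ≤ d) : IsTruncBounded H (fun w => f w + g w) := by
  simpa only [neg_one_mul, sub_neg_eq_add] using hf.sub (hg.const_mul (-1)) hH hd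

theorem IsTruncBounded.diffQuot (hf : IsTruncBounded H f) (hH : IsJumpKernel d H) (hd : 1 ≤ d)
    (b : Cover d) (n : ℕ) : IsTruncBounded H (diffQuot b n f) :=
  ((hf.translate _).sub hf hH hd).const_mul _

theorem diffQuot_eq_perturbation_add (u : Cyl d → ℝ) (η : ℝ → ℝ) (b : Cover d) (n : ℕ) :
    diffQuot b n u = fun w => diffQuot b n (fun w => u w - η w.1) w +
      ((n : ℝ) + 1) * (η (w.1 + 1 / ((n : ℝ) + 1) * b.1) - η w.1) := by
  ext w
  simp only [diffQuot, proj, Prod.fst_add, Prod.smul_fst, smul_eq_mul]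
  ring

theorem isTruncBounded_diffQuot (hH : IsJumpKernel d H) (hd : 1 ≤ d) (hη : IsProfile η)
    (hu : MemH 1 fun w : Cyl d => u w - η w.1) (b : Cover d) (n : ℕ) :
    IsTruncBounded H (diffQuot b n u) := by
  rw [diffQuot_eq_perturbation_add u η]
  exact ((hu.isTruncBounded hH hd).diffQuot hH hd b n).add
    (((hη.memH_translate_sub _).isTruncBounded hH hd).const_mul _) hH hd

theorem aestronglyMeasurable_of_memH (hη : IsProfile η)
    (hu : MemH 1 fun w : Cyl d => u w - η w.1) : AEStronglyMeasurable u := by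
  have := hu.1.1.add (hη.smooth.continuous.comp continuous_fst).aestronglyMeasurable
  exact this.congr (ae_of_all _ fun w => sub_add_cancel _ _)

theorem ae_integrable_comp_sub_of_bounded {κ : Measure (Cyl d)} [IsFiniteMeasure κ] {M : ℝ}
    (hf : AEStronglyMeasurable f) (hM : ∀ w, |f w| ≤ M) :
    ∀ᵐ w, Integrable (fun z => f (w - z)) κ := by
  have meas_jump : AEStronglyMeasurable (fun p : Cyl d × Cyl d => f (p.1 - p.2))
      (volume.prod κ) :=
    hf.comp_fst.comp_measurePreserving (measurePreserving_sub_prod volume κ)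
  filter_upwards [meas_jump.prodMk_left] with w meas_section
  exact Integrable.of_bound meas_section M (ae_of_all _ fun _ => hM _)

theorem nonlocal_diffQuot {κ : Measure (Cyl d)} [IsFiniteMeasure κ] (b : Cover d) (n : ℕ)
    {w : Cyl d} (hf : Integrable (fun z => f (w - z)) κ)
    (hf_translate : Integrable
      (fun z => f (w + proj ((1 / ((n : ℝ) + 1)) • b) - z)) κ) :
    nonlocal κ (diffQuot b n f) w = diffQuot b n (nonlocal κ f) w := by
  have (a z : Cyl d) : w + a - z = w - z + a := add_sub_right_comm w a z
  simp only [this] at hf_translate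
  refine (congrFun (nonlocal_const_mul _ _ _) w).trans ?_
  rw [nonlocal_sub hf_translate hf, nonlocal_translate]
  rfl

theorem IsLayerSolution.ae_tendsto_nonlocal_diffQuot (hu : IsLayerSolution H γ u)
    (hu_meas : AEStronglyMeasurable u) (hH : IsJumpKernel d H) (hd : 1 ≤ d) (b : Cover d)
    (n : ℕ) :
    ∀ᵐ w, Tendsto (fun l => nonlocal (jumpSeq H l) (diffQuot b n u) w) atTop
      (𝓝 (-diffQuot b n (fun w => deriv γ (u w)) w)) := by
  let a : Cyl d := proj ((1 / ((n : ℝ) + 1)) • b)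
  have translation :=
    (measurePreserving_add_right (volume : Measure (Cyl d)) a).quasiMeasurePreserving
  have ae_integrable : ∀ᵐ w, ∀ l, Integrable (fun z => u (w - z)) (jumpSeq H l) :=
    ae_all_iff.2 fun l =>
      have := hH.isFiniteMeasure_jumpSeq hd l
      ae_integrable_comp_sub_of_bounded hu_meas hu.abs_le_one
  have ae_tendsto := hu.ae_tendsto_nonlocal hH hd
  filter_upwards [ae_integrable, translation.ae ae_integrable, ae_tendsto,
    translation.ae ae_tendsto] with w integrable integrable_translate tendsto tendsto_translate
  have limit_eq : -diffQuot b n (fun w => deriv γ (u w)) w =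
      ((n : ℝ) + 1) * (-deriv γ (u (w + a)) - -deriv γ (u w)) := by
    simp only [diffQuot, a]
    ring
  rw [limit_eq]
  refine ((tendsto_translate.sub tendsto).const_mul _).congr fun l => ?_
  have := hH.isFiniteMeasure_jumpSeq hd l
  exact (nonlocal_diffQuot b n (integrable l) (integrable_translate l)).symm

theorem exists_bound_diffQuot_axial (hd : 1 ≤ d) (hη : IsProfile η)
    (hu : MemH 1 fun w : Cyl d => u w - η w.1) :
    ∃ C, ∀ n : ℕ, ∫ w, diffQuot ((1, 0) : Cover d) n u w ^ 2 ≤ C := by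
  obtain ⟨m, spectral⟩ := hu.exists_isSpectral
  obtain ⟨C, profile_bound⟩ := hη.exists_integral_translate_sub_sq_le (d := d)
  refine ⟨2 * ((2 * Real.pi * (d * ‖((1, 0) : Cover d)‖)) ^ 2 *
    ∫ ν, freqNorm ν.1 ν.2 ^ 2 ∂m) + 2 * C, fun n => ?_⟩
  let t : ℝ := 1 / ((n : ℝ) + 1)
  have step_mul : ((n : ℝ) + 1) * t = 1 := mul_one_div_cancel (by positivity)
  have abs_step_le : |t| ≤ 1 := by
    rw [abs_of_pos Nat.one_div_pos_of_nat]
    exact Nat.one_div_le_one_div (Nat.zero_le n) |>.trans_eq (by norm_num)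
  have profile_quotient_bound :
      ∫ w : Cyl d, (-(((n : ℝ) + 1) * (η (w.1 + t) - η w.1))) ^ 2 ≤ C := by
    simp only [neg_sq, mul_pow, integral_const_mul]
    calc ((n : ℝ) + 1) ^ 2 * ∫ w : Cyl d, (η (w.1 + t) - η w.1) ^ 2
        ≤ ((n : ℝ) + 1) ^ 2 * (C * t ^ 2) := by gcongr; exact profile_bound t abs_step_le
      _ = C * (((n : ℝ) + 1) * t) ^ 2 := by ring
      _ = C := by rw [step_mul, one_pow, mul_one]
  rw [diffQuot_eq_perturbation_add u η]
  simp only [mul_one]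
  have := integral_sub_sq_le (spectral.memLp_diffQuot (1, 0) n)
    (((hη.memH_translate_sub t).1.const_mul ((n : ℝ) + 1)).neg)
  simp only [Pi.neg_apply, sub_neg_eq_add] at this
  exact this.trans (add_le_add
    (mul_le_mul_of_nonneg_left (spectral.integral_diffQuot_sq_le hd (1, 0) n) two_pos.le)
    (mul_le_mul_of_nonneg_left profile_quotient_bound two_pos.le))

end Perturbation

/-! ### Convergence in `L²` -/

section ConvergenceL2

variable {α : Type*} [MeasurableSpace α] {μ : Measure α}

theorem exists_subseq_tendsto_ae {f : ℕ → α → ℝ} {f₀ : α → ℝ} (hf : ∀ n, MemLp (f n) 2 μ)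
    (hf₀ : MemLp f₀ 2 μ) (hlim : Tendsto (fun n => ∫ x, (f n x - f₀ x) ^ 2 ∂μ) atTop (𝓝 0)) :
    ∃ ns : ℕ → ℕ, StrictMono ns ∧
      ∀ᵐ x ∂μ, Tendsto (fun k => f (ns k) x) atTop (𝓝 (f₀ x)) := by
  have norm_sub_sq (n : ℕ) :
      ∫ x, (f n x - f₀ x) ^ 2 ∂μ = ‖(hf n).toLp - hf₀.toLp‖ ^ 2 := by
    rw [← MemLp.toLp_sub, norm_toLp_sq]
    rfl
  simp only [norm_sub_sq] at hlim
  have tendsto_norm := hlim.sqrt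
  simp only [Real.sqrt_sq (norm_nonneg _), Real.sqrt_zero] at tendsto_norm
  exact ((tendstoInMeasure_of_tendsto_Lp (tendsto_iff_norm_sub_tendsto_zero.2 tendsto_norm)).congr
    (fun n => (hf n).coeFn_toLp) hf₀.coeFn_toLp).exists_seq_tendsto_ae

variable {K : ℝ} {f₀ : α → ℝ}

theorem memLp_bdd_mul {e f : α → ℝ} (he : AEStronglyMeasurable e μ) (hK : ∀ x, |e x| ≤ K)
    (hf : MemLp f 2 μ) : MemLp (fun x => e x * f x) 2 μ :=
  hf.of_le_mul (c := K) (he.mul hf.1) (ae_of_all _ fun x =>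
    (norm_mul _ _).trans_le (mul_le_mul_of_nonneg_right (hK x) (norm_nonneg _)))

theorem integral_bdd_mul_sq_le {e f : α → ℝ} (hK : ∀ x, |e x| ≤ K) (hf : MemLp f 2 μ) :
    ∫ x, (e x * f x) ^ 2 ∂μ ≤ K ^ 2 * ∫ x, f x ^ 2 ∂μ := by
  rw [← integral_const_mul]
  refine integral_mono_of_nonneg (ae_of_all _ fun x => sq_nonneg _)
    (hf.integrable_sq.const_mul _) (ae_of_all _ fun x => ?_)
  simp only [mul_pow]
  rw [← sq_abs (e x)]
  gcongr
  exact hK x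

theorem tendsto_integral_bdd_mul_sq {e : ℕ → α → ℝ} (he : ∀ n, AEStronglyMeasurable (e n) μ)
    (hK : ∀ n x, |e n x| ≤ K) (he_lim : ∀ᵐ x ∂μ, Tendsto (fun n => e n x) atTop (𝓝 0))
    (hf₀ : MemLp f₀ 2 μ) : Tendsto (fun n => ∫ x, (e n x * f₀ x) ^ 2 ∂μ) atTop (𝓝 0) := by
  rw [← integral_zero α ℝ (μ := μ)]
  refine tendsto_integral_of_dominated_convergence (fun x => K ^ 2 * f₀ x ^ 2)
    (fun n => ((he n).mul hf₀.1).pow 2) (hf₀.integrable_sq.const_mul _)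
    (fun n => ae_of_all _ fun x => ?_) ?_
  · rw [Real.norm_of_nonneg (sq_nonneg _), mul_pow, ← sq_abs (e n x)]
    gcongr
    exact hK n x
  · filter_upwards [he_lim] with x hx
    simpa only [zero_mul, zero_pow two_ne_zero] using (hx.mul_const (f₀ x)).pow 2

theorem tendsto_integral_bdd_mul_sq_of_tendsto {e f : ℕ → α → ℝ}
    (he : ∀ n, AEStronglyMeasurable (e n) μ) (hK : ∀ n x, |e n x| ≤ K)
    (he_lim : ∀ᵐ x ∂μ, Tendsto (fun n => e n x) atTop (𝓝 0)) (hf : ∀ n, MemLp (f n) 2 μ)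
    (hf₀ : MemLp f₀ 2 μ)
    (hlim : Tendsto (fun n => ∫ x, (f n x - f₀ x) ^ 2 ∂μ) atTop (𝓝 0)) :
    Tendsto (fun n => ∫ x, (e n x * f n x) ^ 2 ∂μ) atTop (𝓝 0) := by
  have bound_tendsto := ((hlim.const_mul (K ^ 2)).const_mul 2).add
    ((tendsto_integral_bdd_mul_sq he hK he_lim hf₀).const_mul 2)
  simp only [mul_zero, add_zero] at bound_tendsto
  refine squeeze_zero (fun n => integral_nonneg fun x => sq_nonneg _) (fun n => ?_) bound_tendsto
  have memLp_sub : MemLp (fun x => f n x - f₀ x) 2 μ := (hf n).sub hf₀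
  calc ∫ x, (e n x * f n x) ^ 2 ∂μ
      = ∫ x, (e n x * (f n x - f₀ x) - -e n x * f₀ x) ^ 2 ∂μ := by
        congr 1 with x
        ring
    _ ≤ 2 * (∫ x, (e n x * (f n x - f₀ x)) ^ 2 ∂μ) + 2 * ∫ x, (-e n x * f₀ x) ^ 2 ∂μ :=
        integral_sub_sq_le (memLp_bdd_mul (he n) (hK n) memLp_sub)
          (memLp_bdd_mul (he n).neg (fun x => (abs_neg _).trans_le (hK n x)) hf₀)
    _ ≤ 2 * (K ^ 2 * ∫ x, (f n x - f₀ x) ^ 2 ∂μ) + 2 * ∫ x, (e n x * f₀ x) ^ 2 ∂μ := by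
        simp only [neg_mul, neg_sq]
        linarith [integral_bdd_mul_sq_le (hK n) memLp_sub]

end ConvergenceL2

/-! ### Linearization along a step -/

section StepSlope

theorem measurable_dslope {g : ℝ → ℝ} (hg : Measurable g) :
    Measurable fun p : ℝ × ℝ => dslope g p.1 p.2 := by
  have dslope_eq_ite : (fun p : ℝ × ℝ => dslope g p.1 p.2) =
      fun p => if p.2 = p.1 then deriv g p.1 else (g p.2 - g p.1) / (p.2 - p.1) := by
    ext p
    split_ifs with h
    · rw [h, dslope_same]
    · rw [dslope_of_ne _ h, slope_def_field]
  rw [dslope_eq_ite]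
  exact Measurable.ite (measurableSet_eq_fun measurable_snd measurable_fst)
    ((measurable_deriv g).comp measurable_fst)
    (((hg.comp measurable_snd).sub (hg.comp measurable_fst)).div
      (measurable_snd.sub measurable_fst))

theorem exists_dslope_bound {g : ℝ → ℝ} (hg : ContDiff ℝ 1 g) (a b : ℝ) :
    ∃ M, ∀ x ∈ Set.Icc a b, ∀ y ∈ Set.Icc a b, |dslope g x y| ≤ M := by
  obtain ⟨M, hM⟩ := (isCompact_Icc (a := a) (b := b)).exists_bound_of_continuousOn
    (hg.continuous_deriv le_rfl).continuousOn
  refine ⟨M, fun x hx y hy => ?_⟩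
  rcases eq_or_ne y x with rfl | h
  · rw [dslope_same]
    exact hM _ hy
  · rw [dslope_of_ne _ h, slope_def_field, abs_div, div_le_iff₀ (abs_pos.2 (sub_ne_zero.2 h))]
    exact (convex_Icc a b).norm_image_sub_le_of_norm_deriv_le
      (fun t _ => hg.differentiable one_ne_zero t) hM hx hy

variable {d : ℕ} {H : Cover d → ℝ} {γ g : ℝ → ℝ} {u : Cyl d → ℝ} {b : Cover d} {w : Cyl d}

/-- The slope of `g` between the values of `u` at the two points entering `diffQuot b n u w`, the
coefficient in the exact linearization `diffQuot_comp`. It is `g'(u w)` where these values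
coincide. -/
def stepSlope (g : ℝ → ℝ) (u : Cyl d → ℝ) (b : Cover d) (n : ℕ) (w : Cyl d) : ℝ :=
  dslope g (u w) (u (w + proj ((1 / ((n : ℝ) + 1)) • b)))

theorem diffQuot_comp (g : ℝ → ℝ) (u : Cyl d → ℝ) (b : Cover d) (n : ℕ) (w : Cyl d) :
    diffQuot b n (fun w => g (u w)) w = stepSlope g u b n w * diffQuot b n u w := by
  rw [diffQuot, diffQuot, ← sub_smul_dslope, smul_eq_mul, stepSlope]
  ring

theorem aestronglyMeasurable_stepSlope (hg : Measurable g) (hu : AEStronglyMeasurable u)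
    (b : Cover d) (n : ℕ) : AEStronglyMeasurable (stepSlope g u b n) :=
  ((measurable_dslope hg).comp_aemeasurable (hu.aemeasurable.prodMk
    (hu.comp_quasiMeasurePreserving
      (measurePreserving_add_right _ _).quasiMeasurePreserving).aemeasurable)).aestronglyMeasurable

theorem tendsto_translate_of_tendsto_diffQuot {ns : ℕ → ℕ} (hns : Tendsto ns atTop atTop) {l : ℝ}
    (h : Tendsto (fun k => diffQuot b (ns k) u w) atTop (𝓝 l)) :
    Tendsto (fun k => u (w + proj ((1 / ((ns k : ℝ) + 1)) • b))) atTop (𝓝 (u w)) := by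
  have tendsto_step := (tendsto_one_div_add_atTop_nhds_zero_nat (𝕜 := ℝ)).comp hns
  have tendsto_add := (tendsto_step.mul h).add_const (u w)
  rw [zero_mul, zero_add] at tendsto_add
  refine tendsto_add.congr fun k => ?_
  simp only [Function.comp_apply, diffQuot]
  have : (ns k : ℝ) + 1 ≠ 0 := by positivity
  field_simp
  ring

theorem tendsto_stepSlope (hg : Differentiable ℝ g) {ns : ℕ → ℕ} (hns : Tendsto ns atTop atTop)
    {l : ℝ} (h : Tendsto (fun k => diffQuot b (ns k) u w) atTop (𝓝 l)) :
    Tendsto (fun k => stepSlope g u b (ns k) w) atTop (𝓝 (deriv g (u w))) := by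
  have continuousAt : ContinuousAt (dslope g (u w)) (u w) := continuousAt_dslope_same.2 (hg _)
  rw [ContinuousAt, dslope_same] at continuousAt
  exact continuousAt.comp (tendsto_translate_of_tendsto_diffQuot hns h)

theorem add_proj_axial (w : Cyl d) (t : ℝ) :
    w + proj (t • ((1, 0) : Cover d)) = (w.1 + t, w.2) := by
  ext <;> simp [proj]

theorem IsLayerSolution.diffQuot_axial_pos (hu : IsLayerSolution H γ u) (n : ℕ) (w : Cyl d) :
    0 < diffQuot ((1, 0) : Cover d) n u w := by
  rw [diffQuot, add_proj_axial]
  exact mul_pos n.cast_add_one_pos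
    (sub_pos.2 (hu.strictMono w.2 (lt_add_of_pos_right _ Nat.one_div_pos_of_nat)))

theorem IsLayerSolution.tendsto_diffQuot_axial (hu : IsLayerSolution H γ u) (w : Cyl d) :
    Tendsto (fun n => diffQuot ((1, 0) : Cover d) n u w) atTop
      (𝓝 (deriv (fun t => u (t, w.2)) w.1)) := by
  have tendsto_slope :=
    hasDerivAt_iff_tendsto_slope_zero.1 (hu.differentiable w.1 w.2).hasDerivAt
  have tendsto_step : Tendsto (fun n : ℕ => 1 / ((n : ℝ) + 1)) atTop (𝓝[≠] 0) :=
    tendsto_nhdsWithin_iff.2 ⟨tendsto_one_div_add_atTop_nhds_zero_nat,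
      Eventually.of_forall fun _ => Nat.one_div_pos_of_nat.ne'⟩
  refine (tendsto_slope.comp tendsto_step).congr fun n => ?_
  simp only [Function.comp_apply, one_div, inv_inv, smul_eq_mul]
  rw [diffQuot, add_proj_axial, one_div]

end StepSlope

/-! ### The Liouville argument -/

section Liouville

variable {d : ℕ} {H : Cover d → ℝ} {γ η : ℝ → ℝ} {u : Cyl d → ℝ} {b : Cover d}

theorem ae_eq_const_mul_of_arctanEnergy_eq_zero {v w : Cyl d → ℝ} (hH : IsJumpKernel d H)
    (hd : 1 ≤ d) (hv : ∀ p, v p ≠ 0)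
    (henergy : ∀ n, ∀ᵐ p ∂(volume : Measure (Cyl d)).prod (jumpSeq H n), arctanEnergy v w p = 0) :
    ∃ c, ∀ᵐ p, w p = c * v p := by
  have ratio_const : ∀ᵐ p, ∀ n, ∀ᵐ z ∂jumpSeq H n, w p / v p = w (p - z) / v (p - z) := by
    refine ae_all_iff.2 fun n => ?_
    have := hH.isFiniteMeasure_jumpSeq hd n
    exact Measure.ae_ae_of_ae_prod ((henergy n).mono fun p hp =>
      div_eq_div_of_arctan_wronskian_eq_zero (hv _) (hv _) hp)
  obtain ⟨p, hp⟩ := ratio_const.exists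
  refine ⟨w p / v p, ?_⟩
  filter_upwards [(Measure.measurePreserving_sub_left (volume : Measure (Cyl d))
    p).quasiMeasurePreserving.ae (hH.ae_of_forall_ae_jumpTrunc hp)] with q hq
  rw [sub_sub_cancel] at hq
  rw [hq, div_mul_cancel₀ _ (hv q)]

theorem tendsto_arctanEnergy {v w : ℕ → Cyl d → ℝ} {v₀ w₀ : Cyl d → ℝ} {p : Cyl d × Cyl d}
    (hv : ∀ q, Tendsto (fun k => v k q) atTop (𝓝 (v₀ q))) (hv₀ : ∀ q, v₀ q ≠ 0)
    (hw_fst : Tendsto (fun k => w k p.1) atTop (𝓝 (w₀ p.1)))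
    (hw_sub : Tendsto (fun k => w k (p.1 - p.2)) atTop (𝓝 (w₀ (p.1 - p.2)))) :
    Tendsto (fun k => arctanEnergy (v k) (w k) p) atTop (𝓝 (arctanEnergy v₀ w₀ p)) := by
  have tendsto_arctan {q : Cyl d} (hw : Tendsto (fun k => w k q) atTop (𝓝 (w₀ q))) :
      Tendsto (fun k => Real.arctan (w k q / v k q)) atTop (𝓝 (Real.arctan (w₀ q / v₀ q))) :=
    (Real.continuous_arctan.tendsto _).comp (hw.div (hv q) (hv₀ q))
  exact ((hw_fst.mul (hv _)).sub ((hv _).mul hw_sub)).mul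
    ((tendsto_arctan hw_fst).sub (tendsto_arctan hw_sub))

/-- The bounded factor measuring to what extent the difference quotients of `u` in the directions
`(1, 0)` and `b` fail to solve the same linear equation, see `arctan_mul_defect`. -/
def linearizationError (γ : ℝ → ℝ) (u : Cyl d → ℝ) (b : Cover d) (n : ℕ) (p : Cyl d) : ℝ :=
  Real.arctan (diffQuot b n u p / diffQuot (1, 0) n u p) *
    (stepSlope (deriv γ) u (1, 0) n p - stepSlope (deriv γ) u b n p)

theorem arctan_mul_defect (γ : ℝ → ℝ) (u : Cyl d → ℝ) (b : Cover d) (n : ℕ) (p : Cyl d) :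
    Real.arctan (diffQuot b n u p / diffQuot (1, 0) n u p) *
        (diffQuot (1, 0) n u p * -diffQuot b n (fun p => deriv γ (u p)) p -
          diffQuot b n u p * -diffQuot (1, 0) n (fun p => deriv γ (u p)) p) =
      diffQuot (1, 0) n u p * (linearizationError γ u b n p * diffQuot b n u p) := by
  rw [diffQuot_comp, diffQuot_comp, linearizationError]
  ring

theorem aestronglyMeasurable_diffQuot (hu : AEStronglyMeasurable u) (b : Cover d) (n : ℕ) :
    AEStronglyMeasurable (diffQuot b n u) :=
  ((hu.comp_measurePreserving (measurePreserving_add_right _ _)).sub hu).const_mul _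

theorem aestronglyMeasurable_linearizationError (hγ : Continuous (deriv γ))
    (hu : AEStronglyMeasurable u) (b : Cover d) (n : ℕ) :
    AEStronglyMeasurable (linearizationError γ u b n) :=
  (aestronglyMeasurable_arctan_div (aestronglyMeasurable_diffQuot hu b n)
    (aestronglyMeasurable_diffQuot hu _ n)).mul
    ((aestronglyMeasurable_stepSlope hγ.measurable hu _ n).sub
      (aestronglyMeasurable_stepSlope hγ.measurable hu b n))

theorem IsLayerSolution.exists_linearizationError_bound (hu : IsLayerSolution H γ u)
    (hγ : ContDiff ℝ 1 (deriv γ)) (b : Cover d) :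
    ∃ K, ∀ n p, |linearizationError γ u b n p| ≤ K := by
  obtain ⟨M, hM⟩ := exists_dslope_bound hγ (-1) 1
  have slope_bound (b : Cover d) (n : ℕ) (p : Cyl d) : |stepSlope (deriv γ) u b n p| ≤ M :=
    hM _ (hu.mem_Icc _) _ (hu.mem_Icc _)
  refine ⟨Real.pi / 2 * (M + M), fun n p => (abs_mul _ _).trans_le ?_⟩
  gcongr
  · exact abs_arctan_le _
  · exact (abs_sub _ _).trans (add_le_add (slope_bound _ n p) (slope_bound b n p))

theorem IsLayerSolution.tendsto_linearizationError (hu : IsLayerSolution H γ u)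
    (hγ : Differentiable ℝ (deriv γ)) {ns : ℕ → ℕ} (hns : Tendsto ns atTop atTop) {p : Cyl d}
    {l : ℝ} (h : Tendsto (fun k => diffQuot b (ns k) u p) atTop (𝓝 l)) :
    Tendsto (fun k => linearizationError γ u b (ns k) p) atTop (𝓝 0) := by
  have slopes := (tendsto_stepSlope hγ hns ((hu.tendsto_diffQuot_axial p).comp hns)).sub
    (tendsto_stepSlope hγ hns h)
  rw [sub_self] at slopes
  exact bdd_le_mul_tendsto_zero' (Real.pi / 2) (Eventually.of_forall fun _ => abs_arctan_le _)
    slopes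

theorem IsLayerSolution.exists_integral_arctanEnergy_diffQuot_le (hu : IsLayerSolution H γ u)
    (hH : IsJumpKernel d H) (hd : 1 ≤ d) (hγ : ContDiff ℝ 1 (deriv γ)) (hη : IsProfile η)
    (huη : MemH 1 fun w : Cyl d => u w - η w.1) (b : Cover d) :
    ∃ C, ∀ n l, ∫ p, arctanEnergy (diffQuot (1, 0) n u) (diffQuot b n u) p
        ∂volume.prod (jumpSeq H l) ≤
      2 * (√C * √(∫ p, (linearizationError γ u b n p * diffQuot b n u p) ^ 2)) := by
  obtain ⟨C, axial_bound⟩ := exists_bound_diffQuot_axial hd hη huη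
  obtain ⟨K, error_bound⟩ := hu.exists_linearizationError_bound hγ b
  have meas_u := aestronglyMeasurable_of_memH hη huη
  refine ⟨C, fun n l => ?_⟩
  have axial := isTruncBounded_diffQuot hH hd hη huη (1, 0) n
  have directional := isTruncBounded_diffQuot hH hd hη huη b n
  have energy_le := integral_arctanEnergy_le hH hd axial directional (hu.diffQuot_axial_pos n)
    (hu.ae_tendsto_nonlocal_diffQuot meas_u hH hd (1, 0) n)
    (hu.ae_tendsto_nonlocal_diffQuot meas_u hH hd b n) l
  simp only [arctan_mul_defect] at energy_le
  refine energy_le.trans (mul_le_mul_of_nonneg_left ?_ two_pos.le)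
  have memLp_error := memLp_bdd_mul
    (aestronglyMeasurable_linearizationError hγ.continuous meas_u b n) (error_bound n)
    directional.memLp
  refine ((le_abs_self _).trans (abs_integral_mul_le axial.memLp memLp_error)).trans ?_
  gcongr
  exact axial_bound n

theorem IsLayerSolution.ae_eq_const_mul_deriv (hu : IsLayerSolution H γ u)
    (hH : IsJumpKernel d H) (hd : 1 ≤ d) (hγ : ContDiff ℝ 1 (deriv γ)) (hη : IsProfile η)
    (huη : MemH 1 fun w : Cyl d => u w - η w.1) {w₀ : Cyl d → ℝ} (hw₀ : MemLp w₀ 2)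
    (hlim : Tendsto (fun n => ∫ w, (diffQuot b n u w - w₀ w) ^ 2) atTop (𝓝 0)) :
    ∃ c, ∀ᵐ w, w₀ w = c * deriv (fun t => u (t, w.2)) w.1 := by
  have memLp_axial n := (isTruncBounded_diffQuot hH hd hη huη (1, 0) n).memLp
  have memLp_directional n := (isTruncBounded_diffQuot hH hd hη huη b n).memLp
  obtain ⟨ns, strictMono_ns, ae_tendsto⟩ := exists_subseq_tendsto_ae memLp_directional hw₀ hlim
  have tendsto_ns := strictMono_ns.tendsto_atTop
  obtain ⟨C, energy_le⟩ := hu.exists_integral_arctanEnergy_diffQuot_le hH hd hγ hη huη b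
  obtain ⟨K, error_bound⟩ := hu.exists_linearizationError_bound hγ b
  have error_tendsto : Tendsto (fun k => ∫ p, (linearizationError γ u b (ns k) p *
      diffQuot b (ns k) u p) ^ 2) atTop (𝓝 0) :=
    tendsto_integral_bdd_mul_sq_of_tendsto (fun _ => aestronglyMeasurable_linearizationError
        hγ.continuous (aestronglyMeasurable_of_memH hη huη) b _) (fun _ => error_bound _)
      (ae_tendsto.mono fun _ hp =>
        hu.tendsto_linearizationError (hγ.differentiable one_ne_zero) tendsto_ns hp)
      (fun _ => memLp_directional _) hw₀ (hlim.comp tendsto_ns)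
  have energy_tendsto := (error_tendsto.sqrt.const_mul √C).const_mul 2
  simp only [Real.sqrt_zero, mul_zero] at energy_tendsto
  have deriv_ne_zero (p : Cyl d) : deriv (fun t => u (t, p.2)) p.1 ≠ 0 :=
    (hu.deriv_pos p.1 p.2).ne'
  refine ae_eq_const_mul_of_arctanEnergy_eq_zero hH hd deriv_ne_zero fun l => ?_
  have := hH.isFiniteMeasure_jumpSeq hd l
  refine ae_eq_zero_of_tendsto_of_integral_le
    (fun k => integrable_arctanEnergy (memLp_axial (ns k)) (memLp_directional (ns k)))
    (fun k => arctanEnergy_nonneg (hu.diffQuot_axial_pos _)) (fun k => energy_le (ns k) l)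
    energy_tendsto ?_
  filter_upwards [Measure.quasiMeasurePreserving_fst.ae ae_tendsto,
    (Measure.quasiMeasurePreserving_fst.comp (measurePreserving_sub_prod
      (volume : Measure (Cyl d)) (jumpSeq H l)).quasiMeasurePreserving).ae ae_tendsto]
    with p tendsto_fst tendsto_sub
  exact tendsto_arctanEnergy (fun q => (hu.tendsto_diffQuot_axial q).comp tendsto_ns)
    deriv_ne_zero tendsto_fst tendsto_sub

end Liouville

/-! ### Invariance under translations of the torus -/

section Translation

theorem eLpNorm_translate_nsmul_sub_le {G E : Type*} [AddGroup G] [MeasurableSpace G]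
    [MeasurableAdd G] {μ : Measure G} [μ.IsAddRightInvariant] [NormedAddCommGroup E] {f : G → E}
    (hf : AEStronglyMeasurable f μ) {p : ENNReal} (hp : 1 ≤ p) (a : G) (k : ℕ) :
    eLpNorm (fun w => f (w + k • a) - f w) p μ ≤ k * eLpNorm (fun w => f (w + a) - f w) p μ := by
  have translate_meas (a : G) : AEStronglyMeasurable (fun w => f (w + a) - f w) μ :=
    (hf.comp_measurePreserving (measurePreserving_add_right μ a)).sub hf
  induction k with
  | zero => simp
  | succ k ih =>
    calc eLpNorm (fun w => f (w + (k + 1) • a) - f w) p μ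
        = eLpNorm ((fun w => f (w + a) - f w) ∘ (· + k • a) +
            fun w => f (w + k • a) - f w) p μ := by
          congr 1
          ext w
          simp [succ_nsmul, add_assoc]
      _ ≤ eLpNorm ((fun w => f (w + a) - f w) ∘ (· + k • a)) p μ +
            eLpNorm (fun w => f (w + k • a) - f w) p μ :=
          eLpNorm_add_le ((translate_meas a).comp_measurePreserving
            (measurePreserving_add_right μ _)) (translate_meas _) hp
      _ ≤ eLpNorm (fun w => f (w + a) - f w) p μ + k * eLpNorm (fun w => f (w + a) - f w) p μ := by
          rw [eLpNorm_comp_measurePreserving (translate_meas a) (measurePreserving_add_right μ _)]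
          gcongr
      _ = (k + 1 : ℕ) * eLpNorm (fun w => f (w + a) - f w) p μ := by
          push_cast
          ring

theorem eLpNorm_two_eq_ofReal_sqrt {α : Type*} [MeasurableSpace α] {μ : Measure α} {g : α → ℝ}
    (hg : MemLp g 2 μ) : eLpNorm g 2 μ = ENNReal.ofReal √(∫ x, g x ^ 2 ∂μ) := by
  rw [← norm_toLp_sq hg, Real.sqrt_sq (norm_nonneg _), Lp.norm_toLp,
    ENNReal.ofReal_toReal hg.eLpNorm_ne_top]

variable {d : ℕ} {f : Cyl d → ℝ}

theorem nsmul_proj_smul_one_div (b : Cover d) (n : ℕ) :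
    (n + 1) • proj ((1 / ((n : ℝ) + 1)) • b) = proj b := by
  have scale : (n + 1) • (1 / ((n : ℝ) + 1)) • b = b := by
    rw [← Nat.cast_smul_eq_nsmul ℝ, smul_smul, Nat.cast_add_one,
      mul_one_div_cancel n.cast_add_one_ne_zero, one_smul]
  conv_rhs => rw [← scale]
  exact Prod.ext rfl (funext fun i => (AddCircle.coe_nsmul (1 : ℝ)).symm)

theorem eLpNorm_translate_sub_le_eLpNorm_diffQuot (hf : AEStronglyMeasurable f) (b : Cover d)
    (n : ℕ) : eLpNorm (fun w => f (w + proj b) - f w) 2 ≤ eLpNorm (diffQuot b n f) 2 := by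
  have iterate := eLpNorm_translate_nsmul_sub_le hf one_le_two
    (proj ((1 / ((n : ℝ) + 1)) • b)) (n + 1)
  rw [nsmul_proj_smul_one_div] at iterate
  refine iterate.trans_eq ?_
  rw [← Real.enorm_natCast, ← eLpNorm_const_smul, Nat.cast_add_one]
  rfl

theorem ae_translate_eq_of_tendsto_diffQuot {b : Cover d} (hf : MemLp f 2)
    (hlim : Tendsto (fun n => ∫ w, diffQuot b n f w ^ 2) atTop (𝓝 0)) :
    ∀ᵐ w, f (w + proj b) = f w := by
  have memLp_diffQuot (n : ℕ) : MemLp (diffQuot b n f) 2 :=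
    ((memLp_translate hf _).sub hf).const_mul _
  have tendsto_eLpNorm : Tendsto (fun n => eLpNorm (diffQuot b n f) 2) atTop (𝓝 0) := by
    simpa only [eLpNorm_two_eq_ofReal_sqrt (memLp_diffQuot _), Real.sqrt_zero,
      ENNReal.ofReal_zero] using ENNReal.tendsto_ofReal hlim.sqrt
  have eLpNorm_eq_zero : eLpNorm (fun w => f (w + proj b) - f w) 2 = 0 :=
    le_antisymm (ge_of_tendsto' tendsto_eLpNorm fun n =>
      eLpNorm_translate_sub_le_eLpNorm_diffQuot hf.1 b n) zero_le
  filter_upwards [(eLpNorm_eq_zero_iff ((memLp_translate hf _).sub hf).1 two_ne_zero).1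
    eLpNorm_eq_zero] with w hw
  exact sub_eq_zero.1 hw

end Translation

section Slab

variable {d : ℕ} {u : Cyl d → ℝ}

/-- The slab `[0,1] × 𝕋^(d-1)`, a set of finite measure invariant under translations of the
torus. -/
def slab (d : ℕ) : Set (Cyl d) := Set.Icc (0 : ℝ) 1 ×ˢ Set.univ

theorem measurableSet_slab : MeasurableSet (slab d) := measurableSet_Icc.prod MeasurableSet.univ

theorem volume_slab : volume (slab d) = 1 := by
  rw [slab, Measure.volume_eq_prod, Measure.prod_prod, measure_univ, mul_one, Real.volume_Icc,
    sub_zero, ENNReal.ofReal_one]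

instance : IsProbabilityMeasure ((volume : Measure (Cyl d)).restrict (slab d)) :=
  ⟨by rw [Measure.restrict_apply_univ, volume_slab]⟩

theorem measurePreserving_add_right_slab {a : Cyl d} (ha : a.1 = 0) :
    MeasurePreserving (· + a) (volume.restrict (slab d)) (volume.restrict (slab d)) := by
  have preimage_slab : (· + a) ⁻¹' slab d = slab d := by
    ext w
    simp [slab, ha]
  simpa only [preimage_slab] using
    (measurePreserving_add_right volume a).restrict_preimage (measurableSet_slab (d := d))

theorem setIntegral_slab_diffQuot (hu : IntegrableOn u (slab d)) {b : Cover d} (hb : b.1 = 0)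
    (n : ℕ) : ∫ w in slab d, diffQuot b n u w = 0 := by
  have translation := measurePreserving_add_right_slab (d := d)
    (a := proj ((1 / ((n : ℝ) + 1)) • b)) (by simp [proj, hb])
  have integral_translate := translation.integral_comp (measurableEmbedding_addRight _) u
  simp only [diffQuot]
  rw [integral_const_mul, integral_sub (f := fun w => u (w + _))
    (translation.integrable_comp_of_integrable hu) hu, integral_translate, sub_self, mul_zero]

end Slab

section SetIntegral

variable {α : Type*} [MeasurableSpace α] {μ : Measure α} {s : Set α}

theorem abs_setIntegral_le {g : α → ℝ} (hs : μ s ≠ ⊤) (hg : MemLp g 2 μ) :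
    |∫ x in s, g x ∂μ| ≤ √(μ.real s) * √(∫ x, g x ^ 2 ∂μ) := by
  have : IsFiniteMeasure (μ.restrict s) := isFiniteMeasure_restrict.2 hs
  have cauchy_schwarz := abs_integral_mul_le (memLp_const (1 : ℝ)) (hg.restrict s)
  simp only [one_mul, one_pow, integral_const, measureReal_restrict_apply_univ, smul_eq_mul,
    mul_one] at cauchy_schwarz
  have integral_le : ∫ x in s, g x ^ 2 ∂μ ≤ ∫ x, g x ^ 2 ∂μ :=
    setIntegral_le_integral hg.integrable_sq (ae_of_all _ fun _ => sq_nonneg _)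
  exact cauchy_schwarz.trans (by gcongr)

theorem setIntegral_eq_zero_of_tendsto_integral_sub_sq (hs : μ s ≠ ⊤) {f : ℕ → α → ℝ}
    {f₀ : α → ℝ} (hf : ∀ n, MemLp (f n) 2 μ) (hf₀ : MemLp f₀ 2 μ)
    (hlim : Tendsto (fun n => ∫ x, (f n x - f₀ x) ^ 2 ∂μ) atTop (𝓝 0))
    (hzero : ∀ n, ∫ x in s, f n x ∂μ = 0) : ∫ x in s, f₀ x ∂μ = 0 := by
  have : IsFiniteMeasure (μ.restrict s) := isFiniteMeasure_restrict.2 hs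
  have bound_tendsto := hlim.sqrt.const_mul √(μ.real s)
  rw [Real.sqrt_zero, mul_zero] at bound_tendsto
  refine abs_eq_zero.1 (le_antisymm (ge_of_tendsto' bound_tendsto fun n => ?_) (abs_nonneg _))
  calc |∫ x in s, f₀ x ∂μ|
      = |∫ x in s, (f n x - f₀ x) ∂μ| := by
        rw [integral_sub (((hf n).restrict s).integrable one_le_two)
          ((hf₀.restrict s).integrable one_le_two), hzero, zero_sub, abs_neg]
    _ ≤ √(μ.real s) * √(∫ x, (f n x - f₀ x) ^ 2 ∂μ) := abs_setIntegral_le hs ((hf n).sub hf₀)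

theorem eq_zero_of_setIntegral_eq_zero_of_ae_eq_const_mul_pos (hs : μ s ≠ 0) {f g : α → ℝ} {c : ℝ}
    (hg : ∀ x, 0 < g x) (hf : IntegrableOn f s μ) (hfg : ∀ᵐ x ∂μ, f x = c * g x)
    (hzero : ∫ x in s, f x ∂μ = 0) : c = 0 := by
  by_contra hc
  have pos : ∀ᵐ x ∂μ.restrict s, 0 < c * f x := by
    filter_upwards [ae_restrict_of_ae hfg] with x hx
    rw [hx, ← mul_assoc]
    exact mul_pos (mul_self_pos.2 hc) (hg x)
  have ae_eq_zero := (setIntegral_eq_zero_iff_of_nonneg_ae (pos.mono fun _ => le_of_lt)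
    (hf.const_mul c)).1 (by rw [integral_const_mul, hzero, mul_zero])
  have restrict_ne_zero : (ae (μ.restrict s)).NeBot :=
    ae_neBot.2 (Measure.restrict_eq_zero.not.2 hs)
  obtain ⟨x, hx, hx'⟩ := (pos.and ae_eq_zero).exists
  exact hx.ne' hx'

end SetIntegral

section Symmetry

variable {d : ℕ} {H : Cover d → ℝ} {γ η : ℝ → ℝ} {u : Cyl d → ℝ}

theorem diffQuot_sub_of_fst_eq_zero (u : Cyl d → ℝ) (η : ℝ → ℝ) {b : Cover d} (hb : b.1 = 0)
    (n : ℕ) : diffQuot b n (fun w => u w - η w.1) = diffQuot b n u := by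
  ext w
  simp [diffQuot, proj, hb]

theorem IsLayerSolution.ae_translate_eq (hu : IsLayerSolution H γ u) (hH : IsJumpKernel d H)
    (hd : 1 ≤ d) (hγ : ContDiff ℝ 1 (deriv γ)) (hη : IsProfile η)
    (huη : MemH 1 fun w : Cyl d => u w - η w.1) {b : Cover d} (hb : b.1 = 0) :
    ∀ᵐ w, u (w + proj b) = u w := by
  obtain ⟨m, spectral⟩ := huη.exists_isSpectral
  obtain ⟨w₀, memLp_limit, tendsto_limit⟩ := spectral.exists_diffQuot_limit hd b
  have memLp_quot (n : ℕ) := spectral.memLp_diffQuot b n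
  simp only [diffQuot_sub_of_fst_eq_zero u η hb] at memLp_quot tendsto_limit
  have u_integrable : IntegrableOn u (slab d) :=
    Measure.integrableOn_of_bounded (by simp [volume_slab]) (aestronglyMeasurable_of_memH hη huη)
      (ae_of_all _ hu.abs_le_one)
  have limit_mean_zero : ∫ w in slab d, w₀ w = 0 :=
    setIntegral_eq_zero_of_tendsto_integral_sub_sq (by simp [volume_slab]) memLp_quot memLp_limit
      tendsto_limit fun n => setIntegral_slab_diffQuot u_integrable hb n
  obtain ⟨c, limit_eq⟩ := hu.ae_eq_const_mul_deriv hH hd hγ hη huη memLp_limit tendsto_limit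
  obtain rfl : c = 0 := eq_zero_of_setIntegral_eq_zero_of_ae_eq_const_mul_pos
    (by simp [volume_slab]) (fun w => hu.deriv_pos w.1 w.2)
    ((memLp_limit.restrict (slab d)).integrable one_le_two) limit_eq limit_mean_zero
  have tendsto_zero : Tendsto (fun n => ∫ w, diffQuot b n (fun w => u w - η w.1) w ^ 2) atTop
      (𝓝 0) := by
    refine tendsto_limit.congr fun n => integral_congr_ae (limit_eq.mono fun w hw => ?_)
    simp only [hw, zero_mul, sub_zero, diffQuot_sub_of_fst_eq_zero u η hb]
  filter_upwards [ae_translate_eq_of_tendsto_diffQuot spectral.memLp tendsto_zero] with w hw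
  simpa [proj, hb] using hw

end Symmetry

/-! ### The profile -/

section Fubini

variable {X Y E : Type*} [MeasurableSpace X] {μ : Measure X} [SFinite μ] [AddCommGroup Y]
  [MeasurableSpace Y] [MeasurableAdd₂ Y] {ν : Measure Y} [IsProbabilityMeasure ν]
  [ν.IsAddLeftInvariant]

theorem ae_eq_integral_of_forall_ae_translate_eq [NormedAddCommGroup E] [NormedSpace ℝ E]
    [CompleteSpace E] {g : X × Y → E} (hg : StronglyMeasurable g)
    (h : ∀ y, ∀ᵐ w ∂μ.prod ν, g (w.1, w.2 + y) = g w) :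
    ∀ᵐ w ∂μ.prod ν, g w = ∫ y, g (w.1, y) ∂ν := by
  have measurableSet_eq : MeasurableSet
      {p : (X × Y) × Y | g (p.1.1, p.1.2 + p.2) = g p.1} :=
    (hg.comp_measurable (by fun_prop)).measurableSet_eq_fun (hg.comp_measurable measurable_fst)
  have ae_ae_eq : ∀ᵐ w ∂μ.prod ν, ∀ᵐ y ∂ν, g (w.1, w.2 + y) = g w :=
    (Measure.ae_ae_comm measurableSet_eq).2 (ae_of_all _ h)
  filter_upwards [ae_ae_eq] with w hw
  calc g w = ∫ _, g w ∂ν := by rw [integral_const, probReal_univ, one_smul]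
    _ = ∫ y, g (w.1, w.2 + y) ∂ν := integral_congr_ae (hw.mono fun _ => Eq.symm)
    _ = ∫ y, g (w.1, y) ∂ν := integral_add_left_eq_self (fun y => g (w.1, y)) w.2

theorem exists_forall_eq_of_forall_ae_translate_eq [TopologicalSpace X] [μ.IsOpenPosMeasure]
    {u : X × Y → ℝ} (hu : AEStronglyMeasurable u (μ.prod ν))
    (hcont : ∀ y, Continuous fun x => u (x, y))
    (h : ∀ y, ∀ᵐ w ∂μ.prod ν, u (w.1, w.2 + y) = u w) :
    ∃ y₀, ∀ᵐ y ∂ν, ∀ x, u (x, y) = u (x, y₀) := by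
  have translation (y : Y) :=
    ((MeasurePreserving.id μ).prod (measurePreserving_add_right ν y)).quasiMeasurePreserving
  have mk_translate_eq (y : Y) : ∀ᵐ w ∂μ.prod ν, hu.mk u (w.1, w.2 + y) = hu.mk u w := by
    filter_upwards [hu.ae_eq_mk, (translation y).ae hu.ae_eq_mk, h y] with w hw hwy huy
    exact hwy.symm.trans (huy.trans hw)
  have ae_eq_integral : ∀ᵐ w ∂μ.prod ν, u w = ∫ y, hu.mk u (w.1, y) ∂ν :=
    hu.ae_eq_mk.trans
      (ae_eq_integral_of_forall_ae_translate_eq hu.stronglyMeasurable_mk mk_translate_eq)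
  have ae_ae_eq : ∀ᵐ y ∂ν, ∀ᵐ x ∂μ, u (x, y) = ∫ y', hu.mk u (x, y') ∂ν :=
    Measure.ae_ae_of_ae_prod (Measure.measurePreserving_swap.quasiMeasurePreserving.ae
      ae_eq_integral)
  obtain ⟨y₀, hy₀⟩ := ae_ae_eq.exists
  refine ⟨y₀, ae_ae_eq.mono fun y hy => congrFun ?_⟩
  refine ((hcont y).ae_eq_iff_eq μ (hcont y₀)).1 ?_
  filter_upwards [hy, hy₀] with x hx hx₀
  exact hx.trans hx₀.symm

end Fubini

theorem eq_of_tendsto_integral_const_sub {α : Type*} [MeasurableSpace α] {κ : ℕ → Measure α}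
    [∀ n, IsFiniteMeasure (κ n)] (hκ : Tendsto (fun n => κ n Set.univ) atTop (𝓝 ⊤)) {f : α → ℝ}
    (hf : ∀ n, Integrable f (κ n)) {a b l l' : ℝ}
    (ha : Tendsto (fun n => ∫ x, (a - f x) ∂κ n) atTop (𝓝 l))
    (hb : Tendsto (fun n => ∫ x, (b - f x) ∂κ n) atTop (𝓝 l')) : a = b := by
  have mass_tendsto : Tendsto (fun n => (κ n).real Set.univ) atTop atTop :=
    ENNReal.tendsto_ofReal_nhds_top.1 (hκ.congr fun _ => Eq.symm ofReal_measureReal)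
  have integral_sub_eq (n : ℕ) : (∫ x, (a - f x) ∂κ n) - ∫ x, (b - f x) ∂κ n =
      (a - b) * (κ n).real Set.univ := by
    rw [integral_sub (integrable_const _) (hf n), integral_sub (integrable_const _) (hf n),
      integral_const, integral_const, smul_eq_mul, smul_eq_mul]
    ring
  have quotient_tendsto := (ha.sub hb).div_atTop mass_tendsto
  simp only [integral_sub_eq] at quotient_tendsto
  refine sub_eq_zero.1 (tendsto_nhds_unique (tendsto_const_nhds.congr' ?_) quotient_tendsto)
  filter_upwards [mass_tendsto.eventually_gt_atTop 0] with n hn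
  rw [mul_div_cancel_right₀ _ hn.ne']

section Pointwise

variable {d : ℕ} {H : Cover d → ℝ} {γ η : ℝ → ℝ} {u : Cyl d → ℝ} {φ : ℝ → ℝ}

theorem SolvesAt.exists_tendsto_integral {x : ℝ} {y : Fin (d - 1) → UnitAddCircle}
    (h : SolvesAt H γ u (x, y)) (hH : IsJumpKernel d H) (hd : 1 ≤ d)
    (hφ : ∀ᵐ y : Fin (d - 1) → UnitAddCircle, ∀ x, u (x, y) = φ x) :
    ∃ l, Tendsto (fun n => ∫ z, (u (x, y) - φ (x - z.1)) ∂jumpSeq H n) atTop (𝓝 l) := by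
  obtain ⟨l, hasL, -⟩ := h
  refine ⟨l, (hasL.tendsto_integral_jumpTrunc hH hd).congr fun n => integral_congr_ae ?_⟩
  refine (hH.jumpTrunc_absolutelyContinuous _).ae_le ?_
  filter_upwards [(Measure.quasiMeasurePreserving_snd.comp (Measure.measurePreserving_sub_left
    (volume : Measure (Cyl d)) (x, y)).quasiMeasurePreserving).ae hφ] with z hz
  exact congrArg (u (x, y) - ·) (hz (x - z.1))

/-- The mass of the kernel near the origin is infinite, so at a given `x` the principal value
`P.V. ∫ (a - φ(x - z)) K` exists for at most one value `a`. -/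
theorem eq_of_forall_solvesAt (hH : IsJumpKernel d H) (hd : 1 ≤ d) (hφ_cont : Continuous φ)
    (hφ_bdd : ∀ x, |φ x| ≤ 1) (hφ : ∀ᵐ y : Fin (d - 1) → UnitAddCircle, ∀ x, u (x, y) = φ x)
    (h : ∀ w, SolvesAt H γ u w) (x : ℝ) (y : Fin (d - 1) → UnitAddCircle) : u (x, y) = φ x := by
  obtain ⟨y₁, hy₁⟩ := hφ.exists
  obtain ⟨l, tendsto_y⟩ := (h (x, y)).exists_tendsto_integral hH hd hφ
  obtain ⟨l₁, tendsto_y₁⟩ := (h (x, y₁)).exists_tendsto_integral hH hd hφ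
  have := hH.isFiniteMeasure_jumpSeq hd
  rw [← hy₁ x]
  exact eq_of_tendsto_integral_const_sub (hH.tendsto_jumpTrunc_univ hd) (fun n =>
    Integrable.of_bound (hφ_cont.comp (continuous_const.sub
      continuous_fst)).aestronglyMeasurable 1 (ae_of_all _ fun _ => hφ_bdd _)) tendsto_y tendsto_y₁

theorem eq_of_continuous (hu : Continuous u)
    (hφ : ∀ᵐ y : Fin (d - 1) → UnitAddCircle, ∀ x, u (x, y) = φ x) (x : ℝ)
    (y : Fin (d - 1) → UnitAddCircle) : u (x, y) = φ x :=
  congrFun ((hu.comp (Continuous.prodMk_right x)).ext_on (Measure.dense_of_ae hφ)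
    continuous_const fun _ hy => hy x) y

theorem IsLayerSolution.exists_profile (hu : IsLayerSolution H γ u) (hH : IsJumpKernel d H)
    (hd : 1 ≤ d) (hγ : ContDiff ℝ 1 (deriv γ)) (hη : IsProfile η)
    (huη : MemH 1 fun w : Cyl d => u w - η w.1) :
    ∃ y₀, ∀ᵐ y : Fin (d - 1) → UnitAddCircle, ∀ x, u (x, y) = u (x, y₀) := by
  refine exists_forall_eq_of_forall_ae_translate_eq (aestronglyMeasurable_of_memH hη huη)
    hu.continuous_fst fun y => ?_
  filter_upwards [hu.ae_translate_eq hH hd hγ hη huη (b := rep ((0, y) : Cyl d)) rfl] with w hw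
  rw [proj_rep] at hw
  rw [← hw]
  exact congrArg (fun x => u (x, w.2 + y)) (add_zero w.1).symm

end Pointwise

end DeGiorgi

end

theorem mainTheorem2_general {d : ℕ} (hd : 1 ≤ d) {H : DeGiorgi.Cover d → ℝ}
    (hH : DeGiorgi.IsJumpKernel d H) {γ : ℝ → ℝ} (hγ : ContDiff ℝ 1 (deriv γ)) {η : ℝ → ℝ}
    (hη : DeGiorgi.IsProfile η) {u : DeGiorgi.Cyl d → ℝ}
    (hu : DeGiorgi.MemH 1 fun w : DeGiorgi.Cyl d => u w - η w.1)
    (hsol : DeGiorgi.IsLayerSolution H γ u) :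
    ∃ φ : ℝ → ℝ,
      (∀ᵐ w : DeGiorgi.Cyl d, u w = φ w.1) ∧
      ((Continuous u ∨ ∀ w, DeGiorgi.SolvesAt H γ u w) → ∀ x y, u (x, y) = φ x) := by
  obtain ⟨y₀, profile_eq⟩ := hsol.exists_profile hH hd hγ hη hu
  refine ⟨fun x => u (x, y₀), ?_, ?_⟩
  · filter_upwards [Measure.quasiMeasurePreserving_snd.ae profile_eq] with w hw
    exact hw w.1
  · rintro (u_continuous | solves_everywhere)
    · exact DeGiorgi.eq_of_continuous u_continuous profile_eq
    · exact DeGiorgi.eq_of_forall_solvesAt hH hd (hsol.continuous_fst y₀)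
        (fun x => hsol.abs_le_one (x, y₀)) profile_eq solves_everywhere

theorem mainTheorem2 (d : ℕ) (hd : 1 ≤ d)
    (H : DeGiorgi.Cover d → ℝ) (hH : DeGiorgi.KernelAssumptions d H)
    (γ : ℝ → ℝ) (hγ : DeGiorgi.IsDoubleWell γ)
    (η : ℝ → ℝ) (hη : DeGiorgi.IsProfile η)
    (u : DeGiorgi.Cyl d → ℝ) (hu : DeGiorgi.MemH 1 (fun w : DeGiorgi.Cyl d => u w - η w.1))
    (hsol : DeGiorgi.IsLayerSolution H γ u) :
    ∃ φ : ℝ → ℝ,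
      (∀ᵐ w : DeGiorgi.Cyl d, u w = φ w.1) ∧
      ((Continuous u ∨ ∀ w, DeGiorgi.SolvesAt H γ u w) → ∀ x y, u (x, y) = φ x) :=
  mainTheorem2_general hd hH.isJumpKernel
    ((contDiff_infty_iff_deriv.1 hγ.smooth).2.of_le (by simp)) hη hu hsol
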